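/- **Definitions.** Let $S_1,\dots,S_z$ be subsets of a finite universe $U$. A family $(C_u)_{u\in U}$ of sets $C_u\subseteq\{1,\dots,\ell\}$ with $|C_u|=w$ for all $u$ is an *$(\{S_i\},\tau)$-superimposed code* of length $\ell$ and weight $w$ if $|C_u\setminus\bigcup_{v\in S_i}C_v|\ge\tau$ for every $i$ and every $u\notin S_i$. The model of computation is the (deterministic) word RAM: a fixed program over finitely many registers and an addressable memory of words, with unit-cost load, store, conditional jump, addition, subtraction, multiplication, integer division and remainder, bitwise operations and shifts. Space is the number of memory cells in use, i.e. all addresses used lie below this number. **Theorem.** There are a word RAM program and an absolute constant $c$ such that the following holds for all integers $z,k$ with $zk\ge 2$, every rational $\varepsilon=p/q$ with integers $0<p<q$, and all sets $S_1,\dots,S_z\subseteq U=\{0,\dots,zk-1\}$ with $|S_i|\le k$ for all $i$. Given as input $z,k,p,q$ and, for each $i$, the size of $S_i$ followed by a list (in arbitrary order, without repetition) of its elements, the program outputs an integer $w$, an integer $\ell$ and all the sets $C_u$ ($u\in U$), each listed as $w$ words, of an $(\{S_i\},(1-\varepsilon)w)$-superimposed code of length $\ell$ and positive weight $w$, where $$1\le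 w\le c\,\varepsilon^{-1}\log^2|U|,\qquad \ell\le c\,\varepsilon^{-2}\,k\,\log^5|U| .$$ It halts within $c\,\varepsilon^{-1}|U|\log^2|U|$ steps, uses at most $c\,\varepsilon^{-1}|U|\log^2|U|$ memory cells (the input included), and all numbers occurring in the computation are smaller than $(|U|\,q)^c$, so that words of $O(\log(|U|\,q))$ bits suffice. -/

import Mathlib

/-! ### Superimposed codes -/

/-- `C` is an `({S i}, τ)`-superimposed code of length `ℓ` and weight `w`: every `C u` is a
`w`-element subset of `{1, …, ℓ}`, and whenever `u ∉ S i`, at least `τ` elements of `C u` lie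
outside the union of the `C v`, `v ∈ S i`. -/
structure IsSuperimposedCode {ι U : Type*} (S : ι → Finset U) (τ : ℝ) (ℓ w : ℕ)
    (C : U → Finset ℕ) : Prop where
  subset : ∀ u, C u ⊆ Finset.Icc 1 ℓ
  card_eq : ∀ u, (C u).card = w
  separated : ∀ i u, u ∉ S i → τ ≤ (((C u) \ (S i).biUnion C).card : ℝ)

/-! ### The word RAM

A deterministic random access machine with finitely many registers per program and a memory whose
cells are addressed by natural numbers. Every instruction costs one step. Arithmetic is exact; a
word length is imposed by bounding all numbers that occur during a run
(see `WordRAM.RunsWithin`), so that no overflow ever takes place. -/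

namespace WordRAM

/-- The arithmetic and bitwise operations on words. Subtraction is truncated at zero. -/
inductive BinOp
  | add | sub | mul | div | mod | land | lor | lxor | shl | shr

def BinOp.eval : BinOp → ℕ → ℕ → ℕ
  | .add, x, y => x + y
  | .sub, x, y => x - y
  | .mul, x, y => x * y
  | .div, x, y => x / y
  | .mod, x, y => x % y
  | .land, x, y => x &&& y
  | .lor, x, y => x ||| y
  | .lxor, x, y => x ^^^ y
  | .shl, x, y => x <<< y
  | .shr, x, y => x >>> y

/-- Instructions; `d`, `a`, `b` are register indices and `t` is a position in the program.
* `const d n`: put the constant `n` into register `d`;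
* `op o d a b`: put the result of `o` on registers `a` and `b` into register `d`;
* `load d a`: copy the memory cell whose address is in register `a` to register `d`;
* `store a b`: copy register `b` to the memory cell whose address is in register `a`;
* `jump t`: continue at position `t`;
* `jumpIfZero a t`: continue at position `t` if register `a` is zero. -/
inductive Instr
  | const (d n : ℕ)
  | op (o : BinOp) (d a b : ℕ)
  | load (d a : ℕ)
  | store (a b : ℕ)
  | jump (t : ℕ)
  | jumpIfZero (a t : ℕ)

/-- A program is a finite list of instructions, fixed once and for all inputs. -/
abbrev Program := List Instr

/-- A configuration: program counter, registers, memory. -/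
structure Config where
  pc : ℕ
  reg : ℕ → ℕ
  mem : ℕ → ℕ

def Instr.exec : Instr → Config → Config
  | .const d n, c => ⟨c.pc + 1, Function.update c.reg d n, c.mem⟩
  | .op o d a b, c => ⟨c.pc + 1, Function.update c.reg d (o.eval (c.reg a) (c.reg b)), c.mem⟩
  | .load d a, c => ⟨c.pc + 1, Function.update c.reg d (c.mem (c.reg a)), c.mem⟩
  | .store a b, c => ⟨c.pc + 1, c.reg, Function.update c.mem (c.reg a) (c.reg b)⟩
  | .jump t, c => ⟨t, c.reg, c.mem⟩
  | .jumpIfZero a t, c => ⟨if c.reg a = 0 then t else c.pc + 1, c.reg, c.mem⟩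

/-- The machine halts when the program counter leaves the program. -/
def Halted (P : Program) (c : Config) : Prop := P.length ≤ c.pc

/-- One step of the machine; a halted configuration does not change. -/
def step (P : Program) (c : Config) : Config :=
  match P[c.pc]? with
  | none => c
  | some i => i.exec c

/-- The configuration after `t` steps from `c`. -/
def configAt (P : Program) (c : Config) (t : ℕ) : Config := (step P)^[t] c

/-- The memory address, if any, that the next step of the machine reads or writes. -/
def accessed (P : Program) (c : Config) : Option ℕ :=
  match P[c.pc]? with
  | some (.load _ a) => some (c.reg a)
  | some (.store a _) => some (c.reg a)
  | _ => none

/-- The initial configuration on an input: the input words are in the memory cells `0, 1, 2, …`,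
and all other cells and all registers are zero. -/
def initial (input : List ℕ) : Config := ⟨0, fun _ => 0, fun a => input.getD a 0⟩

/-- On the given input, `P` halts after at most `T` steps; the input and all memory cells accessed
lie in the first `s` cells; and every register and memory cell holds a number below `W`
throughout, that is, the run needs only words of `⌈log₂ W⌉` bits. -/
structure RunsWithin (P : Program) (input : List ℕ) (T s W : ℕ) : Prop where
  halted : Halted P (configAt P (initial input) T)
  input_le : input.length ≤ s
  space : ∀ t < T, ∀ a, accessed P (configAt P (initial input) t) = some a → a < s
  word_reg : ∀ t ≤ T, ∀ r, (configAt P (initial input) t).reg r < W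
  word_mem : ∀ t ≤ T, ∀ a, (configAt P (initial input) t).mem a < W

end WordRAM

/-! ### Input and output of the construction -/

/-- The input words: `z`, `k`, the numerator `p` and the denominator `q` of `ε`, and then for each
of the `z` sets its size followed by its elements in the order in which they are listed. -/
def encodeInput (z k p q : ℕ) (L : Fin z → List (Fin (z * k))) : List ℕ :=
  z :: k :: p :: q :: (List.ofFn L).flatMap (fun l => l.length :: l.map Fin.val)

/-- The weight is returned in register `0`. -/
def outputWeight (c : WordRAM.Config) : ℕ := c.reg 0

/-- The length is returned in register `1`. -/
def outputLength (c : WordRAM.Config) : ℕ := c.reg 1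

/-- Register `2` points to a memory block in which the codewords are listed one after the other,
each as a list of `w` words, where `w` is the weight. -/
def outputCode {n : ℕ} (c : WordRAM.Config) (u : Fin n) : Finset ℕ :=
  (Finset.range (outputWeight c)).image fun j => c.mem (c.reg 2 + u * outputWeight c + j)

/-! Let `n = zk` and let `m` be the logarithm of `n` rounded up. An element `u` gets the codeword of
all triples `(f u, r, R_u(r))` with `r` modulo a prime `Q`, where `R_u` is the polynomial whose
coefficients are the base-`Q` digits of `u`, and `f` hashes into `K` buckets, `K` being a power of
two with `2k ≤ K < 4k`. Codewords from different buckets are disjoint. Two codewords from the same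
bucket share at most `m` triples, since distinct polynomials agree in few points
(`card_rsSymbol_eq_le`). If every `S_i` has at most `m + 2` elements in each bucket, then `u ∉ S_i`
loses at most `(m + 2) * m` of its `Q` triples (`card_hashedSymbol_sdiff`). This is at most `εQ`
once `Q > (m + 2)² / ε` up to rounding; Bertrand's postulate supplies a prime within a factor of
two.

The hash function is built greedily by a derandomised balancing argument (`BalancedTrees.step`). If
`c_i` elements of `S_i` have been placed and `b_i(v)` of them lie in bucket `v`, the potential is
the sum over `i` of `(K - c_i) * ∑_v 2 ^ b_i(v)`. For a bucket that is no worse than average, the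
loss of the factor `K - c_i` pays for the growth of the exponential sum, so the potential never
exceeds its initial value `zK²`. As `c_i ≤ k ≤ K / 2`, this gives `2 ^ b_i(v) ≤ 2zK < 8n` at all
times, hence `b_i(v) ≤ m + 2`.

To find a good bucket fast, each set keeps a binary tree over the buckets with subtree sums; walking
from the root to the cheaper child at least halves the weighted cost at every level
(`runs_descend`). An element in `d` sets costs `O((d + 1) log n)`, and the `d` add up to at most
`n`. By Horner's rule, the codeword of `u` comes from that of `u / Q`, already written, in `O(Q)`
steps. The naive prime search takes `O(Q²)` steps, which is `O(nQ)` if `ε⁻² < n`; if `ε⁻² ≥ n`,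
disjoint singletons are short enough.

The algorithm is written in a small structured language. A verified compiler (`Cmd.compile_correct`)
carries correctness, time, space and word length over to the RAM, and a calculus of postconditions
(`Runs`) verifies the structured program. -/

namespace WordRAM

/-! ### A structured language over the word RAM -/

/-- The variables of the structured programs; the first three hold the results. -/
inductive Var
  | weight | length | base | numSets | maxSize | num | den | univ | leaves | log | comp | pos
  | divisor | count | elt | idx | node | left | right | link | ptr | inc | row | heads | trees
  deriving DecidableEq

/-- The register that holds a variable. -/
def Var.index : Var → ℕ
  | weight => 0 | length => 1 | base => 2 | numSets => 3 | maxSize => 4 | num => 5 | den => 6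
  | univ => 7 | leaves => 8 | log => 9 | comp => 10 | pos => 11 | divisor => 12 | count => 13
  | elt => 14 | idx => 15 | node => 16 | left => 17 | right => 18 | link => 19 | ptr => 20
  | inc => 21 | row => 22 | heads => 23 | trees => 24

/-- The first register that is used for temporary results. -/
def firstTemp : ℕ := 25

theorem Var.index_lt (x : Var) : x.index < firstTemp := by
  cases x <;> decide

theorem Var.index_injective : Function.Injective Var.index := by
  intro x y h
  cases x <;> cases y <;> first | rfl | (exact absurd h (by decide))

/-- The arithmetic operations of the structured language. -/
inductive ArithOp
  | add | sub | mul | div | mod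

def ArithOp.toBinOp : ArithOp → BinOp
  | add => .add | sub => .sub | mul => .mul | div => .div | mod => .mod

def ArithOp.eval : ArithOp → ℕ → ℕ → ℕ
  | add, x, y => x + y
  | sub, x, y => x - y
  | mul, x, y => x * y
  | div, x, y => x / y
  | mod, x, y => x % y

theorem ArithOp.toBinOp_eval (o : ArithOp) (x y : ℕ) : o.toBinOp.eval x y = o.eval x y := by
  cases o <;> rfl

/-- Each operation yields at most `(x + 1) * (y + 1) - 1`; this is why degrees simply add. -/
theorem ArithOp.eval_lt_mul (o : ArithOp) {x y a b : ℕ} (hx : x < a) (hy : y < b) :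
    o.eval x y < a * b := by
  have ha : x + 1 ≤ a := hx
  have hb : y + 1 ≤ b := hy
  have h : (x + 1) * (y + 1) ≤ a * b := Nat.mul_le_mul ha hb
  have h1 : x * y + x + y + 1 ≤ a * b := by
    calc x * y + x + y + 1 = (x + 1) * (y + 1) := by ring
      _ ≤ _ := h
  have hdiv := Nat.div_le_self x y
  have hmod := Nat.mod_le x y
  cases o <;> simp only [ArithOp.eval] <;> omega

/-- Expressions: variables, constants, arithmetic, and reading from memory. -/
inductive Expr
  | var (x : Var)
  | lit (n : ℕ)
  | op (o : ArithOp) (a b : Expr)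
  | ld (a : Expr)

/-- The state of a structured program: the values of the variables and the memory. -/
structure State where
  reg : Var → ℕ
  mem : ℕ → ℕ

namespace Expr

def eval (σ : State) : Expr → ℕ
  | var x => σ.reg x
  | lit n => n
  | op o a b => o.eval (a.eval σ) (b.eval σ)
  | ld a => σ.mem (a.eval σ)

/-- All memory cells that are read lie below `s`. -/
def Safe (s : ℕ) (σ : State) : Expr → Prop
  | var _ => True
  | lit _ => True
  | op _ a b => a.Safe s σ ∧ b.Safe s σ
  | ld a => a.Safe s σ ∧ a.eval σ < s

/-- The number of instructions needed for the evaluation. -/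
def cost : Expr → ℕ
  | var _ => 1
  | lit _ => 1
  | op _ a b => a.cost + b.cost + 1
  | ld a => a.cost + 1

/-- A bound for the degree of the expression as a polynomial in a bound for its inputs. -/
def deg : Expr → ℕ
  | var _ => 1
  | lit n => n + 1
  | op _ a b => a.deg + b.deg
  | ld a => a.deg

/-- Code that puts the value of an expression into register `d`, using only registers from `d`
onwards as temporary storage. -/
def compile : Expr → ℕ → Program
  | var x, d => [.op .lor d x.index x.index]
  | lit n, d => [.const d n]
  | op o a b, d => a.compile d ++ (b.compile (d + 1) ++ [.op o.toBinOp d d (d + 1)])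
  | ld a, d => a.compile d ++ [.load d d]

theorem length_compile (a : Expr) (d : ℕ) : (a.compile d).length = a.cost := by
  induction a generalizing d with
  | var x => rfl
  | lit n => rfl
  | op o a b iha ihb => simp [compile, cost, iha, ihb]; ring
  | ld a iha => simp [compile, cost, iha]

/-- Needed for loads: a loaded word is below `X` whatever the size of its address, and `X ≤ X ^
deg`. -/
theorem one_le_deg (a : Expr) : 1 ≤ a.deg := by
  induction a with
  | var x => simp [deg]
  | lit n => simp [deg]
  | op o a b iha ihb => simp only [deg]; omega
  | ld a iha => simpa [deg] using iha

end Expr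

/-- All variables and memory cells hold numbers below `X`. -/
def State.Below (X : ℕ) (σ : State) : Prop :=
  (∀ x, σ.reg x < X) ∧ ∀ a, σ.mem a < X

theorem Expr.eval_lt {X : ℕ} (hX : 2 ≤ X) {σ : State} (hσ : σ.Below X) (a : Expr) :
    a.eval σ < X ^ a.deg := by
  induction a with
  | var x => simpa [eval, deg] using hσ.1 x
  | lit n =>
    calc n < 2 ^ n := Nat.lt_two_pow_self
      _ ≤ X ^ n := Nat.pow_le_pow_left hX n
      _ ≤ X ^ (n + 1) := Nat.pow_le_pow_right (by omega) (by omega)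
  | op o a b iha ihb =>
    rw [deg, pow_add]
    exact o.eval_lt_mul iha ihb
  | ld a iha =>
    calc σ.mem (a.eval σ) < X := hσ.2 _
      _ = X ^ 1 := (pow_one X).symm
      _ ≤ X ^ a.deg := Nat.pow_le_pow_right (by omega) a.one_le_deg

/-- Structured commands; conditions hold when they are nonzero. -/
inductive Cmd
  | set (x : Var) (e : Expr)
  | put (a e : Expr)
  | seq (c₁ c₂ : Cmd)
  | ite (e : Expr) (c₁ c₂ : Cmd)
  | loop (e : Expr) (c : Cmd)

namespace Cmd

/-- The number of instructions of the compiled command. -/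
def size : Cmd → ℕ
  | set _ e => e.cost + 1
  | put a e => a.cost + e.cost + 1
  | seq c₁ c₂ => c₁.size + c₂.size
  | ite e c₁ c₂ => e.cost + c₁.size + c₂.size + 2
  | loop e c => e.cost + c.size + 2

/-- The degree only has to dominate that of every expression in the command. A loop is charged once,
because `Exec` forces each assigned value below `X`, so magnitudes do not compound over iterations.
-/
def deg : Cmd → ℕ
  | set _ e => e.deg
  | put a e => a.deg + e.deg
  | seq c₁ c₂ => c₁.deg + c₂.deg
  | ite e c₁ c₂ => e.deg + c₁.deg + c₂.deg
  | loop e c => e.deg + c.deg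

/-- The code of a command, to be placed at position `k` of a program. -/
def compile : Cmd → ℕ → Program
  | set x e, _ => e.compile firstTemp ++ [.op .lor x.index firstTemp firstTemp]
  | put a e, _ => a.compile firstTemp ++
      (e.compile (firstTemp + 1) ++ [.store firstTemp (firstTemp + 1)])
  | seq c₁ c₂, k => c₁.compile k ++ c₂.compile (k + c₁.size)
  | ite e c₁ c₂, k => e.compile firstTemp ++
      (.jumpIfZero firstTemp (k + e.cost + 1 + c₁.size + 1) ::
        (c₁.compile (k + e.cost + 1) ++
          (.jump (k + e.cost + 1 + c₁.size + 1 + c₂.size) ::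
            c₂.compile (k + e.cost + 1 + c₁.size + 1))))
  | loop e c, k => e.compile firstTemp ++
      (.jumpIfZero firstTemp (k + e.cost + 1 + c.size + 1) ::
        (c.compile (k + e.cost + 1) ++ [.jump k]))

theorem length_compile (c : Cmd) (k : ℕ) : (c.compile k).length = c.size := by
  induction c generalizing k with
  | set x e => simp [compile, size, Expr.length_compile]
  | put a e => simp [compile, size, Expr.length_compile]; ring
  | seq c₁ c₂ h₁ h₂ => simp [compile, size, h₁, h₂]
  | ite e c₁ c₂ h₁ h₂ => simp [compile, size, h₁, h₂, Expr.length_compile]; ring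
  | loop e c h => simp [compile, size, h, Expr.length_compile]; ring

end Cmd

def State.set (σ : State) (x : Var) (v : ℕ) : State := ⟨Function.update σ.reg x v, σ.mem⟩

def State.put (σ : State) (a v : ℕ) : State := ⟨σ.reg, Function.update σ.mem a v⟩

/-- `Exec X s c σ t σ'`: the command `c` leads from `σ` to `σ'` in `t` steps, accesses only memory
cells below `s` and assigns only values below `X`. -/
inductive Exec (X s : ℕ) : Cmd → State → ℕ → State → Prop
  | set {x e σ} (h : e.Safe s σ) (hX : e.eval σ < X) :
      Exec X s (.set x e) σ (e.cost + 1) (σ.set x (e.eval σ))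
  | put {a e σ} (ha : a.Safe s σ) (he : e.Safe s σ) (hs : a.eval σ < s) (hX : e.eval σ < X) :
      Exec X s (.put a e) σ (a.cost + e.cost + 1) (σ.put (a.eval σ) (e.eval σ))
  | seq {c₁ c₂ σ σ₁ σ₂ t₁ t₂} (h₁ : Exec X s c₁ σ t₁ σ₁) (h₂ : Exec X s c₂ σ₁ t₂ σ₂) :
      Exec X s (.seq c₁ c₂) σ (t₁ + t₂) σ₂
  | iteTrue {e c₁ c₂ σ σ' t} (he : e.Safe s σ) (h0 : e.eval σ ≠ 0) (h : Exec X s c₁ σ t σ') :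
      Exec X s (.ite e c₁ c₂) σ (e.cost + 1 + t + 1) σ'
  | iteFalse {e c₁ c₂ σ σ' t} (he : e.Safe s σ) (h0 : e.eval σ = 0) (h : Exec X s c₂ σ t σ') :
      Exec X s (.ite e c₁ c₂) σ (e.cost + 1 + t) σ'
  | loopTrue {e c σ σ₁ σ₂ t₁ t₂} (he : e.Safe s σ) (h0 : e.eval σ ≠ 0)
      (h₁ : Exec X s c σ t₁ σ₁) (h₂ : Exec X s (.loop e c) σ₁ t₂ σ₂) :
      Exec X s (.loop e c) σ (e.cost + 1 + t₁ + 1 + t₂) σ₂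
  | loopFalse {e c σ} (he : e.Safe s σ) (h0 : e.eval σ = 0) :
      Exec X s (.loop e c) σ (e.cost + 1) σ

/-! ### Correctness of the compiler -/

/-- All registers and memory cells hold numbers below `W`. -/
def Config.Below (W : ℕ) (c : Config) : Prop :=
  (∀ r, c.reg r < W) ∧ ∀ a, c.mem a < W

/-- `SafeRun P s W c t c'`: within `t` steps `P` gets from `c` to `c'`, accessing only memory cells
below `s` and holding only numbers below `W`. -/
inductive SafeRun (P : Program) (s W : ℕ) : Config → ℕ → Config → Prop
  | refl {c} (h : c.Below W) : SafeRun P s W c 0 c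
  | head {c c' t} (h : c.Below W) (ha : ∀ a, accessed P c = some a → a < s)
      (hr : SafeRun P s W (step P c) t c') : SafeRun P s W c (t + 1) c'

namespace SafeRun

variable {P : Program} {s W t t' : ℕ} {c c' c'' : Config}

theorem below_right (h : SafeRun P s W c t c') : c'.Below W := by
  induction h with
  | refl h => exact h
  | head _ _ _ ih => exact ih

theorem trans (h : SafeRun P s W c t c') (h' : SafeRun P s W c' t' c'') :
    SafeRun P s W c (t + t') c'' := by
  induction h with
  | refl _ => simpa using h'
  | @head c _ t h ha _ ih =>
    rw [show t + 1 + t' = (t + t') + 1 by ring]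
    exact .head h ha (ih h')

theorem single {i : Instr} (hi : P[c.pc]? = some i) (h : c.Below W) (h' : (i.exec c).Below W)
    (hl : ∀ d a, i = .load d a → c.reg a < s) (hst : ∀ a b, i = .store a b → c.reg a < s) :
    SafeRun P s W c 1 (i.exec c) := by
  have hs : step P c = i.exec c := by simp [step, hi]
  refine .head h ?_ (by rw [hs]; exact .refl h')
  intro a ha
  unfold accessed at ha
  rw [hi] at ha
  cases i <;> simp only [Option.some.injEq, reduceCtorEq] at ha
  · subst ha; exact hl _ _ rfl
  · subst ha; exact hst _ _ rfl

theorem configAt_eq (h : SafeRun P s W c t c') : configAt P c t = c' := by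
  induction h with
  | refl _ => rfl
  | head _ _ _ ih => rw [← ih]; rfl

theorem spec (h : SafeRun P s W c t c') :
    (∀ j < t, ∀ a, accessed P (configAt P c j) = some a → a < s) ∧
      ∀ j ≤ t, (configAt P c j).Below W := by
  induction h with
  | @refl c h =>
    refine ⟨fun j hj => absurd hj (Nat.not_lt_zero j), fun j hj => ?_⟩
    obtain rfl : j = 0 := by omega
    exact h
  | @head c c' t h ha _ ih =>
    refine ⟨fun j hj => ?_, fun j hj => ?_⟩
    · cases j with
      | zero => exact ha
      | succ j => exact ih.1 j (by omega)
    · cases j with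
      | zero => exact h
      | succ j => exact ih.2 j (by omega)

theorem runsWithin {input : List ℕ} (h : SafeRun P s W (initial input) t c')
    (hh : Halted P c') (hs : input.length ≤ s) : RunsWithin P input t s W where
  halted := by rw [h.configAt_eq]; exact hh
  input_le := hs
  space := h.spec.1
  word_reg j hj := (h.spec.2 j hj).1
  word_mem j hj := (h.spec.2 j hj).2

end SafeRun

/-- The program `P` contains `code` from position `k` on. -/
def CodeAt (P : Program) (k : ℕ) (code : Program) : Prop :=
  ∃ l r, P = l ++ (code ++ r) ∧ l.length = k

namespace CodeAt

variable {P code code' : Program} {k : ℕ} {i : Instr}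

theorem left (h : CodeAt P k (code ++ code')) : CodeAt P k code := by
  obtain ⟨l, r, rfl, rfl⟩ := h
  exact ⟨l, code' ++ r, by simp, rfl⟩

theorem right (h : CodeAt P k (code ++ code')) : CodeAt P (k + code.length) code' := by
  obtain ⟨l, r, rfl, rfl⟩ := h
  exact ⟨l ++ code, r, by simp, by simp⟩

theorem head (h : CodeAt P k (i :: code)) : P[k]? = some i := by
  obtain ⟨l, r, rfl, rfl⟩ := h
  simp

theorem tail (h : CodeAt P k (i :: code)) : CodeAt P (k + 1) code := by
  obtain ⟨l, r, rfl, rfl⟩ := h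
  exact ⟨l ++ [i], r, by simp, by simp⟩

end CodeAt

theorem Config.Below.update {W : ℕ} {c : Config} (h : c.Below W) {k d v : ℕ} (hv : v < W) :
    Config.Below W ⟨k, Function.update c.reg d v, c.mem⟩ := by
  refine ⟨fun r => ?_, h.2⟩
  rcases eq_or_ne r d with rfl | hr
  · simpa using hv
  · simpa [hr] using h.1 r

/-- The registers of the configuration hold the variables of the state. -/
structure Config.Matches (c : Config) (σ : State) : Prop where
  reg : ∀ x : Var, c.reg x.index = σ.reg x
  mem : c.mem = σ.mem

/-- Registers below `d` survive: the left operand waits in `d` while the right one is evaluated from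
`d + 1` on. The variables live below `firstTemp`, so temporaries never touch them. The bound `W` is
larger than `X` to accommodate intermediate values. -/
theorem Expr.compile_correct {P : Program} {X s W : ℕ} (hX : 2 ≤ X) {σ : State}
    (hσ : σ.Below X) (a : Expr) {d : ℕ} (hd : firstTemp ≤ d) {c : Config}
    (hP : CodeAt P c.pc (a.compile d)) (hc : c.Below W) (hm : c.Matches σ)
    (ha : a.Safe s σ) (hW : X ^ a.deg ≤ W) :
    ∃ c', SafeRun P s W c a.cost c' ∧ c'.pc = c.pc + a.cost ∧ c'.Matches σ ∧
      (∀ r < d, c'.reg r = c.reg r) ∧ c'.reg d = a.eval σ := by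
  induction a generalizing d c with
  | var x =>
    refine ⟨_, SafeRun.single hP.head hc ?_ (by simp) (by simp), rfl, ?_, ?_, ?_⟩
    · exact hc.update (by simpa [BinOp.eval] using hc.1 _)
    · refine ⟨fun y => ?_, hm.mem⟩
      have := y.index_lt
      simp [Instr.exec, show y.index ≠ d by omega, hm.reg]
    · intro r hr
      simp [Instr.exec, hr.ne]
    · simp [Instr.exec, BinOp.eval, Expr.eval, hm.reg]
  | lit n =>
    refine ⟨_, SafeRun.single hP.head hc ?_ (by simp) (by simp), rfl, ?_, ?_, ?_⟩
    · exact hc.update ((Expr.eval_lt hX hσ (.lit n)).trans_le hW)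
    · refine ⟨fun y => ?_, hm.mem⟩
      have := y.index_lt
      simp [Instr.exec, show y.index ≠ d by omega, hm.reg]
    · intro r hr
      simp [Instr.exec, hr.ne]
    · simp [Instr.exec, Expr.eval]
  | op o a b iha ihb =>
    have hpow {m : ℕ} (h : m ≤ a.deg + b.deg) : X ^ m ≤ W :=
      (Nat.pow_le_pow_right (by omega) h).trans hW
    rw [Expr.compile] at hP
    obtain ⟨c₁, h₁, hpc₁, hm₁, hr₁, hv₁⟩ := iha hd hP.left hc hm ha.1 (hpow (by omega))
    have hP₁ := hP.right
    rw [Expr.length_compile, ← hpc₁] at hP₁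
    obtain ⟨c₂, h₂, hpc₂, hm₂, hr₂, hv₂⟩ :=
      ihb (d := d + 1) (by omega) hP₁.left h₁.below_right hm₁ ha.2 (hpow (by omega))
    have hP₂ := hP₁.right
    rw [Expr.length_compile, ← hpc₂] at hP₂
    have hv : o.toBinOp.eval (c₂.reg d) (c₂.reg (d + 1)) = (Expr.op o a b).eval σ := by
      rw [hr₂ d (by omega), hv₁, hv₂, ArithOp.toBinOp_eval, Expr.eval]
    refine ⟨_, (h₁.trans h₂).trans (SafeRun.single hP₂.head h₂.below_right ?_ (by simp) (by simp)),
      ?_, ?_, ?_, ?_⟩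
    · refine h₂.below_right.update ?_
      rw [hv]
      exact (Expr.eval_lt hX hσ _).trans_le hW
    · simp only [Instr.exec, Expr.cost]; omega
    · refine ⟨fun y => ?_, hm₂.mem⟩
      have := y.index_lt
      simp [Instr.exec, show y.index ≠ d by omega, hm₂.reg]
    · intro r hr
      simp only [Instr.exec, Function.update_of_ne hr.ne]
      rw [hr₂ r (by omega), hr₁ r hr]
    · simpa [Instr.exec] using hv
  | ld a iha =>
    rw [Expr.compile] at hP
    obtain ⟨c₁, h₁, hpc₁, hm₁, hr₁, hv₁⟩ := iha hd hP.left hc hm ha.1 hW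
    have hP₁ := hP.right
    rw [Expr.length_compile, ← hpc₁] at hP₁
    refine ⟨_, h₁.trans (SafeRun.single hP₁.head h₁.below_right ?_ ?_ (by simp)), ?_, ?_, ?_, ?_⟩
    · exact h₁.below_right.update (h₁.below_right.2 _)
    · intro d' a' h
      cases h
      rw [hv₁]
      exact ha.2
    · simp only [Instr.exec, Expr.cost]; omega
    · refine ⟨fun y => ?_, hm₁.mem⟩
      have := y.index_lt
      simp [Instr.exec, show y.index ≠ d by omega, hm₁.reg]
    · intro r hr
      simp only [Instr.exec, Function.update_of_ne hr.ne]
      exact hr₁ r hr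
    · simp [Instr.exec, Expr.eval, hv₁, hm₁.mem]

theorem State.Below.set {X : ℕ} {σ : State} (h : σ.Below X) {x : Var} {v : ℕ} (hv : v < X) :
    (σ.set x v).Below X := by
  refine ⟨fun y => ?_, h.2⟩
  rcases eq_or_ne y x with rfl | hy
  · simpa [State.set] using hv
  · simpa [State.set, hy] using h.1 y

theorem State.Below.put {X : ℕ} {σ : State} (h : σ.Below X) {a v : ℕ} (hv : v < X) :
    (σ.put a v).Below X := by
  refine ⟨h.1, fun b => ?_⟩
  rcases eq_or_ne b a with rfl | hb
  · simpa [State.put] using hv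
  · simpa [State.put, hb] using h.2 b

/-- The induction runs over the execution rather than over the command, so that the remaining
iterations of a loop are covered by an induction hypothesis. -/
theorem Cmd.compile_correct {P : Program} {X s W t : ℕ} (hX : 2 ≤ X) {σ σ' : State} {c : Cmd}
    (h : Exec X s c σ t σ') (hσ : σ.Below X) (hW : X ^ c.deg ≤ W) {f : Config}
    (hP : CodeAt P f.pc (c.compile f.pc)) (hf : f.Below W) (hm : f.Matches σ) :
    σ'.Below X ∧ ∃ f', SafeRun P s W f t f' ∧ f'.pc = f.pc + c.size ∧ f'.Matches σ' := by
  have hpow {m m' : ℕ} (h' : X ^ m' ≤ W) (h : m ≤ m') : X ^ m ≤ W :=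
    (Nat.pow_le_pow_right (by omega) h).trans h'
  induction h generalizing f with
  | @set x e σ he hv =>
    refine ⟨hσ.set hv, ?_⟩
    rw [Cmd.compile] at hP
    obtain ⟨f₁, h₁, hpc₁, hm₁, -, hv₁⟩ := e.compile_correct hX hσ le_rfl hP.left hf hm he hW
    have hP₁ := hP.right
    rw [Expr.length_compile, ← hpc₁] at hP₁
    refine ⟨_, h₁.trans (SafeRun.single hP₁.head h₁.below_right ?_ (by simp) (by simp)), ?_, ?_⟩
    · exact h₁.below_right.update (by simpa [BinOp.eval] using h₁.below_right.1 _)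
    · simp only [Instr.exec, Cmd.size]; omega
    · refine ⟨fun y => ?_, hm₁.mem⟩
      rcases eq_or_ne y x with rfl | hy
      · simp [Instr.exec, State.set, BinOp.eval, hv₁]
      · simp [Instr.exec, State.set, hy, Var.index_injective.ne hy, hm₁.reg]
  | @put a e σ ha he hs hv =>
    refine ⟨hσ.put hv, ?_⟩
    rw [Cmd.compile] at hP
    obtain ⟨f₁, h₁, hpc₁, hm₁, -, hv₁⟩ := a.compile_correct hX hσ le_rfl hP.left hf hm ha
      (hpow hW (Nat.le_add_right _ _))
    have hP₁ := hP.right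
    rw [Expr.length_compile, ← hpc₁] at hP₁
    obtain ⟨f₂, h₂, hpc₂, hm₂, hr₂, hv₂⟩ := e.compile_correct hX hσ (Nat.le_succ _) hP₁.left
      h₁.below_right hm₁ he (hpow hW (Nat.le_add_left _ _))
    have hP₂ := hP₁.right
    rw [Expr.length_compile, ← hpc₂] at hP₂
    have hva : f₂.reg firstTemp = a.eval σ := by rw [hr₂ _ (Nat.lt_succ_self _), hv₁]
    have hve : f₂.reg (firstTemp + 1) = e.eval σ := hv₂
    refine ⟨_, (h₁.trans h₂).trans (SafeRun.single hP₂.head h₂.below_right ?_ (by simp) ?_),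
      ?_, ?_⟩
    · refine ⟨h₂.below_right.1, fun b => ?_⟩
      simp only [Instr.exec]
      rcases eq_or_ne b (f₂.reg firstTemp) with rfl | hb
      · simpa using h₂.below_right.1 _
      · simpa [hb] using h₂.below_right.2 b
    · intro a' b' h'
      cases h'
      rw [hva]
      exact hs
    · simp only [Instr.exec, Cmd.size]; omega
    · refine ⟨hm₂.reg, ?_⟩
      simp [Instr.exec, State.put, hm₂.mem, hva, hve]
  | @seq c₁ c₂ σ σ₁ σ₂ t₁ t₂ _ _ ih₁ ih₂ =>
    rw [Cmd.compile] at hP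
    obtain ⟨hσ₁, f₁, h₁, hpc₁, hm₁⟩ := ih₁ hσ (hpow hW (Nat.le_add_right _ _)) hP.left hf hm
    have hP₁ := hP.right
    rw [Cmd.length_compile, ← hpc₁] at hP₁
    obtain ⟨hσ₂, f₂, h₂, hpc₂, hm₂⟩ :=
      ih₂ hσ₁ (hpow hW (Nat.le_add_left _ _)) hP₁ h₁.below_right hm₁
    exact ⟨hσ₂, f₂, h₁.trans h₂, by rw [hpc₂, hpc₁, Cmd.size]; ring, hm₂⟩
  | @iteTrue e c₁ c₂ σ σ' t he h0 _ ih =>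
    rw [Cmd.compile] at hP
    obtain ⟨f₁, h₁, hpc₁, hm₁, -, hv₁⟩ := e.compile_correct hX hσ le_rfl hP.left hf hm he
      (hpow hW (by simp only [Cmd.deg]; omega))
    have hP₁ := hP.right
    rw [Expr.length_compile, ← hpc₁] at hP₁
    have hj := SafeRun.single (s := s) (W := W) hP₁.head h₁.below_right h₁.below_right
      (by simp) (by simp)
    simp only [Instr.exec, hv₁, if_neg h0] at hj
    obtain ⟨hσ', f₂, h₂, hpc₂, hm₂⟩ := ih hσ (hpow hW (by simp only [Cmd.deg]; omega))
      (f := ⟨f₁.pc + 1, f₁.reg, f₁.mem⟩) hP₁.tail.left h₁.below_right ⟨hm₁.reg, hm₁.mem⟩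
    have hP₂ := hP₁.tail.right
    rw [Cmd.length_compile] at hP₂
    simp only at hpc₂
    rw [← hpc₂] at hP₂
    have hj₂ := SafeRun.single (s := s) (W := W) hP₂.head h₂.below_right h₂.below_right
      (by simp) (by simp)
    refine ⟨hσ', _, ((h₁.trans hj).trans h₂).trans hj₂, ?_, ⟨hm₂.reg, hm₂.mem⟩⟩
    simp only [Instr.exec, Cmd.size]; omega
  | @iteFalse e c₁ c₂ σ σ' t he h0 _ ih =>
    rw [Cmd.compile] at hP
    obtain ⟨f₁, h₁, hpc₁, hm₁, -, hv₁⟩ := e.compile_correct hX hσ le_rfl hP.left hf hm he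
      (hpow hW (by simp only [Cmd.deg]; omega))
    have hP₁ := hP.right
    rw [Expr.length_compile, ← hpc₁] at hP₁
    have hj := SafeRun.single (s := s) (W := W) hP₁.head h₁.below_right h₁.below_right
      (by simp) (by simp)
    simp only [Instr.exec, hv₁, if_pos h0, hpc₁] at hj
    have hP₂ := hP₁.tail.right.tail
    rw [Cmd.length_compile, hpc₁] at hP₂
    obtain ⟨hσ', f₂, h₂, hpc₂, hm₂⟩ := ih hσ (hpow hW (by simp only [Cmd.deg]; omega))
      (f := ⟨f.pc + e.cost + 1 + c₁.size + 1, f₁.reg, f₁.mem⟩) hP₂ h₁.below_right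
      ⟨hm₁.reg, hm₁.mem⟩
    refine ⟨hσ', _, (h₁.trans hj).trans h₂, ?_, hm₂⟩
    rw [hpc₂]
    simp only [Cmd.size]; omega
  | @loopTrue e c σ σ₁ σ₂ t₁ t₂ he h0 _ _ ih₁ ih₂ =>
    -- The undecomposed code is kept because the closing jump returns to the head of the same loop.
    have hP₀ := hP
    rw [Cmd.compile] at hP
    obtain ⟨f₁, h₁, hpc₁, hm₁, -, hv₁⟩ := e.compile_correct hX hσ le_rfl hP.left hf hm he
      (hpow hW (by simp only [Cmd.deg]; omega))
    have hP₁ := hP.right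
    rw [Expr.length_compile, ← hpc₁] at hP₁
    have hj := SafeRun.single (s := s) (W := W) hP₁.head h₁.below_right h₁.below_right
      (by simp) (by simp)
    simp only [Instr.exec, hv₁, if_neg h0] at hj
    obtain ⟨hσ₁, f₂, h₂, hpc₂, hm₂⟩ := ih₁ hσ (hpow hW (by simp only [Cmd.deg]; omega))
      (f := ⟨f₁.pc + 1, f₁.reg, f₁.mem⟩) hP₁.tail.left h₁.below_right ⟨hm₁.reg, hm₁.mem⟩
    have hP₂ := hP₁.tail.right
    rw [Cmd.length_compile] at hP₂
    simp only at hpc₂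
    rw [← hpc₂] at hP₂
    have hj₂ := SafeRun.single (s := s) (W := W) hP₂.head h₂.below_right h₂.below_right
      (by simp) (by simp)
    obtain ⟨hσ₂, f₃, h₃, hpc₃, hm₃⟩ := ih₂ hσ₁ hW (f := ⟨f.pc, f₂.reg, f₂.mem⟩) hP₀
      h₂.below_right ⟨hm₂.reg, hm₂.mem⟩
    exact ⟨hσ₂, f₃, (((h₁.trans hj).trans h₂).trans hj₂).trans h₃, hpc₃, hm₃⟩
  | @loopFalse e c σ he h0 =>
    refine ⟨hσ, ?_⟩
    rw [Cmd.compile] at hP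
    obtain ⟨f₁, h₁, hpc₁, hm₁, -, hv₁⟩ := e.compile_correct hX hσ le_rfl hP.left hf hm he
      (hpow hW (by simp only [Cmd.deg]; omega))
    have hP₁ := hP.right
    rw [Expr.length_compile, ← hpc₁] at hP₁
    have hj := SafeRun.single (s := s) (W := W) hP₁.head h₁.below_right h₁.below_right
      (by simp) (by simp)
    simp only [Instr.exec, hv₁, if_pos h0] at hj
    refine ⟨_, h₁.trans hj, ?_, ⟨hm₁.reg, hm₁.mem⟩⟩
    simp only [Cmd.size]; omega

/-- The initial state of a structured program. -/
def State.initial (input : List ℕ) : State := ⟨fun _ => 0, fun a => input.getD a 0⟩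

theorem Exec.runsWithin {X s t : ℕ} (hX : 2 ≤ X) {input : List ℕ} {c : Cmd} {σ : State}
    (h : Exec X s c (.initial input) t σ) (hi : ∀ a ∈ input, a < X) (hs : input.length ≤ s) {W : ℕ}
    (hW : X ^ c.deg ≤ W) (hXW : X ≤ W) :
    RunsWithin (c.compile 0) input t s W ∧
      (configAt (c.compile 0) (initial input) t).Matches σ := by
  have hmem (a : ℕ) : input.getD a 0 < X := by
    rw [List.getD_eq_getElem?_getD]
    rcases lt_or_ge a input.length with ha | ha
    · simpa [ha] using hi _ (List.getElem_mem ha)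
    · simp [List.getElem?_eq_none ha]; omega
  obtain ⟨-, f, hf, hpc, hm⟩ := Cmd.compile_correct (P := c.compile 0) hX h
    ⟨fun _ => by simp only [State.initial]; omega, hmem⟩ hW (f := WordRAM.initial input)
    ⟨[], [], by simp [WordRAM.initial], rfl⟩
    ⟨fun _ => by simp only [WordRAM.initial]; omega, fun a => (hmem a).trans_le hXW⟩
    ⟨fun _ => rfl, rfl⟩
  refine ⟨hf.runsWithin ?_ hs, by rwa [hf.configAt_eq]⟩
  rw [Halted, Cmd.length_compile, hpc]
  simp [WordRAM.initial]

end WordRAM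

namespace WordRAM

/-! ### Notation for expressions and rules for structured programs -/

instance : Coe Var Expr := ⟨.var⟩
instance (n : ℕ) : OfNat Expr n := ⟨.lit n⟩
instance : Add Expr := ⟨.op .add⟩
instance : Sub Expr := ⟨.op .sub⟩
instance : Mul Expr := ⟨.op .mul⟩
instance : Div Expr := ⟨.op .div⟩
instance : Mod Expr := ⟨.op .mod⟩

namespace Expr

variable (s : ℕ) (σ : State) (a b : Expr) (x : Var) (n : ℕ)

@[simp] theorem eval_var : (var x).eval σ = σ.reg x := rfl
@[simp] theorem eval_ofNat : (no_index (OfNat.ofNat n) : Expr).eval σ = OfNat.ofNat n := rfl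
@[simp] theorem eval_ld : (ld a).eval σ = σ.mem (a.eval σ) := rfl
@[simp] theorem eval_add : (a + b).eval σ = a.eval σ + b.eval σ := rfl
@[simp] theorem eval_sub : (a - b).eval σ = a.eval σ - b.eval σ := rfl
@[simp] theorem eval_mul : (a * b).eval σ = a.eval σ * b.eval σ := rfl
@[simp] theorem eval_div : (a / b).eval σ = a.eval σ / b.eval σ := rfl
@[simp] theorem eval_mod : (a % b).eval σ = a.eval σ % b.eval σ := rfl

@[simp] theorem safe_var : (var x).Safe s σ ↔ True := Iff.rfl
@[simp] theorem safe_ofNat : (no_index (OfNat.ofNat n) : Expr).Safe s σ ↔ True := Iff.rfl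
@[simp] theorem safe_ld : (ld a).Safe s σ ↔ a.Safe s σ ∧ a.eval σ < s := Iff.rfl
@[simp] theorem safe_add : (a + b).Safe s σ ↔ a.Safe s σ ∧ b.Safe s σ := Iff.rfl
@[simp] theorem safe_sub : (a - b).Safe s σ ↔ a.Safe s σ ∧ b.Safe s σ := Iff.rfl
@[simp] theorem safe_mul : (a * b).Safe s σ ↔ a.Safe s σ ∧ b.Safe s σ := Iff.rfl
@[simp] theorem safe_div : (a / b).Safe s σ ↔ a.Safe s σ ∧ b.Safe s σ := Iff.rfl
@[simp] theorem safe_mod : (a % b).Safe s σ ↔ a.Safe s σ ∧ b.Safe s σ := Iff.rfl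

end Expr

@[simp] theorem State.set_reg (σ : State) (x y : Var) (v : ℕ) :
    (σ.set x v).reg y = if y = x then v else σ.reg y := by
  simp [State.set, Function.update_apply]

@[simp] theorem State.set_mem (σ : State) (x : Var) (v : ℕ) : (σ.set x v).mem = σ.mem := rfl

@[simp] theorem State.put_reg (σ : State) (a v : ℕ) : (σ.put a v).reg = σ.reg := rfl

@[simp] theorem State.put_mem (σ : State) (a v : ℕ) :
    (σ.put a v).mem = Function.update σ.mem a v := rfl

namespace Cmd

/-- The effect of a command without branches. -/
def after : Cmd → State → State
  | set x e, σ => σ.set x (e.eval σ)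
  | put a e, σ => σ.put (a.eval σ) (e.eval σ)
  | seq c₁ c₂, σ => c₂.after (c₁.after σ)
  -- A dummy value: `Straight` is false for branching commands.
  | _, σ => σ

/-- The command has no branches and is executed safely. -/
def Straight (X s : ℕ) : Cmd → State → Prop
  | set _ e, σ => e.Safe s σ ∧ e.eval σ < X
  | put a e, σ => (a.Safe s σ ∧ e.Safe s σ) ∧ a.eval σ < s ∧ e.eval σ < X
  | seq c₁ c₂, σ => c₁.Straight X s σ ∧ c₂.Straight X s (c₁.after σ)
  | _, _ => False

end Cmd

/-- From the state `σ`, the command halts after `t` steps in a state `σ'` with `Q t σ'`. -/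
def Runs (X s : ℕ) (c : Cmd) (σ : State) (Q : ℕ → State → Prop) : Prop :=
  ∃ t σ', Exec X s c σ t σ' ∧ Q t σ'

namespace Runs

variable {X s : ℕ} {c c₁ c₂ : Cmd} {σ : State} {Q Q' : ℕ → State → Prop} {e : Expr}

theorem mono (h : Runs X s c σ Q) (hQ : ∀ t σ', Q t σ' → Q' t σ') : Runs X s c σ Q' := by
  obtain ⟨t, σ', h, hq⟩ := h
  exact ⟨t, σ', h, hQ _ _ hq⟩

/-- Straight-line code becomes a symbolic computation: `Straight` collects all side conditions,
`after` is the result, and the time is the code size. -/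
theorem straight (h : c.Straight X s σ) (hQ : Q c.size (c.after σ)) : Runs X s c σ Q := by
  refine ⟨c.size, c.after σ, ?_, hQ⟩
  clear hQ
  induction c generalizing σ with
  | set x e => exact .set h.1 h.2
  | put a e => exact .put h.1.1 h.1.2 h.2.1 h.2.2
  | seq c₁ c₂ h₁ h₂ => exact .seq (h₁ h.1) (h₂ h.2)
  | ite e c₁ c₂ => exact h.elim
  | loop e c => exact h.elim

theorem seq (h : Runs X s c₁ σ fun t₁ σ₁ => Runs X s c₂ σ₁ fun t₂ σ₂ => Q (t₁ + t₂) σ₂) :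
    Runs X s (.seq c₁ c₂) σ Q := by
  obtain ⟨t₁, σ₁, h₁, t₂, σ₂, h₂, hq⟩ := h
  exact ⟨_, _, .seq h₁ h₂, hq⟩

theorem iteTrue (he : e.Safe s σ) (h0 : e.eval σ ≠ 0)
    (h : Runs X s c₁ σ fun t σ' => Q (e.cost + 1 + t + 1) σ') : Runs X s (.ite e c₁ c₂) σ Q := by
  obtain ⟨t, σ', h, hq⟩ := h
  exact ⟨_, _, .iteTrue he h0 h, hq⟩

theorem iteFalse (he : e.Safe s σ) (h0 : e.eval σ = 0)
    (h : Runs X s c₂ σ fun t σ' => Q (e.cost + 1 + t) σ') : Runs X s (.ite e c₁ c₂) σ Q := by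
  obtain ⟨t, σ', h, hq⟩ := h
  exact ⟨_, _, .iteFalse he h0 h, hq⟩

/-- A loop with invariant `I` whose body is executed `N` times, the `j`-th time in at most `τ j`
steps. -/
theorem loop (I : ℕ → State → Prop) (N : ℕ) (τ : ℕ → ℕ) (h0 : I 0 σ)
    (hstep : ∀ j < N, ∀ σ, I j σ → e.Safe s σ ∧ e.eval σ ≠ 0 ∧
      Runs X s c σ fun t σ' => t ≤ τ j ∧ I (j + 1) σ')
    (hend : ∀ σ, I N σ → e.Safe s σ ∧ e.eval σ = 0) :
    Runs X s (.loop e c) σ fun t σ' =>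
      t ≤ ∑ j ∈ Finset.range N, (τ j + (e.cost + 2)) + (e.cost + 1) ∧ I N σ' := by
  induction N generalizing I τ σ with
  | zero =>
    obtain ⟨h1, h2⟩ := hend σ h0
    exact ⟨_, _, .loopFalse h1 h2, by simp, h0⟩
  | succ N ih =>
    obtain ⟨h1, h2, t₁, σ₁, h₁, ht₁, hI₁⟩ := hstep 0 (Nat.succ_pos N) σ h0
    -- After one pass, the remaining loop satisfies the invariant and the time bounds shifted by
    -- one.
    obtain ⟨t₂, σ₂, h₂, ht₂, hI₂⟩ := ih (fun j => I (j + 1)) (fun j => τ (j + 1)) hI₁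
      (fun j hj => hstep (j + 1) (by omega)) hend
    refine ⟨_, _, .loopTrue h1 h2 h₁ h₂, ?_, hI₂⟩
    rw [Finset.sum_range_succ']
    omega

/-- A loop with invariant `I` whose body is executed `N` times in at most `τ` steps each. -/
theorem loop_const (I : ℕ → State → Prop) (N τ : ℕ) (h0 : I 0 σ)
    (hstep : ∀ j < N, ∀ σ, I j σ → e.Safe s σ ∧ e.eval σ ≠ 0 ∧
      Runs X s c σ fun t σ' => t ≤ τ ∧ I (j + 1) σ')
    (hend : ∀ σ, I N σ → e.Safe s σ ∧ e.eval σ = 0) :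
    Runs X s (.loop e c) σ fun t σ' =>
      t ≤ N * (τ + (e.cost + 2)) + (e.cost + 1) ∧ I N σ' := by
  refine (loop I N (fun _ => τ) h0 hstep hend).mono fun t σ' h => ?_
  simpa using h

end Runs

/-! ### The program -/

open Var in
/-- Disjoint codewords with one element each. -/
def disjointCode : Cmd :=
  .seq (.seq (.set weight 1) (.seq (.set length univ) (.seq (.set base 0) (.set elt 0))))
    (.loop (univ - elt) (.seq (.put elt (elt + 1)) (.set elt (elt + 1))))

open Var in
/-- The number `leaves`, a power of two that is at least twice the size of the sets. -/
def computeLeaves : Cmd :=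
  .seq (.set leaves 1) (.loop (2 * maxSize - leaves) (.set leaves (2 * leaves)))

open Var in
/-- The logarithm of the size of the universe, plus two. -/
def computeLog : Cmd :=
  .seq (.seq (.set left 1) (.set log 2))
    (.loop (univ - left) (.seq (.set left (2 * left)) (.set log (log + 1))))

open Var in
/-- The weight: the first prime that is large enough. -/
def computeWeight : Cmd :=
  .seq (.seq (.set weight (log * log * den / num)) (.set comp 1))
    (.loop comp
      -- Setting `comp` to one forces a first pass, so the search starts strictly above the lower
      -- bound.
      (.seq (.seq (.set weight (weight + 1)) (.seq (.set comp 0) (.set divisor 2)))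
        (.loop (weight - divisor)
          -- Truncated subtraction: `1 - x` is one exactly when `x = 0`, so `comp` counts the
          -- divisors found.
          (.seq (.set comp (comp + (1 - weight % divisor))) (.set divisor (divisor + 1))))))

open Var in
/-- The positions of the tables. -/
def computeLayout : Cmd :=
  .seq (.set length (leaves * weight * weight))
    (.seq (.set heads (4 + numSets + univ))
      (.seq (.set trees (heads + univ)) (.set base (trees + 2 * leaves * numSets))))

open Var in
/-- For every element of the universe, the linked list of the sets that contain it. -/
def buildLists : Cmd :=
  .seq (.seq (.set pos 4) (.set idx 0))
    (.loop (numSets - idx)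
      (.seq (.seq (.set count (.ld pos)) (.set pos (pos + 1)))
        (.seq
          (.loop count
            (.seq (.set elt (.ld pos))
              -- The input cell just read is recycled as a list cell, so the lists need no memory
              -- beyond their heads.
              (.seq (.put pos (.ld (heads + elt) * numSets + idx))
                (.seq (.put (heads + elt) pos)
                  (.seq (.set pos (pos + 1)) (.set count (count - 1)))))))
          (.set idx (idx + 1)))))

open Var in
/-- The weighted numbers of collisions in the two subtrees below a node. -/
def compareSubtrees : Cmd :=
  .seq (.seq (.set left 0) (.seq (.set right 0) (.set link (.ld (heads + elt)))))
    (.loop link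
      (.seq (.set ptr (.ld link))
        (.seq (.set link (ptr / numSets))
          (.seq (.set ptr (trees + 2 * leaves * (ptr % numSets)))
            -- Cell `0` of a tree counts the elements placed so far; the weight is the factor of the
            -- potential after one more placement.
            (.seq (.set inc (leaves - 1 - .ld ptr))
              (.seq (.set left (left + inc * .ld (ptr + 2 * node)))
                (.set right (right + inc * .ld (ptr + (2 * node + 1))))))))))

open Var in
/-- Walk down the trees to a leaf that causes few collisions. -/
def descend : Cmd :=
  .seq (.set node 1)
    (.loop (leaves - node)
      -- The nested truncated subtractions give one if `left > right` and zero otherwise.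
      (.seq compareSubtrees (.set node (2 * node + (1 - (1 - (left - right)))))))

open Var in
/-- Increase the counters at the leaf and at the nodes above it. -/
def climb : Cmd :=
  .seq (.set right node)
    (.loop right
      (.seq (.put (ptr + right) (.ld (ptr + right) + inc)) (.set right (right / 2))))

open Var in
/-- Update the trees of all sets that contain the current element. -/
def updateTrees : Cmd :=
  .seq (.set link (.ld (heads + elt)))
    (.loop link
      (.seq
        (.seq (.set ptr (.ld link))
          (.seq (.set link (ptr / numSets))
            (.seq (.set ptr (trees + 2 * leaves * (ptr % numSets)))
              -- A leaf with `b` elements stores `2 ^ b - 1`, and one more element adds `2 ^ b`,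
              -- which is its old value plus one.
              (.seq (.put ptr (.ld ptr + 1)) (.set inc (.ld (ptr + node) + 1))))))
        climb))

open Var in
/-- Write the codeword of the current element. -/
def writeCodeword : Cmd :=
  .seq (.seq (.set row 0)
      (.seq (.set ptr (base + elt * weight)) (.set right (base + elt / weight * weight))))
    (.loop (weight - row)
      (.seq
        -- The symbol of `elt / weight` is recovered from its written codeword by removing the
        -- offset `1` and reducing modulo `weight`; one Horner step follows.
        (.put (ptr + row) (1 + ((node - leaves) * weight + row) * weight +
          ((.ld (right + row) - 1) % weight * row + elt % weight) % weight))
        (.set row (row + 1))))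

-- Increasing order matters: each codeword is derived from that of `elt / weight`.
open Var in
def writeCode : Cmd :=
  .seq (.set elt 0)
    (.loop (univ - elt)
      (.seq descend (.seq updateTrees (.seq writeCodeword (.set elt (elt + 1))))))

open Var in
def readParameters : Cmd :=
  .seq (.set numSets (.ld 0)) (.seq (.set maxSize (.ld 1)) (.seq (.set num (.ld 2))
    (.seq (.set den (.ld 3)) (.set univ (numSets * maxSize)))))

/-- Hashed Reed-Solomon code with balanced hash function. -/
def hashedCode : Cmd :=
  .seq computeLeaves (.seq computeLog (.seq computeWeight (.seq computeLayout
    (.seq buildLists writeCode))))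

open Var in
/-- The whole construction. -/
def construction : Cmd :=
  .seq readParameters (.ite (num * num * univ - den * den) hashedCode disjointCode)

end WordRAM

/-! ### Reed-Solomon symbols -/

/-- The `r`-th symbol of the Reed-Solomon codeword of `u` over the integers modulo `Q`: the
polynomial whose coefficients are the digits of `u` to the base `Q`, evaluated at `r`. -/
def rsSymbol (Q u r : ℕ) : ℕ := Nat.ofDigits r (Q.digits u) % Q

theorem rsSymbol_zero (Q r : ℕ) : rsSymbol Q 0 r = 0 := by simp [rsSymbol]

theorem rsSymbol_lt {Q : ℕ} (hQ : 0 < Q) (u r : ℕ) : rsSymbol Q u r < Q := Nat.mod_lt _ hQ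

/-- Horner's rule, applied to the lowest digit of `u`. -/
theorem rsSymbol_eq {Q : ℕ} (hQ : 1 < Q) (u r : ℕ) :
    rsSymbol Q u r = (rsSymbol Q (u / Q) r * r + u % Q) % Q := by
  rcases Nat.eq_zero_or_pos u with rfl | hu
  · simp [rsSymbol]
  · unfold rsSymbol
    rw [Nat.digits_def' hQ hu, Nat.ofDigits_cons, add_comm, mul_comm]
    simp [Nat.add_mod, Nat.mul_mod]

-- The digits are the coefficients of a polynomial over the field `ZMod Q` that determines `u`. The
-- difference of two such polynomials is nonzero, and the rows where the symbols agree are among its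
-- roots.
open Polynomial in
theorem card_rsSymbol_eq_le {Q m u v : ℕ} (hQ : Q.Prime) (hu : u < Q ^ m) (hv : v < Q ^ m)
    (huv : u ≠ v) : ((Finset.range Q).filter fun r => rsSymbol Q u r = rsSymbol Q v r).card ≤ m := by
  have := Fact.mk hQ
  let P : ℕ → (ZMod Q)[X] := fun u => Nat.ofDigits X (Q.digits u)
  have hP (u : ℕ) : P u = C ((u % Q : ℕ) : ZMod Q) + X * P (u / Q) := by
    rcases Nat.eq_zero_or_pos u with rfl | hu
    · simp [P, Nat.ofDigits]
    · simp only [P]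
      rw [Nat.digits_def' hQ.one_lt hu, Nat.ofDigits, map_natCast]
  have hdiv {u m : ℕ} (h : u < Q ^ (m + 1)) : u / Q < Q ^ m :=
    Nat.div_lt_of_lt_mul (by rwa [pow_succ'] at h)
  -- The bound `m` instead of `m - 1` keeps the induction uniform down to `m = 0`.
  have hdeg (m : ℕ) : ∀ u < Q ^ m, (P u).natDegree ≤ m := by
    induction m with
    | zero =>
      intro u hu
      obtain rfl : u = 0 := by simpa using hu
      simp [P, Nat.ofDigits]
    | succ m ih =>
      intro u hu
      rw [hP u]
      refine natDegree_add_le_of_degree_le (by simp) (natDegree_mul_le.trans ?_)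
      have := ih _ (hdiv hu)
      have := natDegree_X_le (R := ZMod Q)
      omega
  have hinj (m : ℕ) : ∀ u < Q ^ m, ∀ v < Q ^ m, P u = P v → u = v := by
    induction m with
    | zero =>
      intro u hu v hv _
      rw [pow_zero] at hu hv
      omega
    | succ m ih =>
      intro u hu v hv h
      rw [hP u, hP v] at h
      have h0 : ((u % Q : ℕ) : ZMod Q) = ((v % Q : ℕ) : ZMod Q) := by
        simpa using congrArg (fun p => p.coeff 0) h
      have h1 : P (u / Q) = P (v / Q) := by
        rw [h0] at h
        exact mul_left_cancel₀ X_ne_zero (add_left_cancel h)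
      rw [ZMod.natCast_eq_natCast_iff', Nat.mod_mod, Nat.mod_mod] at h0
      rw [← Nat.div_add_mod u Q, ← Nat.div_add_mod v Q, h0, ih _ (hdiv hu) _ (hdiv hv) h1]
  have heval (u r : ℕ) : (P u).eval (r : ZMod Q) = (rsSymbol Q u r : ZMod Q) := by
    simp only [P, rsSymbol, ZMod.natCast_mod]
    generalize Q.digits u = l
    induction l with
    | nil => simp [Nat.ofDigits]
    | cons d l ih => simp [Nat.ofDigits, ih]
  have hne : P u - P v ≠ 0 := fun h => huv (hinj m u hu v hv (sub_eq_zero.mp h))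
  calc ((Finset.range Q).filter fun r => rsSymbol Q u r = rsSymbol Q v r).card
      ≤ (P u - P v).roots.toFinset.card := by
        refine Finset.card_le_card_of_injOn (fun r => (r : ZMod Q)) ?_ ?_
        · intro r hr
          simp only [Finset.coe_filter, Set.mem_ofPred_eq] at hr
          simp [hne, heval, hr.2]
        · intro r hr r' hr' h
          simp only [Finset.coe_filter, Finset.mem_range, Set.mem_ofPred_eq] at hr hr'
          exact Nat.ModEq.eq_of_lt_of_lt ((ZMod.natCast_eq_natCast_iff _ _ _).mp h) hr.1 hr'.1
    _ ≤ (P u - P v).roots.card := Multiset.toFinset_card_le _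
    _ ≤ (P u - P v).natDegree := card_roots' _
    _ ≤ max (P u).natDegree (P v).natDegree := natDegree_sub_le _ _
    _ ≤ m := max_le (hdeg m u hu) (hdeg m v hv)

/-- The `r`-th element of the codeword of `u`, where `f` is the hash function. -/
def hashedSymbol (Q : ℕ) (f : ℕ → ℕ) (u r : ℕ) : ℕ := 1 + (f u * Q + r) * Q + rsSymbol Q u r

/-- Bucket, row and symbol are the digits of a number in base `Q`, the bucket being the unbounded
leading digit. -/
theorem hashedSymbol_inj {Q : ℕ} (hQ : 0 < Q) {f : ℕ → ℕ} {u v r t : ℕ} (hr : r < Q) (ht : t < Q)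
    (h : hashedSymbol Q f u r = hashedSymbol Q f v t) :
    f u = f v ∧ r = t ∧ rsSymbol Q u r = rsSymbol Q v t := by
  have h1 : (f u * Q + r) * Q + rsSymbol Q u r = (f v * Q + t) * Q + rsSymbol Q v t := by
    unfold hashedSymbol at h
    omega
  have hu := rsSymbol_lt hQ u r
  have hv := rsSymbol_lt hQ v t
  have key {a b c d : ℕ} (hb : b < Q) (hd : d < Q) (h : a * Q + b = c * Q + d) :
      a = c ∧ b = d := by
    have h2 : (a * Q + b) / Q = (c * Q + d) / Q := by rw [h]
    rw [mul_comm a, mul_comm c, Nat.mul_add_div hQ, Nat.mul_add_div hQ, Nat.div_eq_of_lt hb,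
      Nat.div_eq_of_lt hd] at h2
    obtain rfl : a = c := by omega
    exact ⟨rfl, by omega⟩
  obtain ⟨h2, h3⟩ := key hu hv h1
  obtain ⟨h4, h5⟩ := key hr ht h2
  exact ⟨h4, h5, h3⟩

/-- If every set meets every fibre of the hash function in at most `B` elements, then a hashed
Reed-Solomon codeword collides with every set in few places. -/
theorem card_hashedSymbol_sdiff {Q m B : ℕ} (hQ : Q.Prime) {f : ℕ → ℕ} {T : Finset ℕ}
    (hT : ∀ v ∈ T, v < Q ^ m) {u : ℕ} (hu : u < Q ^ m) (huT : u ∉ T)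
    (hB : (T.filter fun v => f v = f u).card ≤ B) :
    Q ≤ (((Finset.range Q).image (hashedSymbol Q f u)) \
      T.biUnion fun v => (Finset.range Q).image (hashedSymbol Q f v)).card + B * m := by
  classical
  -- Collisions of `u` with `T` can occur only at rows where some `v` in the same bucket has the
  -- same symbol.
  set bad := (T.filter fun v => f v = f u).biUnion fun v =>
    (Finset.range Q).filter fun r => rsSymbol Q u r = rsSymbol Q v r with hbad
  have hcard : bad.card ≤ B * m := by
    refine (Finset.card_biUnion_le_card_mul _ _ m fun v hv => ?_).trans
      (Nat.mul_le_mul_right m hB)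
    rw [Finset.mem_filter] at hv
    exact card_rsSymbol_eq_le hQ hu (hT v hv.1) fun h => huT (h ▸ hv.1)
  have hsub : (Finset.range Q \ bad).card ≤ (((Finset.range Q).image (hashedSymbol Q f u)) \
      T.biUnion fun v => (Finset.range Q).image (hashedSymbol Q f v)).card := by
    refine Finset.card_le_card_of_injOn (hashedSymbol Q f u) ?_ ?_
    · intro r hr
      simp only [Finset.coe_sdiff, Set.mem_sdiff, Finset.mem_coe, Finset.mem_range] at hr
      simp only [Finset.coe_sdiff, Set.mem_sdiff, Finset.mem_coe, Finset.mem_image,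
        Finset.mem_range, Finset.mem_biUnion, not_exists, not_and]
      refine ⟨⟨r, hr.1, rfl⟩, fun v hv t ht h => hr.2 ?_⟩
      obtain ⟨h1, rfl, h3⟩ := hashedSymbol_inj hQ.pos ht hr.1 h
      rw [hbad, Finset.mem_biUnion]
      exact ⟨v, Finset.mem_filter.mpr ⟨hv, h1⟩,
        Finset.mem_filter.mpr ⟨Finset.mem_range.mpr ht, h3.symm⟩⟩
    · intro r hr t ht h
      simp only [Finset.coe_sdiff, Set.mem_sdiff, Finset.mem_coe, Finset.mem_range] at hr ht
      exact (hashedSymbol_inj hQ.pos hr.1 ht.1 h).2.1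
  have := Finset.le_card_sdiff bad (Finset.range Q)
  rw [Finset.card_range] at this
  omega

/-! ### BalancedTrees hash functions -/

/-- In the binary tree in which `2 * w` and `2 * w + 1` are the children of `w`, the node `w` lies
above `v` or equals `v`. -/
def IsAncestor (w v : ℕ) : Prop := ∃ j, v / 2 ^ j = w

theorem isAncestor_child_iff {w v : ℕ} (hwv : w < v) :
    IsAncestor w v ↔ IsAncestor (2 * w) v ∨ IsAncestor (2 * w + 1) v := by
  constructor
  · rintro ⟨j, hj⟩
    cases j with
    | zero => simp at hj; omega
    | succ j =>
      rw [pow_succ, ← Nat.div_div_eq_div_mul] at hj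
      rcases Nat.mod_two_eq_zero_or_one (v / 2 ^ j) with h | h
      · exact .inl ⟨j, by omega⟩
      · exact .inr ⟨j, by omega⟩
  · rintro (⟨j, hj⟩ | ⟨j, hj⟩) <;>
    · refine ⟨j + 1, ?_⟩
      rw [pow_succ, ← Nat.div_div_eq_div_mul]
      omega

theorem not_isAncestor_both {w v : ℕ} (hw : 1 ≤ w) :
    ¬(IsAncestor (2 * w) v ∧ IsAncestor (2 * w + 1) v) := by
  rintro ⟨⟨j, hj⟩, ⟨l, hl⟩⟩
  -- Of two different nodes on one path to the root, the higher is at most half the deeper; siblings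
  -- violate this.
  have key {a b x y : ℕ} (hab : a < b) (ha : v / 2 ^ a = x) (hb : v / 2 ^ b = y) : y ≤ x / 2 := by
    obtain ⟨c, rfl⟩ := Nat.exists_eq_add_of_lt hab
    rw [show a + c + 1 = a + 1 + c by ring, pow_add, ← Nat.div_div_eq_div_mul, pow_succ,
      ← Nat.div_div_eq_div_mul, ha] at hb
    exact hb ▸ Nat.div_le_self _ _
  rcases lt_trichotomy j l with h | rfl | h
  · have := key h hj hl; omega
  · omega
  · have := key h hl hj; omega

theorem isAncestor_leaf_iff {w v K : ℕ} (hw : K ≤ w) (hv : v < 2 * K) :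
    IsAncestor w v ↔ w = v := by
  refine ⟨?_, fun h => ⟨0, by simp [h]⟩⟩
  rintro ⟨j, hj⟩
  cases j with
  | zero => simpa using hj.symm
  | succ j =>
    rw [pow_succ', ← Nat.div_div_eq_div_mul] at hj
    have := Nat.div_le_self (v / 2) (2 ^ j)
    omega

/-- The state of the balancing algorithm after the elements below `u` have been hashed by `f` to
the leaves `K, …, 2 * K - 1` of a binary tree. For each `i < z`, `g i 0` counts the elements of
`S i` seen so far, and `g i v`, for `v ≥ 1`, is the sum of the numbers `2 ^ b - 1` over the leaves
below `v`, where `b` is the number of elements of `S i` at the leaf. -/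
structure BalancedTrees (S : ℕ → Finset ℕ) (z K u : ℕ) (f : ℕ → ℕ) (g : ℕ → ℕ → ℕ) : Prop where
  count : ∀ i < z, g i 0 = ((S i).filter fun x => x < u).card
  node : ∀ i < z, ∀ v, 1 ≤ v → v < K → g i v = g i (2 * v) + g i (2 * v + 1)
  leaf : ∀ i < z, ∀ v, K ≤ v → v < 2 * K →
    g i v + 1 = 2 ^ ((S i).filter fun x => x < u ∧ f x = v).card
  -- The second factor is the sum of `2 ^ b` over all `K` leaves, since each leaf contributes `2 ^ b
  -- - 1` to the root.
  potential : ∑ i ∈ Finset.range z, (K - g i 0) * (g i 1 + K) ≤ z * (K * K)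

namespace BalancedTrees

variable {S : ℕ → Finset ℕ} {z K u : ℕ} {f : ℕ → ℕ} {g : ℕ → ℕ → ℕ}

theorem init (S : ℕ → Finset ℕ) (z K : ℕ) (f : ℕ → ℕ) : BalancedTrees S z K 0 f fun _ _ => 0 where
  count i _ := by simp
  node i _ v _ _ := rfl
  leaf i _ v _ _ := by simp
  potential := by simp

/-- Only the first `2 * K` cells of each tree matter. This allows `g` to be read off the memory,
where other data follow. -/
theorem congr (h : BalancedTrees S z K u f g) (hK : 1 ≤ K) {g' : ℕ → ℕ → ℕ}
    (hg : ∀ i < z, ∀ w < 2 * K, g' i w = g i w) : BalancedTrees S z K u f g' where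
  count i hi := by rw [hg i hi 0 (by omega), h.count i hi]
  node i hi v h1 h2 := by
    rw [hg i hi v (by omega), hg i hi _ (by omega), hg i hi _ (by omega), h.node i hi v h1 h2]
  leaf i hi v h1 h2 := by rw [hg i hi v h2, h.leaf i hi v h1 h2]
  potential := by
    refine le_of_eq_of_le (Finset.sum_congr rfl fun i hi => ?_) h.potential
    rw [Finset.mem_range] at hi
    rw [hg i hi 0 (by omega), hg i hi 1 (by omega)]

/-- Subtree sums grow from child to parent because all terms are nonnegative. -/
theorem le_root (h : BalancedTrees S z K u f g) {i : ℕ} (hi : i < z) {v : ℕ} (h1 : 1 ≤ v)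
    (h2 : v < 2 * K) : g i v ≤ g i 1 := by
  induction v using Nat.strong_induction_on with
  | _ v ih =>
    rcases eq_or_lt_of_le h1 with rfl | h3
    · exact le_rfl
    · have := ih (v / 2) (by omega) (by omega) (by omega)
      have hn := h.node i hi (v / 2) (by omega) (by omega)
      rcases Nat.mod_two_eq_zero_or_one v with h4 | h4
      · rw [show 2 * (v / 2) = v by omega] at hn; omega
      · rw [show 2 * (v / 2) + 1 = v by omega] at hn; omega

/-- At most `k ≤ K / 2` elements are counted, so the factor `K - g i 0` is at least `K / 2`, while
each single summand is below the bound for the whole potential. -/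
theorem root_le (h : BalancedTrees S z K u f g) {i k : ℕ} (hi : i < z) (hk : (S i).card ≤ k)
    (hK : 2 * k ≤ K) (hK0 : 0 < K) : g i 1 + K ≤ 2 * z * K := by
  have h1 : (K - g i 0) * (g i 1 + K) ≤ z * (K * K) :=
    (Finset.single_le_sum (f := fun i => (K - g i 0) * (g i 1 + K)) (fun _ _ => Nat.zero_le _)
      (Finset.mem_range.mpr hi)).trans h.potential
  have h2 : g i 0 ≤ k := by
    rw [h.count i hi]
    exact (Finset.card_filter_le _ _).trans hk
  have h3 : K ≤ 2 * (K - g i 0) := by omega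
  refine Nat.le_of_mul_le_mul_left ?_ hK0
  calc K * (g i 1 + K) ≤ 2 * (K - g i 0) * (g i 1 + K) := Nat.mul_le_mul_right _ h3
    _ = 2 * ((K - g i 0) * (g i 1 + K)) := by ring
    _ ≤ 2 * (z * (K * K)) := Nat.mul_le_mul_left _ h1
    _ = K * (2 * z * K) := by ring

theorem two_pow_load_le (h : BalancedTrees S z K u f g) {i k : ℕ} (hi : i < z) (hk : (S i).card ≤ k)
    (hK : 2 * k ≤ K) (hK0 : 0 < K) {v : ℕ} (h1 : K ≤ v) (h2 : v < 2 * K) :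
    2 ^ ((S i).filter fun x => x < u ∧ f x = v).card ≤ 2 * z * K := by
  rw [← h.leaf i hi v h1 h2]
  have := h.le_root hi (by omega) h2
  have := h.root_le hi hk hK hK0
  omega

/-- Placing the element `u` at a leaf whose weighted number of collisions is at most average. -/
theorem step (h : BalancedTrees S z K u f g) (hS : ∀ i < z, (S i).card ≤ K) {κ : ℕ} (hκ : K = 2 ^ κ)
    {v : ℕ} (hv1 : K ≤ v) (hv2 : v < 2 * K)
    (hv : K * ∑ i ∈ (Finset.range z).filter (u ∈ S ·), (K - 1 - g i 0) * g i v ≤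
      ∑ i ∈ (Finset.range z).filter (u ∈ S ·), (K - 1 - g i 0) * g i 1)
    {g' : ℕ → ℕ → ℕ} (hg0 : ∀ i < z, u ∈ S i → g' i 0 = g i 0 + 1)
    (hg1 : ∀ i < z, u ∈ S i → ∀ w, 1 ≤ w → w < 2 * K → IsAncestor w v →
      g' i w = g i w + (g i v + 1))
    (hg2 : ∀ i < z, u ∈ S i → ∀ w, 1 ≤ w → w < 2 * K → ¬IsAncestor w v → g' i w = g i w)
    (hg3 : ∀ i < z, u ∉ S i → ∀ w < 2 * K, g' i w = g i w) :
    BalancedTrees S z K (u + 1) (Function.update f u v) g' where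
  count i hi := by
    by_cases hu : u ∈ S i
    · rw [hg0 i hi hu, h.count i hi, ← Finset.card_insert_of_notMem (a := u) (by simp)]
      congr 1
      ext x
      simp only [Finset.mem_insert, Finset.mem_filter]
      constructor
      · rintro (rfl | ⟨h1, h2⟩)
        · exact ⟨hu, by omega⟩
        · exact ⟨h1, by omega⟩
      · rintro ⟨h1, h2⟩
        rcases eq_or_ne x u with rfl | hx
        · exact .inl rfl
        · exact .inr ⟨h1, by omega⟩
    · rw [hg3 i hi hu 0 (by omega), h.count i hi]
      congr 1
      refine Finset.filter_congr fun x hx => ?_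
      have : x ≠ u := fun hxu => hu (hxu ▸ hx)
      omega
  node i hi w hw1 hw2 := by
    have hn := h.node i hi w hw1 hw2
    by_cases hu : u ∈ S i
    · have hch := isAncestor_child_iff (w := w) (v := v) (by omega)
      have hnb := not_isAncestor_both (v := v) hw1
      by_cases hl : IsAncestor (2 * w) v
      · rw [hg1 i hi hu w hw1 (by omega) (hch.mpr (.inl hl)),
          hg1 i hi hu (2 * w) (by omega) (by omega) hl,
          hg2 i hi hu (2 * w + 1) (by omega) (by omega) fun hr => hnb ⟨hl, hr⟩]
        omega
      · by_cases hr : IsAncestor (2 * w + 1) v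
        · rw [hg1 i hi hu w hw1 (by omega) (hch.mpr (.inr hr)),
            hg2 i hi hu (2 * w) (by omega) (by omega) hl,
            hg1 i hi hu (2 * w + 1) (by omega) (by omega) hr]
          omega
        · rw [hg2 i hi hu w hw1 (by omega) fun ha => (hch.mp ha).elim hl hr,
            hg2 i hi hu (2 * w) (by omega) (by omega) hl,
            hg2 i hi hu (2 * w + 1) (by omega) (by omega) hr]
          omega
    · rw [hg3 i hi hu _ (by omega), hg3 i hi hu _ (by omega), hg3 i hi hu _ (by omega), hn]
  leaf i hi w hw1 hw2 := by
    have hK : 0 < K := by rw [hκ]; positivity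
    have hl := h.leaf i hi w hw1 hw2
    have hold : ((S i).filter fun x => x < u ∧ f x = w) =
        ((S i).filter fun x => x < u ∧ Function.update f u v x = w) := by
      refine Finset.filter_congr fun x _ => ?_
      constructor <;> rintro ⟨h1, h2⟩ <;> refine ⟨h1, ?_⟩ <;> simpa [h1.ne] using h2
    by_cases hu : u ∈ S i
    · by_cases hwv : w = v
      · subst hwv
        rw [hg1 i hi hu w (by omega) hw2 ((isAncestor_leaf_iff hw1 hv2).mpr rfl)]
        have : ((S i).filter fun x => x < u + 1 ∧ Function.update f u w x = w) =
            insert u ((S i).filter fun x => x < u ∧ f x = w) := by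
          rw [hold]
          ext x
          simp only [Finset.mem_insert, Finset.mem_filter]
          constructor
          · rintro ⟨h1, h2, h3⟩
            rcases eq_or_ne x u with rfl | hx
            · exact .inl rfl
            · exact .inr ⟨h1, by omega, h3⟩
          · rintro (rfl | ⟨h1, h2, h3⟩)
            · exact ⟨hu, by omega, by simp⟩
            · exact ⟨h1, by omega, h3⟩
        rw [this, Finset.card_insert_of_notMem (by simp), pow_succ, ← hl]
        ring
      · rw [hg2 i hi hu w (by omega) hw2 fun ha => hwv ((isAncestor_leaf_iff hw1 hv2).mp ha), hl,
          hold]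
        congr 2
        refine Finset.filter_congr fun x hx => ?_
        rcases eq_or_ne x u with rfl | hx
        · simp [Ne.symm hwv]
        · have : x < u ↔ x < u + 1 := by omega
          rw [this]
    · rw [hg3 i hi hu w hw2, hl, hold]
      congr 2
      refine Finset.filter_congr fun x hx => ?_
      have : x ≠ u := fun hxu => hu (hxu ▸ hx)
      have : x < u ↔ x < u + 1 := by omega
      rw [this]
  potential := by
    have hK : 0 < K := by rw [hκ]; positivity
    have hroot : IsAncestor 1 v := by
      refine ⟨κ, ?_⟩
      rw [← hκ]
      exact (Nat.div_eq_iff (by omega)).mpr ⟨by omega, by omega⟩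
    refine le_trans ?_ h.potential
    rw [← Finset.sum_filter_add_sum_filter_not (Finset.range z) (u ∈ S ·),
      ← Finset.sum_filter_add_sum_filter_not (Finset.range z) (u ∈ S ·)
        (fun i => (K - g i 0) * (g i 1 + K))]
    set I := (Finset.range z).filter (u ∈ S ·) with hI
    have hmem {i : ℕ} (hi : i ∈ I) : i < z ∧ u ∈ S i := by simpa [hI] using hi
    have h2 : ∑ i ∈ (Finset.range z).filter (¬u ∈ S ·), (K - g' i 0) * (g' i 1 + K) =
        ∑ i ∈ (Finset.range z).filter (¬u ∈ S ·), (K - g i 0) * (g i 1 + K) := by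
      refine Finset.sum_congr rfl fun i hi => ?_
      simp only [Finset.mem_filter, Finset.mem_range] at hi
      rw [hg3 i hi.1 hi.2 0 (by omega), hg3 i hi.1 hi.2 1 (by omega)]
    rw [h2]
    refine Nat.add_le_add_right ?_ _
    -- The exact change of the potential, arranged without subtraction: with `c = g i 0`, `W = g i 1
    -- + K` and `e = g i v + 1`, one has `(K - c - 1)(W + e) + W = (K - c)W + (K - c - 1)e`.
    have h3 : ∑ i ∈ I, (K - g' i 0) * (g' i 1 + K) + ∑ i ∈ I, (g i 1 + K) =
        ∑ i ∈ I, (K - g i 0) * (g i 1 + K) + ∑ i ∈ I, (K - 1 - g i 0) * (g i v + 1) := by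
      rw [← Finset.sum_add_distrib, ← Finset.sum_add_distrib]
      refine Finset.sum_congr rfl fun i hi => ?_
      obtain ⟨hi, hu⟩ := hmem hi
      rw [hg0 i hi hu, hg1 i hi hu 1 le_rfl (by omega) hroot]
      -- The element `u` is in `S i` but not yet counted, so the truncated subtractions below are
      -- exact.
      have hlt : g i 0 < K := by
        refine lt_of_lt_of_le ?_ (hS i hi)
        rw [h.count i hi]
        refine Finset.card_lt_card (Finset.filter_ssubset.mpr ⟨u, hu, by simp⟩)
      obtain ⟨o, ho⟩ := Nat.exists_eq_add_of_lt hlt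
      rw [show K - (g i 0 + 1) = o by omega, show K - g i 0 = o + 1 by omega,
        show K - 1 - g i 0 = o by omega]
      ring
    -- The averaging hypothesis concerns the values `2 ^ b - 1`; adding `K - 1 - g i 0` for each of
    -- the `K` leaves turns it into one on `2 ^ b`. The factor `K - 1 - g i 0 ≤ K` then cancels the
    -- number of leaves.
    have h4 : ∑ i ∈ I, (K - 1 - g i 0) * (g i v + 1) ≤ ∑ i ∈ I, (g i 1 + K) := by
      refine Nat.le_of_mul_le_mul_left ?_ hK
      calc K * ∑ i ∈ I, (K - 1 - g i 0) * (g i v + 1)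
          = K * ∑ i ∈ I, (K - 1 - g i 0) * g i v + ∑ i ∈ I, (K - 1 - g i 0) * K := by
            simp only [mul_add, mul_one, Finset.sum_add_distrib, Finset.mul_sum]
            simp only [mul_comm]
        _ ≤ ∑ i ∈ I, (K - 1 - g i 0) * g i 1 + ∑ i ∈ I, (K - 1 - g i 0) * K :=
            Nat.add_le_add_right hv _
        _ = ∑ i ∈ I, (K - 1 - g i 0) * (g i 1 + K) := by
            simp only [mul_add, Finset.sum_add_distrib]
        _ ≤ ∑ i ∈ I, K * (g i 1 + K) :=
            Finset.sum_le_sum fun i _ => Nat.mul_le_mul_right _ (by omega)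
        _ = K * ∑ i ∈ I, (g i 1 + K) := by rw [Finset.mul_sum]
    omega

end BalancedTrees

namespace WordRAM

/-! ### Correctness of the program -/

section

variable {X s : ℕ} {σ : State}

/-- The sets play no role here, so the codewords overwrite the input from cell `0` on. -/
theorem runs_disjointCode {n : ℕ} (hn : σ.reg .univ = n) (hX : n + 2 ≤ X) (hs : n ≤ s) :
    Runs X s disjointCode σ fun t σ' => t ≤ 15 * n + 20 ∧ σ'.reg .weight = 1 ∧
      σ'.reg .length = n ∧ σ'.reg .base = 0 ∧ ∀ u < n, σ'.mem u = u + 1 := by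
  refine Runs.seq (Runs.straight ?_ ?_)
  · simp [Cmd.Straight, Cmd.after, hn]
    omega
  refine (Runs.loop_const (fun j σ' => σ'.reg .weight = 1 ∧ σ'.reg .length = n ∧
    σ'.reg .base = 0 ∧ σ'.reg .univ = n ∧ σ'.reg .elt = j ∧ ∀ u < j, σ'.mem u = u + 1) n 9
    ?_ ?_ ?_).mono ?_
  · simp [Cmd.after, hn]
  · rintro j hj σ ⟨h1, h2, h3, h4, h5, h6⟩
    refine ⟨by simp, by simp [h4, h5]; omega, Runs.straight ?_ ⟨by decide, ?_⟩⟩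
    · simp [Cmd.Straight, Cmd.after, h5]
      omega
    · simp only [Cmd.after, State.set_reg, State.set_mem, State.put_reg, State.put_mem,
        Expr.eval_add, Expr.eval_var, Expr.eval_ofNat, reduceCtorEq, if_false, if_true, h1, h2, h3, h4, h5, true_and]
      intro u hu
      rcases eq_or_ne u j with rfl | huj
      · simp
      · rw [Function.update_of_ne huj, h6 u (by omega)]
  · rintro σ ⟨h1, h2, h3, h4, h5, h6⟩
    simp [h4, h5]
  · rintro t σ' ⟨ht, h1, h2, h3, h4, h5, h6⟩
    refine ⟨?_, h1, h2, h3, h6⟩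
    have : ((Expr.var .univ - Expr.var .elt : Expr)).cost = 3 := rfl
    have : Cmd.size ((Cmd.set .weight 1).seq (.seq (.set .length Var.univ)
      (.seq (.set .base 0) (.set .elt 0)))) = 8 := rfl
    simp only [*] at ht ⊢
    omega

theorem runs_computeLeaves {k : ℕ} (hk : σ.reg .maxSize = k) (hX : 2 ^ Nat.clog 2 (2 * k) < X) :
    Runs X s computeLeaves σ fun t σ' => t ≤ 11 * Nat.clog 2 (2 * k) + 10 ∧
      σ'.mem = σ.mem ∧ (∀ x ∉ [Var.leaves], σ'.reg x = σ.reg x) ∧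
      σ'.reg .leaves = 2 ^ Nat.clog 2 (2 * k) := by
  have hpow (j : ℕ) (hj : j ≤ Nat.clog 2 (2 * k)) : 2 ^ j < X :=
    (Nat.pow_le_pow_right (by omega) hj).trans_lt hX
  refine Runs.seq (Runs.straight ?_ ?_)
  · simpa [Cmd.Straight] using hpow 0 (by omega)
  refine (Runs.loop_const (fun j σ' => σ'.mem = σ.mem ∧ (∀ x ∉ [Var.leaves], σ'.reg x = σ.reg x) ∧
    σ'.reg .leaves = 2 ^ j) (Nat.clog 2 (2 * k)) 4 ?_ ?_ ?_).mono ?_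
  · simp +contextual [Cmd.after]
  · rintro j hj τ ⟨h1, h2, h3⟩
    have h4 := h2 .maxSize (by decide)
    have h5 := (Nat.lt_clog_iff_pow_lt (by omega)).mp hj
    refine ⟨by simp, by simp [h3, h4, hk]; omega, Runs.straight ?_ ⟨by decide, ?_⟩⟩
    · simpa [Cmd.Straight, h3, ← pow_succ'] using hpow (j + 1) hj
    · refine ⟨h1, fun x hx => ?_, by simp [Cmd.after, h3, pow_succ']⟩
      rw [← h2 x hx]
      simp only [List.mem_singleton] at hx
      simp [Cmd.after, hx]
  · rintro τ ⟨h1, h2, h3⟩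
    have h4 := h2 .maxSize (by decide)
    have h5 := Nat.le_pow_clog (b := 2) (by omega) (2 * k)
    simp [h3, h4, hk]
    omega
  · rintro t σ' ⟨ht, h⟩
    refine ⟨?_, h⟩
    have : (2 * Expr.var .maxSize - Expr.var .leaves : Expr).cost = 5 := rfl
    have : Cmd.size (Cmd.set .leaves 1) = 2 := rfl
    simp only [*] at ht ⊢
    omega

theorem runs_computeLog {n : ℕ} (hn : σ.reg .univ = n) (hX : 2 ^ Nat.clog 2 n < X)
    (hX' : Nat.clog 2 n + 2 < X) :
    Runs X s computeLog σ fun t σ' => t ≤ 13 * Nat.clog 2 n + 10 ∧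
      σ'.mem = σ.mem ∧ (∀ x ∉ [Var.left, Var.log], σ'.reg x = σ.reg x) ∧
      σ'.reg .log = Nat.clog 2 n + 2 := by
  have hpow (j : ℕ) (hj : j ≤ Nat.clog 2 n) : 2 ^ j < X :=
    (Nat.pow_le_pow_right (by omega) hj).trans_lt hX
  refine Runs.seq (Runs.straight ?_ ?_)
  · simp [Cmd.Straight]
    omega
  refine (Runs.loop_const (fun j σ' => σ'.mem = σ.mem ∧
    (∀ x ∉ [Var.left, Var.log], σ'.reg x = σ.reg x) ∧ σ'.reg .log = j + 2 ∧
    σ'.reg .left = 2 ^ j) (Nat.clog 2 n) 8 ?_ ?_ ?_).mono ?_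
  · simp +contextual [Cmd.after]
  · rintro j hj τ ⟨h1, h2, h3, h6⟩
    have h4 := h2 .univ (by decide)
    have h5 := (Nat.lt_clog_iff_pow_lt (by omega)).mp hj
    have h7 := hpow (j + 1) hj
    refine ⟨by simp, by simp [h6, h4, hn]; omega, Runs.straight ?_ ⟨by decide, ?_⟩⟩
    · simp [Cmd.Straight, Cmd.after, h3, h6, ← pow_succ', h7]
      omega
    · refine ⟨h1, fun x hx => ?_, by simp [Cmd.after, h3], by simp [Cmd.after, h6, pow_succ']⟩
      rw [← h2 x hx]
      simp at hx
      simp [Cmd.after, hx]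
  · rintro τ ⟨h1, h2, h3, h6⟩
    have h4 := h2 .univ (by decide)
    have h5 := Nat.le_pow_clog (b := 2) (by omega) n
    simp [h6, h4, hn]
    omega
  · rintro t σ' ⟨ht, h1, h2, h3, -⟩
    refine ⟨?_, h1, h2, h3⟩
    have : (Expr.var .univ - Expr.var .left : Expr).cost = 3 := rfl
    have : Cmd.size ((Cmd.set .left 1).seq (.set .log 2)) = 4 := rfl
    simp only [*] at ht ⊢
    omega

end

end WordRAM

/-! ### Computation of the weight and of the memory layout. -/

namespace WordRAM

section

variable {X s : ℕ} {σ : State}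

/-- Testing a number for divisors, the inner loop of the computation of the weight. -/
theorem runs_trialDivision {Q : ℕ} (hQ : 2 ≤ Q) (hX : Q + 1 < X) (hw : σ.reg .weight = Q)
    (hc : σ.reg .comp = 0) (hd : σ.reg .divisor = 2) :
    Runs X s (.loop (Expr.var .weight - Expr.var .divisor)
      (.seq (.set .comp (Expr.var .comp + (1 - Expr.var .weight % Expr.var .divisor)))
        (.set .divisor (Expr.var .divisor + 1)))) σ fun t σ' => t ≤ 17 * Q ∧
      σ'.mem = σ.mem ∧ (∀ x ∉ [Var.comp, Var.divisor], σ'.reg x = σ.reg x) ∧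
      (σ'.reg .comp = 0 ↔ Q.Prime) := by
  refine (Runs.loop_const (fun j σ' => σ'.mem = σ.mem ∧
    (∀ x ∉ [Var.comp, Var.divisor], σ'.reg x = σ.reg x) ∧ σ'.reg .divisor = j + 2 ∧
    σ'.reg .comp ≤ j ∧ (σ'.reg .comp = 0 ↔ ∀ m, 2 ≤ m → m < j + 2 → ¬m ∣ Q)) (Q - 2) 12
    ?_ ?_ ?_).mono ?_
  · refine ⟨rfl, fun _ _ => rfl, hd, hc.le, ?_⟩
    simp only [hc, true_iff]
    omega
  · rintro j hj τ ⟨h1, h2, h3, h4, h5⟩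
    have h6 := h2 .weight (by decide)
    rw [hw] at h6
    refine ⟨by simp, by simp [h3, h6]; omega, Runs.straight ?_ ⟨by decide, h1, fun x hx => ?_,
      by simp [Cmd.after, h3], ?_, ?_⟩⟩
    · simp [Cmd.Straight, Cmd.after, h3, h6]
      omega
    · rw [← h2 x hx]
      simp at hx
      simp [Cmd.after, hx]
    · simp [Cmd.after, h3, h6]
      omega
    · simp only [Cmd.after, State.set_reg, reduceCtorEq, if_false, if_true, Expr.eval_add,
        Expr.eval_sub, Expr.eval_mod, Expr.eval_var, Expr.eval_ofNat, h3, h6, Nat.add_eq_zero_iff,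
        h5]
      have h7 : 1 - Q % (j + 2) = 0 ↔ ¬(j + 2) ∣ Q := by
        rw [Nat.dvd_iff_mod_eq_zero]; omega
      rw [h7]
      constructor
      · rintro ⟨h8, h9⟩ m hm1 hm2
        rcases eq_or_ne m (j + 2) with rfl | hm
        · exact h9
        · exact h8 m hm1 (by omega)
      · exact fun h8 => ⟨fun m hm1 hm2 => h8 m hm1 (by omega), h8 _ (by omega) (by omega)⟩
  · rintro τ ⟨h1, h2, h3, -⟩
    have h6 := h2 .weight (by decide)
    rw [hw] at h6
    simp [h3, h6]
    omega
  · rintro t σ' ⟨ht, h1, h2, h3, -, h5⟩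
    refine ⟨?_, h1, h2, ?_⟩
    · have : (Expr.var .weight - Expr.var .divisor : Expr).cost = 3 := rfl
      simp only [this] at ht
      omega
    · rw [h5, Nat.prime_def_lt', show Q - 2 + 2 = Q by omega]
      exact ⟨fun h => ⟨hQ, h⟩, fun h => h.2⟩

/-- By Bertrand's postulate the search ends by `2 * M`. It tests at most `Q` candidates, each in
`O(Q)` steps. -/
theorem runs_computeWeight {l p q M : ℕ} (hl : σ.reg .log = l) (hp : σ.reg .num = p)
    (hq : σ.reg .den = q) (hM : l * l * q / p = M) (hM1 : 1 ≤ M) (hX : 2 * M + 1 < X) :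
    Runs X s computeWeight σ fun t σ' => σ'.mem = σ.mem ∧
      (∀ x ∉ [Var.weight, Var.comp, Var.divisor], σ'.reg x = σ.reg x) ∧
      (σ'.reg .weight).Prime ∧ M < σ'.reg .weight ∧ σ'.reg .weight ≤ 2 * M ∧
      t ≤ 40 * (σ'.reg .weight * σ'.reg .weight) := by
  -- The number of passes: the least `N ≥ 1` for which `M + N` is prime.
  obtain ⟨N, hN1, hNp, hNM, hmin⟩ : ∃ N, 1 ≤ N ∧ (M + N).Prime ∧ N ≤ M ∧
      ∀ j < N, ¬(1 ≤ j ∧ (M + j).Prime) := by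
    classical
    obtain ⟨r, h1, h2, h3⟩ := Nat.exists_prime_lt_and_le_two_mul M (by omega)
    have hr : 1 ≤ r - M ∧ (M + (r - M)).Prime :=
      ⟨by omega, by rwa [show M + (r - M) = r by omega]⟩
    have hex : ∃ j, 1 ≤ j ∧ (M + j).Prime := ⟨_, hr⟩
    obtain ⟨h4, h5⟩ := Nat.find_spec hex
    have h6 := Nat.find_min' hex hr
    exact ⟨Nat.find hex, h4, h5, by omega, fun j => Nat.find_min hex⟩
  refine Runs.seq (Runs.straight ?_ ?_)
  · simp [Cmd.Straight, hl, hp, hq, hM]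
    omega
  refine (Runs.loop_const (fun j σ' => σ'.mem = σ.mem ∧
    (∀ x ∉ [Var.weight, Var.comp, Var.divisor], σ'.reg x = σ.reg x) ∧
    σ'.reg .weight = M + j ∧ (σ'.reg .comp = 0 ↔ 1 ≤ j ∧ (M + j).Prime)) N (17 * (M + N) + 8)
    ?_ ?_ ?_).mono ?_
  · refine ⟨rfl, fun x hx => ?_, by simp [Cmd.after, hl, hp, hq, hM], by simp [Cmd.after]⟩
    simp at hx
    simp [Cmd.after, hx]
  · rintro j hj τ ⟨h1, h2, h3, h4⟩
    refine ⟨by simp, by simpa [h4] using hmin j hj, Runs.seq (Runs.straight ?_ ?_)⟩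
    · simp [Cmd.Straight, h3]
      omega
    refine (runs_trialDivision (Q := M + (j + 1)) (by omega) (by omega) ?_ ?_ ?_).mono ?_
    · simp [Cmd.after, h3, add_assoc]
    · simp [Cmd.after]
    · simp [Cmd.after]
    rintro t σ' ⟨ht, h5, h6, h7⟩
    refine ⟨?_, by rw [h5]; exact h1, fun x hx => ?_, ?_, ?_⟩
    · have : Cmd.size (.seq (.set .weight (Expr.var .weight + 1))
        (.seq (.set .comp 0) (.set .divisor 2))) = 8 := rfl
      simp only [this]
      omega
    · rw [← h2 x hx]
      simp at hx
      rw [h6 x (by simp [hx])]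
      simp [Cmd.after, hx]
    · rw [h6 .weight (by decide)]
      simp [Cmd.after, h3, add_assoc]
    · rw [h7]
      simp
  · rintro τ ⟨h1, h2, h3, h4⟩
    simpa [h4] using ⟨hN1, hNp⟩
  · rintro t σ' ⟨ht, h1, h2, h3, -⟩
    rw [h3]
    refine ⟨h1, h2, hNp, by omega, by omega, ?_⟩
    have : (Expr.var .comp : Expr).cost = 1 := rfl
    have : Cmd.size (Cmd.seq (.set .weight (Expr.var .log * .var .log * .var .den / .var .num))
      (.set .comp 1)) = 10 := rfl
    simp only [*] at ht ⊢
    have h4 : N * (17 * (M + N) + 8 + (1 + 2)) ≤ (M + N) * (17 * (M + N) + 8 + (1 + 2)) :=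
      Nat.mul_le_mul_right _ (by omega)
    have h5 : 2 * (M + N) ≤ (M + N) * (M + N) := Nat.mul_le_mul_right _ (by omega)
    have h6 : (M + N) * (17 * (M + N) + 8 + (1 + 2)) = 17 * ((M + N) * (M + N)) + 11 * (M + N) := by
      ring
    omega

theorem runs_computeLayout {z n K Q : ℕ} (hz : σ.reg .numSets = z) (hn : σ.reg .univ = n)
    (hK : σ.reg .leaves = K) (hQ : σ.reg .weight = Q) (hX : K * Q * Q < X)
    (hX' : 4 + z + n + n + 2 * K * z < X) :
    Runs X s computeLayout σ fun t σ' => t ≤ 30 ∧ σ'.mem = σ.mem ∧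
      (∀ x ∉ [Var.length, Var.heads, Var.trees, Var.base], σ'.reg x = σ.reg x) ∧
      σ'.reg .length = K * Q * Q ∧ σ'.reg .heads = 4 + z + n ∧
      σ'.reg .trees = 4 + z + n + n ∧ σ'.reg .base = 4 + z + n + n + 2 * K * z := by
  refine Runs.straight ?_ ⟨by decide, rfl, fun x hx => ?_, ?_⟩
  · simp [computeLayout, Cmd.Straight, Cmd.after, hz, hn, hK, hQ, hX]
    omega
  · simp at hx
    simp [computeLayout, Cmd.after, hx]
  · simp [computeLayout, Cmd.after, hz, hn, hK, hQ]

end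

/-! ### Linked lists of sets -/

/-- From position `a` on, the memory contains the words `l`, followed by zeros up to position
`h`. -/
def Reads (mem : ℕ → ℕ) (a h : ℕ) (l : List ℕ) : Prop :=
  a + l.length ≤ h ∧ ∀ j, a + j < h → mem (a + j) = l.getD j 0

theorem Reads.head {mem : ℕ → ℕ} {a h x : ℕ} {l : List ℕ} (hr : Reads mem a h (x :: l)) :
    a < h ∧ mem a = x := by
  have h1 : a < h := by have := hr.1; simp at this; omega
  exact ⟨h1, by simpa using hr.2 0 h1⟩

theorem Reads.tail {mem mem' : ℕ → ℕ} {a h x : ℕ} {l : List ℕ} (hr : Reads mem a h (x :: l))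
    (hm : ∀ b, a < b → b < h → mem' b = mem b) : Reads mem' (a + 1) h l := by
  refine ⟨by have := hr.1; simp at this; omega, fun j hj => ?_⟩
  rw [hm _ (by omega) hj, add_assoc, add_comm 1, hr.2 _ (by omega)]
  rfl

/-- At position `a` begins a linked list with the entries `l`, all of whose cells are below `b`:
a cell holds `z` times the position of the next cell plus the entry. -/
def IsChain (mem : ℕ → ℕ) (z b : ℕ) : ℕ → List ℕ → Prop
  | a, [] => a = 0
  | a, i :: l => a ≠ 0 ∧ a < b ∧ mem a % z = i ∧ IsChain mem z b (mem a / z) l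

theorem IsChain.congr {mem mem' : ℕ → ℕ} {z b b' a : ℕ} {l : List ℕ} (h : IsChain mem z b a l)
    (hb : b ≤ b') (hm : ∀ x < b, mem' x = mem x) : IsChain mem' z b' a l := by
  induction l generalizing a with
  | nil => exact h
  | cons i l ih =>
    obtain ⟨h1, h2, h3, h4⟩ := h
    refine ⟨h1, by omega, by rw [hm a h2, h3], ?_⟩
    rw [hm a h2]
    exact ih h4

theorem IsChain.lt {mem : ℕ → ℕ} {z b a : ℕ} {l : List ℕ} (h : IsChain mem z b a l) (hb : 0 < b) :
    a < b := by
  cases l with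
  | nil => exact h ▸ hb
  | cons i l => exact h.2.1

/-- The input words from the `i`-th set on, where `A i` enumerates the `i`-th set. -/
def inputFrom (z : ℕ) (A : ℕ → List ℕ) (i : ℕ) : List ℕ :=
  (List.range' i (z - i)).flatMap fun i => (A i).length :: A i

theorem inputFrom_eq {z : ℕ} (A : ℕ → List ℕ) {i : ℕ} (hi : i < z) :
    inputFrom z A i = (A i).length :: (A i ++ inputFrom z A (i + 1)) := by
  unfold inputFrom
  rw [show z - i = z - (i + 1) + 1 by omega, List.range'_succ]
  simp

/-- The linked lists whose heads are at `h, h + 1, …` tell, for every `u < n`, for which of the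
sets the relation `R` holds. -/
def Linked (mem : ℕ → ℕ) (z b h n : ℕ) (R : ℕ → ℕ → Prop) : Prop :=
  ∀ u < n, ∃ l, IsChain mem z b (mem (h + u)) l ∧ l.Nodup ∧ ∀ i, i ∈ l ↔ R i u

theorem Linked.congr {mem mem' : ℕ → ℕ} {z b b' h n : ℕ} {R R' : ℕ → ℕ → Prop}
    (hl : Linked mem z b h n R) (hb : b ≤ b') (hm : ∀ x < b, mem' x = mem x)
    (hm' : ∀ u < n, mem' (h + u) = mem (h + u)) (hR : ∀ i, ∀ u < n, R i u ↔ R' i u) :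
    Linked mem' z b' h n R' := by
  intro u hu
  obtain ⟨l, h1, h2, h3⟩ := hl u hu
  exact ⟨l, by rw [hm' u hu]; exact h1.congr hb hm, h2, fun i => (h3 i).trans (hR i u hu)⟩

/-- Inserting the set `i` into the list of `v`, with the new cell `b`. -/
theorem Linked.insert {mem : ℕ → ℕ} {z b h n : ℕ} {R R' : ℕ → ℕ → Prop} {i v : ℕ}
    (hl : Linked mem z b h n R) (hb : 0 < b) (hbh : b < h) (hi : i < z) (hv : v < n)
    (hiv : ¬R i v) (hR : ∀ j, ∀ u < n, R' j u ↔ R j u ∨ j = i ∧ u = v) :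
    Linked (Function.update (Function.update mem b (mem (h + v) * z + i)) (h + v) b)
      z (b + 1) h n R' := by
  intro u hu
  obtain ⟨l, h1, h2, h3⟩ := hl u hu
  have hm : ∀ x < b, (Function.update (Function.update mem b (mem (h + v) * z + i)) (h + v) b) x =
      mem x := by
    intro x hx
    rw [Function.update_of_ne (by omega), Function.update_of_ne (by omega)]
  rcases eq_or_ne u v with rfl | huv
  · refine ⟨i :: l, ?_, ?_, fun j => ?_⟩
    · rw [Function.update_self]
      refine ⟨by omega, by omega, ?_, ?_⟩
      · rw [Function.update_of_ne (by omega), Function.update_self, Nat.mul_add_mod_of_lt hi]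
      · have hdiv : (mem (h + u) * z + i) / z = mem (h + u) := by
          rw [Nat.add_comm, Nat.add_mul_div_right _ _ (by omega), Nat.div_eq_of_lt hi, zero_add]
        rw [Function.update_of_ne (by omega), Function.update_self, hdiv]
        exact h1.congr (Nat.le_succ b) hm
    · exact List.nodup_cons.mpr ⟨fun h => hiv ((h3 i).mp h), h2⟩
    · rw [List.mem_cons, h3, hR j u hu, or_comm]
      simp
  · refine ⟨l, ?_, h2, fun j => by rw [h3, hR j u hu]; simp [huv]⟩
    rw [Function.update_of_ne (by omega), Function.update_of_ne (by omega)]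
    exact h1.congr (Nat.le_succ b) hm

section

variable {X s : ℕ} {σ : State}

/-- All list cells lie below the reading position `pos`, where the input has been consumed; turning
the cell at `pos` into a list cell therefore destroys neither lists nor unread input. Cells start at
position `4`, so `0` is free to mark the end of a list. -/
theorem runs_buildLists {z n h : ℕ} {A : ℕ → List ℕ} (hA : ∀ i < z, (A i).Nodup)
    (hAn : ∀ i < z, ∀ u ∈ A i, u < n) (hz : σ.reg .numSets = z) (hh : σ.reg .heads = h)
    (hr : Reads σ.mem 4 h (inputFrom z A 0)) (hm : ∀ x, h ≤ x → σ.mem x = 0)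
    (hs : h + n ≤ s) (hX : h + n < X) (hX' : h * z + z < X) :
    Runs X s buildLists σ fun t σ' =>
      t ≤ ∑ i ∈ Finset.range z, (40 * (A i).length + 30) + 10 ∧
      (∀ x ∉ [Var.pos, Var.idx, Var.count, Var.elt], σ'.reg x = σ.reg x) ∧
      (∀ x, h + n ≤ x → σ'.mem x = 0) ∧
      Linked σ'.mem z h h n fun i u => i < z ∧ u ∈ A i := by
  have hh4 : 4 ≤ h := by have := hr.1; omega
  refine Runs.seq (Runs.straight ?_ ?_)
  · simp [Cmd.Straight]
    omega
  refine (Runs.loop (fun i σ' => (∀ x ∉ [Var.pos, Var.idx, Var.count, Var.elt],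
      σ'.reg x = σ.reg x) ∧ (∀ x, h + n ≤ x → σ'.mem x = 0) ∧ σ'.reg .idx = i ∧
      4 ≤ σ'.reg .pos ∧ Reads σ'.mem (σ'.reg .pos) h (inputFrom z A i) ∧
      Linked σ'.mem z (σ'.reg .pos) h n fun j u => j < i ∧ u ∈ A j) z
    (fun i => 40 * (A i).length + 20) ?_ ?_ ?_).mono ?_
  · refine ⟨fun x hx => ?_, fun x hx => hm x (by omega), by simp [Cmd.after],
      by simp [Cmd.after], by simpa [Cmd.after] using hr, ?_⟩
    · simp at hx
      simp [Cmd.after, hx]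
    · intro u hu
      refine ⟨[], ?_, List.nodup_nil, by simp⟩
      exact hm _ (by omega)
  · rintro i hi τ ⟨h1, h2, h3, h4, h5, h6⟩
    have hz' := h1 .numSets (by decide)
    have hh' := h1 .heads (by decide)
    rw [hz] at hz'
    rw [hh] at hh'
    rw [inputFrom_eq A hi] at h5
    obtain ⟨h7, h8⟩ := h5.head
    have hlen : (A i).length ≤ h := by have := h5.1; simp at this; omega
    refine ⟨by simp, by simp [h3, hz']; omega, Runs.seq (Runs.straight ?_ ?_)⟩
    · simp [Cmd.Straight, Cmd.after, h8]
      omega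
    refine Runs.seq ?_
    refine (Runs.loop_const (fun j τ' => (∀ x ∉ [Var.pos, Var.idx, Var.count, Var.elt],
        τ'.reg x = σ.reg x) ∧ (∀ x, h + n ≤ x → τ'.mem x = 0) ∧ τ'.reg .idx = i ∧
        4 ≤ τ'.reg .pos ∧ τ'.reg .count = (A i).length - j ∧
        Reads τ'.mem (τ'.reg .pos) h ((A i).drop j ++ inputFrom z A (i + 1)) ∧
        Linked τ'.mem z (τ'.reg .pos) h n
          -- Membership recorded so far: the earlier sets, and the first `j` elements of the current
          -- one.
          fun l u => l < i ∧ u ∈ A l ∨ l = i ∧ u ∈ (A i).take j) (A i).length 26 ?_ ?_ ?_).mono ?_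
    · refine ⟨fun x hx => ?_, h2, by simp [Cmd.after, h3], ?_, by simp [Cmd.after, h8], ?_, ?_⟩
      · rw [← h1 x hx]
        simp at hx
        simp [Cmd.after, hx]
      · simp [Cmd.after]
        omega
      · simpa [Cmd.after] using h5.tail fun _ _ _ => rfl
      · simpa [Cmd.after] using h6.congr (Nat.le_succ _) (fun _ _ => rfl) (fun _ _ => rfl)
          fun _ _ _ => Iff.rfl
    · rintro j hj τ' ⟨g1, g2, g3, g4, g5, g6, g7⟩
      have hz'' := g1 .numSets (by decide)
      have hh'' := g1 .heads (by decide)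
      rw [hz] at hz''
      rw [hh] at hh''
      rw [List.drop_eq_getElem_cons hj, List.cons_append] at g6
      obtain ⟨g8, g9⟩ := g6.head
      have hu : (A i)[j] < n := hAn i hi _ (List.getElem_mem hj)
      -- A head points to a used cell or is zero; this keeps the packed word, pointer times `z` plus
      -- index, within the word bound.
      have hlt : τ'.mem (h + (A i)[j]) < h := by
        obtain ⟨l, hl, -⟩ := g7 _ hu
        exact (hl.lt (by omega)).trans g8
      have hne : (h + (A i)[j] : ℕ) ≠ τ'.reg .pos := by omega
      refine ⟨by simp, by simp [g5]; omega, Runs.straight ?_ ⟨by decide, ?_⟩⟩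
      · have : τ'.mem (h + (A i)[j]) * z + i < X := by
          have := Nat.mul_le_mul_right z hlt.le
          omega
        simp [Cmd.Straight, Cmd.after, g3, g5, g9, hz'', hh'', this]
        omega
      · simp only [Cmd.after, State.set_reg, State.set_mem, State.put_reg, State.put_mem,
          Expr.eval_add, Expr.eval_sub, Expr.eval_mul, Expr.eval_var, Expr.eval_ofNat,
          Expr.eval_ld, reduceCtorEq, if_false, if_true, g3, g5, g9, hz'', hh'', true_and]
        refine ⟨fun x hx => ?_, fun x hx => ?_, by omega, by omega, ?_, ?_⟩
        · rw [← g1 x hx]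
          simp at hx
          simp [hx]
        · rw [Function.update_of_ne (by omega), Function.update_of_ne (by omega)]
          exact g2 x hx
        · refine g6.tail fun b hb1 hb2 => ?_
          rw [Function.update_of_ne (by omega), Function.update_of_ne (by omega)]
        · refine g7.insert (by omega) g8 hi hu ?_ ?_
          · rintro (⟨h, -⟩ | ⟨-, h⟩)
            · omega
            -- An element listed twice would enter its chain twice; the input has no repetitions.
            · obtain ⟨m, hm, hm'⟩ := List.mem_take_iff_getElem.mp h
              rw [(hA i hi).getElem_inj_iff] at hm'
              omega
          · intro l u _
            rw [List.take_succ_eq_append_getElem hj, List.mem_append, List.mem_singleton]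
            tauto
    · rintro τ' ⟨g1, g2, g3, g4, g5, g6, g7⟩
      simp [g5]
    · rintro t₁ τ' ⟨ht, g1, g2, g3, g4, g5, g6, g7⟩
      refine Runs.straight ?_ ⟨?_, fun x hx => ?_, g2, by simp [Cmd.after, g3], ?_, ?_, ?_⟩
      · simp [Cmd.Straight, g3]
        omega
      · have c1 : (Expr.var .count : Expr).cost = 1 := rfl
        have c2 : Cmd.size (.seq (.set .count (.ld (.var .pos))) (.set .pos (Expr.var .pos + 1)))
          = 7 := rfl
        have c3 : Cmd.size (.set .idx (Expr.var .idx + 1)) = 4 := rfl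
        simp only [c1, c2, c3] at ht ⊢
        omega
      · rw [← g1 x hx]
        simp at hx
        simp [Cmd.after, hx]
      · simpa [Cmd.after] using g4
      · simpa [Cmd.after] using g6
      · refine Linked.congr (by simpa [Cmd.after] using g7) le_rfl (fun _ _ => rfl)
          (fun _ _ => rfl) fun l u _ => ?_
        constructor
        · rintro (⟨g, g'⟩ | ⟨rfl, g⟩)
          · exact ⟨by omega, g'⟩
          · exact ⟨by omega, g⟩
        · rintro ⟨g, g'⟩
          rcases eq_or_ne l i with rfl | hl
          · exact .inr ⟨rfl, g'⟩
          · exact .inl ⟨by omega, g'⟩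
  · rintro τ ⟨h1, h2, h3, -⟩
    have hz' := h1 .numSets (by decide)
    rw [hz] at hz'
    simp [h3, hz']
  · rintro t σ' ⟨ht, h1, h2, h3, h4, h5, h6⟩
    refine ⟨?_, h1, h2, ?_⟩
    · have c1 : (Expr.var .numSets - .var .idx : Expr).cost = 3 := rfl
      have c2 : Cmd.size (.seq (.set .pos 4) (.set .idx 0)) = 4 := rfl
      simp only [c1, c2] at ht ⊢
      have : ∑ j ∈ Finset.range z, (40 * (A j).length + 20 + (3 + 2)) ≤
          ∑ i ∈ Finset.range z, (40 * (A i).length + 30) :=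
        Finset.sum_le_sum fun _ _ => by omega
      omega
    · have := h5.1
      exact h6.congr (by omega) (fun _ _ => rfl) (fun _ _ => rfl) fun _ _ _ => Iff.rfl

end

end WordRAM

/-! ### Walking and updating the balancing trees, and writing one codeword. -/

namespace WordRAM

/-- The variables that stay constant while the code is written. -/
structure Layout (z n K Q h : ℕ) (σ : State) : Prop where
  numSets : σ.reg .numSets = z
  univ : σ.reg .univ = n
  leaves : σ.reg .leaves = K
  weight : σ.reg .weight = Q
  heads : σ.reg .heads = h
  trees : σ.reg .trees = h + n
  base : σ.reg .base = h + n + 2 * K * z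
  length : σ.reg .length = K * Q * Q

/-- The scratch variables used while the code is written. -/
def scratch : List Var := [.elt, .node, .left, .right, .link, .ptr, .inc, .row]

theorem Layout.congr {z n K Q h : ℕ} {σ τ : State} (hl : Layout z n K Q h σ)
    (hτ : ∀ x ∉ scratch, τ.reg x = σ.reg x) : Layout z n K Q h τ where
  numSets := by rw [hτ _ (by decide), hl.numSets]
  univ := by rw [hτ _ (by decide), hl.univ]
  leaves := by rw [hτ _ (by decide), hl.leaves]
  weight := by rw [hτ _ (by decide), hl.weight]
  heads := by rw [hτ _ (by decide), hl.heads]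
  trees := by rw [hτ _ (by decide), hl.trees]
  base := by rw [hτ _ (by decide), hl.base]
  length := by rw [hτ _ (by decide), hl.length]

/-- The trees are stored consecutively, `2 * K` cells each: this lemma and `cell_inj` say that they
fit and do not overlap. -/
theorem cell_lt {K z i w : ℕ} (hi : i < z) (hw : w < 2 * K) : 2 * K * i + w < 2 * K * z :=
  calc 2 * K * i + w < 2 * K * (i + 1) := by rw [mul_add]; omega
    _ ≤ 2 * K * z := Nat.mul_le_mul_left _ hi

theorem cell_inj {K i j w x : ℕ} (hw : w < 2 * K) (hx : x < 2 * K)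
    (h : 2 * K * i + w = 2 * K * j + x) : i = j ∧ w = x := by
  have h1 : (2 * K * i + w) / (2 * K) = (2 * K * j + x) / (2 * K) := by rw [h]
  rw [Nat.mul_add_div (by omega), Nat.mul_add_div (by omega), Nat.div_eq_of_lt hw,
    Nat.div_eq_of_lt hx] at h1
  obtain rfl : i = j := by omega
  exact ⟨rfl, by omega⟩

section

variable {X s : ℕ} {σ : State} {z n K Q h : ℕ}

theorem runs_compareSubtrees {u v : ℕ} {l : List ℕ} {F : ℕ → ℕ → ℕ}
    (hl : IsChain σ.mem z h (σ.mem (h + u)) l) (hlz : ∀ i ∈ l, i < z) (hL : Layout z n K Q h σ)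
    (hu : σ.reg .elt = u) (hv : σ.reg .node = v) (hun : u < n) (hvK : v < K)
    (hF : ∀ i w, F i w = (K - 1 - σ.mem (h + n + 2 * K * i)) * σ.mem (h + n + 2 * K * i + w))
    (hs : h + n + 2 * K * z ≤ s) (hX : h + n + 2 * K * z < X)
    (hX1 : (l.map fun i => F i (2 * v)).sum < X)
    (hX2 : (l.map fun i => F i (2 * v + 1)).sum < X) (hσX : ∀ a, σ.mem a < X) :
    Runs X s compareSubtrees σ fun t σ' => t ≤ 60 * l.length + 15 ∧ σ'.mem = σ.mem ∧
      Layout z n K Q h σ' ∧ σ'.reg .elt = u ∧ σ'.reg .node = v ∧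
      σ'.reg .left = (l.map fun i => F i (2 * v)).sum ∧
      σ'.reg .right = (l.map fun i => F i (2 * v + 1)).sum := by
  have hbig : K ≤ 2 * K * z ∨ z = 0 := by
    rcases Nat.eq_zero_or_pos z with hz | hz
    · exact .inr hz
    · exact .inl (by nlinarith)
  refine Runs.seq (Runs.straight ?_ ?_)
  · simp [Cmd.Straight, Cmd.after, hL.heads, hu, hσX]
    omega
  refine (Runs.loop_const (fun j τ => τ.mem = σ.mem ∧ Layout z n K Q h τ ∧ τ.reg .elt = u ∧
    τ.reg .node = v ∧ IsChain σ.mem z h (τ.reg .link) (l.drop j) ∧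
    -- Adding the contribution of the unread part of the list keeps the invariant an equation, and
    -- bounds every partial sum by the total.
    τ.reg .left + ((l.drop j).map fun i => F i (2 * v)).sum =
      (l.map fun i => F i (2 * v)).sum ∧
    τ.reg .right + ((l.drop j).map fun i => F i (2 * v + 1)).sum =
      (l.map fun i => F i (2 * v + 1)).sum) l.length 50 ?_ ?_ ?_).mono ?_
  · refine ⟨rfl, hL.congr fun x hx => ?_, by simp [Cmd.after, hu], by simp [Cmd.after, hv],
      by simpa [Cmd.after, hL.heads, hu] using hl, by simp [Cmd.after], by simp [Cmd.after]⟩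
    simp [scratch] at hx
    simp [Cmd.after, hx]
  · rintro j hj τ ⟨h1, h2, h3, h4, h5, h6, h7⟩
    have hi : l[j] < z := hlz _ (List.getElem_mem hj)
    rw [List.drop_eq_getElem_cons hj] at h5 h6 h7
    simp only [List.map_cons, List.sum_cons] at h6 h7
    obtain ⟨c1, c2, c3, c4⟩ := h5
    have hc := cell_lt (K := K) (w := 2 * v + 1) hi (by omega)
    have hdiv := Nat.div_le_self (σ.mem (τ.reg .link)) z
    have hlt := hσX (τ.reg .link)
    have hF1 := hF l[j] (2 * v)
    have hF2 := hF l[j] (2 * v + 1)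
    have hK' : K < X := by
      rcases hbig with h | h <;> omega
    refine ⟨by simp, by simpa using c1, Runs.straight ?_ ⟨by decide, ?_⟩⟩
    · simp [Cmd.Straight, Cmd.after, h1, h2.numSets, h2.trees, h2.leaves, h4, c3, ← hF1, ← hF2, hσX]
      omega
    · refine ⟨h1, h2.congr fun x hx => ?_, by simp [Cmd.after, h3], by simp [Cmd.after, h4],
        ?_, ?_, ?_⟩
      · simp [scratch] at hx
        simp [Cmd.after, hx]
      · simpa [Cmd.after, h1, h2.numSets] using c4
      · simp [Cmd.after, h1, h2.numSets, h2.trees, h2.leaves, h4, c3, ← hF1, -List.map_drop]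
        omega
      · simp [Cmd.after, h1, h2.numSets, h2.trees, h2.leaves, h4, c3, ← hF2, -List.map_drop]
        omega
  · rintro τ ⟨h1, h2, h3, h4, h5, -⟩
    rw [List.drop_length] at h5
    exact ⟨by simp, by simpa [IsChain] using h5⟩
  · rintro t τ ⟨ht, h1, h2, h3, h4, h5, h6, h7⟩
    refine ⟨?_, h1, h2, h3, h4, by simpa using h6, by simpa using h7⟩
    have c1 : (Expr.var .link : Expr).cost = 1 := rfl
    have c2 : Cmd.size (.seq (.set .left 0) (.seq (.set .right 0)
      (.set .link (.ld (Expr.var .heads + Expr.var .elt))))) = 9 := rfl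
    simp only [c1, c2] at ht ⊢
    omega

/-- The weights do not depend on the node, so the weighted cost of a node is the sum of those of its
children and the cheaper child has at most half of it. Hence `2 ^ d` times the cost at depth `d`
never exceeds the cost at the root. -/
theorem runs_descend {u κ : ℕ} {l : List ℕ} {F : ℕ → ℕ → ℕ} (hκ : K = 2 ^ κ)
    (hl : IsChain σ.mem z h (σ.mem (h + u)) l) (hlz : ∀ i ∈ l, i < z) (hL : Layout z n K Q h σ)
    (hu : σ.reg .elt = u) (hun : u < n)
    (hF : ∀ i w, F i w = (K - 1 - σ.mem (h + n + 2 * K * i)) * σ.mem (h + n + 2 * K * i + w))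
    (hnode : ∀ i < z, ∀ v, 1 ≤ v → v < K → σ.mem (h + n + 2 * K * i + v) =
      σ.mem (h + n + 2 * K * i + 2 * v) + σ.mem (h + n + 2 * K * i + (2 * v + 1)))
    (hs : h + n + 2 * K * z ≤ s) (hX : h + n + 2 * K * z < X)
    (hX1 : (l.map fun i => F i 1).sum < X) (hKX : 2 * K < X) (hσX : ∀ a, σ.mem a < X) :
    Runs X s descend σ fun t σ' => t ≤ κ * (60 * l.length + 40) + 10 ∧ σ'.mem = σ.mem ∧
      Layout z n K Q h σ' ∧ σ'.reg .elt = u ∧ K ≤ σ'.reg .node ∧ σ'.reg .node < 2 * K ∧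
      K * (l.map fun i => F i (σ'.reg .node)).sum ≤ (l.map fun i => F i 1).sum := by
  have hsum (v : ℕ) (h1 : 1 ≤ v) (h2 : v < K) : (l.map fun i => F i v).sum =
      (l.map fun i => F i (2 * v)).sum + (l.map fun i => F i (2 * v + 1)).sum := by
    rw [← List.sum_map_add]
    refine congrArg List.sum (List.map_congr_left fun i hi => ?_)
    rw [hF, hF, hF, ← mul_add, hnode i (hlz i hi) v h1 h2]
  refine Runs.seq (Runs.straight ?_ ?_)
  · simp [Cmd.Straight]
    omega
  refine (Runs.loop_const (fun d τ => τ.mem = σ.mem ∧ Layout z n K Q h τ ∧ τ.reg .elt = u ∧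
    2 ^ d ≤ τ.reg .node ∧ τ.reg .node < 2 ^ (d + 1) ∧
    2 ^ d * (l.map fun i => F i (τ.reg .node)).sum ≤ (l.map fun i => F i 1).sum) κ
    (60 * l.length + 35) ?_ ?_ ?_).mono ?_
  · refine ⟨rfl, hL.congr fun x hx => ?_, by simp [Cmd.after, hu], by simp [Cmd.after],
      by simp [Cmd.after], by simp [Cmd.after]⟩
    simp [scratch] at hx
    simp [Cmd.after, hx]
  · rintro d hd τ ⟨h1, h2, h3, h4, h5, h6⟩
    have hpd : 2 ^ (d + 1) ≤ K := hκ ▸ Nat.pow_le_pow_right (by omega) hd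
    have hpd' : 1 ≤ 2 ^ d := Nat.one_le_two_pow
    have hs1 := hsum (τ.reg .node) (by omega) (by omega)
    have hle : (l.map fun i => F i (τ.reg .node)).sum ≤ (l.map fun i => F i 1).sum :=
      le_trans (Nat.le_mul_of_pos_left _ (by omega)) h6
    refine ⟨by simp, by simp [h2.leaves]; omega, Runs.seq ?_⟩
    refine (runs_compareSubtrees (F := F) (l := l) (u := u) (by rw [h1]; exact hl) hlz h2 h3 rfl hun
      (by omega) (by rw [h1]; exact hF) hs hX (by omega) (by omega) (by rw [h1]; exact hσX)).mono ?_
    rintro t τ' ⟨ht, g1, g2, g3, g4, g5, g6⟩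
    refine Runs.straight ?_ ⟨?_, g1.trans h1, g2.congr fun x hx => ?_, by simp [Cmd.after, g3], ?_⟩
    · simp [Cmd.Straight, g4]
      omega
    · have c1 : Cmd.size (.set .node (2 * Expr.var .node +
        (1 - (1 - (Expr.var .left - Expr.var .right))))) = 12 := rfl
      simp only [c1]
      omega
    · simp [scratch] at hx
      simp [Cmd.after, hx]
    · rw [pow_succ] at hpd
      simp only [Cmd.after, State.set_reg, if_true, Expr.eval_add, Expr.eval_sub, Expr.eval_mul,
        Expr.eval_var, Expr.eval_ofNat, g4, g5, g6]
      rw [pow_succ] at h5 ⊢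
      rw [pow_succ]
      rcases le_or_gt (l.map fun i => F i (2 * τ.reg .node)).sum
        (l.map fun i => F i (2 * τ.reg .node + 1)).sum with hc | hc
      · rw [show 1 - (1 - ((l.map fun i => F i (2 * τ.reg .node)).sum -
          (l.map fun i => F i (2 * τ.reg .node + 1)).sum)) = 0 by omega, add_zero]
        refine ⟨by omega, by omega, le_trans ?_ h6⟩
        rw [mul_assoc]
        exact Nat.mul_le_mul_left _ (by omega)
      · rw [show 1 - (1 - ((l.map fun i => F i (2 * τ.reg .node)).sum -
          (l.map fun i => F i (2 * τ.reg .node + 1)).sum)) = 1 by omega]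
        refine ⟨by omega, by omega, le_trans ?_ h6⟩
        rw [mul_assoc]
        exact Nat.mul_le_mul_left _ (by omega)
  · rintro τ ⟨h1, h2, h3, h4, -⟩
    simp [h2.leaves]
    omega
  · rintro t τ ⟨ht, h1, h2, h3, h4, h5, h6⟩
    rw [pow_succ] at h5
    rw [← hκ] at h4 h5 h6
    refine ⟨?_, h1, h2, h3, h4, by omega, h6⟩
    have c1 : (Expr.var .leaves - Expr.var .node : Expr).cost = 3 := rfl
    have c2 : Cmd.size (.set .node 1) = 2 := rfl
    simp only [c1, c2] at ht ⊢
    rw [show 60 * l.length + 40 = 60 * l.length + 35 + (3 + 2) by ring]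
    omega

-- The walk visits `v / 2 ^ j` for `j ≤ κ`, which are distinct and positive, so each ancestor is
-- increased once. The condition `1 ≤ w` excludes `0`, which also has the form `v / 2 ^ j` but
-- indexes the counter cell.
open Classical in
theorem runs_climb {p o v κ : ℕ} (hκ : K = 2 ^ κ) (hp : σ.reg .ptr = p) (ho : σ.reg .inc = o)
    (hv : σ.reg .node = v) (hv1 : K ≤ v) (hv2 : v < 2 * K) (hs : p + v < s) (hvX : v < X)
    (hX : ∀ w, 1 ≤ w → w < 2 * K → σ.mem (p + w) + o < X) :
    Runs X s climb σ fun t σ' => t ≤ 30 * (κ + 1) ∧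
      (∀ x ∉ [Var.right], σ'.reg x = σ.reg x) ∧
      ∀ a, σ'.mem a = σ.mem a +
        if ∃ w, 1 ≤ w ∧ IsAncestor w v ∧ a = p + w then o else 0 := by
  have hdivlt (j : ℕ) (hj : j ≤ κ) : 1 ≤ v / 2 ^ j :=
    Nat.div_pos ((Nat.pow_le_pow_right (by omega) hj).trans (hκ ▸ hv1)) (by positivity)
  have hdivle (j : ℕ) : v / 2 ^ j ≤ v := Nat.div_le_self _ _
  have hend : v / 2 ^ (κ + 1) = 0 := Nat.div_eq_of_lt (by rw [pow_succ, ← hκ]; omega)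
  refine Runs.seq (Runs.straight ?_ ?_)
  · simpa [Cmd.Straight, hv] using hvX
  refine (Runs.loop_const (fun j τ => (∀ x ∉ [Var.right], τ.reg x = σ.reg x) ∧
    τ.reg .right = v / 2 ^ j ∧
    ∀ a, τ.mem a = σ.mem a + if ∃ i < j, a = p + v / 2 ^ i then o else 0) (κ + 1) 20
    ?_ ?_ ?_).mono ?_
  · refine ⟨fun x hx => ?_, by simp [Cmd.after, hv], by simp [Cmd.after]⟩
    simp at hx
    simp [Cmd.after, hx]
  · rintro j hj τ ⟨h1, h2, h3⟩
    have hp' := h1 .ptr (by decide)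
    have ho' := h1 .inc (by decide)
    rw [hp] at hp'
    rw [ho] at ho'
    have hj1 := hdivlt j (by omega)
    have hj2 := hdivle j
    -- The visited nodes strictly decrease, so the current one has not been touched.
    have hnew : ¬∃ i < j, p + v / 2 ^ j = p + v / 2 ^ i := by
      rintro ⟨i, hi, h⟩
      have h4 : v / 2 ^ j ≤ v / 2 ^ (i + 1) :=
        Nat.div_le_div_left (Nat.pow_le_pow_right (by omega) hi) (by positivity)
      rw [pow_succ, ← Nat.div_div_eq_div_mul] at h4
      omega
    have hval : τ.mem (p + v / 2 ^ j) = σ.mem (p + v / 2 ^ j) := by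
      rw [h3, if_neg hnew, add_zero]
    refine ⟨by simp, by simp only [Expr.eval_var, h2]; omega,
      Runs.straight ?_ ⟨by decide, fun x hx => ?_, ?_, ?_⟩⟩
    · have := hX (v / 2 ^ j) hj1 (by omega)
      have := Nat.div_le_self (v / 2 ^ j) 2
      simp [Cmd.Straight, Cmd.after, h2, hp', ho', hval]
      omega
    · rw [← h1 x hx]
      simp at hx
      simp [Cmd.after, hx]
    · simp [Cmd.after, h2, pow_succ, Nat.div_div_eq_div_mul]
    · intro a
      simp only [Cmd.after, State.set_mem, State.put_mem, Expr.eval_add, Expr.eval_ld,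
        Expr.eval_var, h2, hp', ho', hval]
      rcases eq_or_ne a (p + v / 2 ^ j) with rfl | ha
      · rw [Function.update_self, if_pos ⟨j, Nat.lt_succ_self j, rfl⟩]
      · rw [Function.update_of_ne ha, h3]
        congr 2
        refine propext ⟨fun ⟨i, hi, h⟩ => ⟨i, by omega, h⟩, fun ⟨i, hi, h⟩ => ⟨i, ?_, h⟩⟩
        rcases eq_or_ne i j with rfl | hij
        · exact absurd h ha
        · omega
  · rintro τ ⟨h1, h2, h3⟩
    simp [h2, hend]
  · rintro t τ ⟨ht, h1, h2, h3⟩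
    refine ⟨?_, h1, fun a => ?_⟩
    · have c1 : (Expr.var .right : Expr).cost = 1 := rfl
      have c2 : Cmd.size (.set .right (.var .node)) = 2 := rfl
      simp only [c1, c2] at ht ⊢
      omega
    · rw [h3]
      congr 2
      refine propext ⟨fun ⟨i, hi, h⟩ => ⟨_, hdivlt i (by omega), ⟨i, rfl⟩, h⟩, ?_⟩
      rintro ⟨w, hw, ⟨i, rfl⟩, h⟩
      refine ⟨i, ?_, h⟩
      by_contra hi
      have h4 : v / 2 ^ i ≤ v / 2 ^ (κ + 1) :=
        Nat.div_le_div_left (Nat.pow_le_pow_right (by omega) (by omega)) (by positivity)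
      omega

open Classical in
/-- The new value of the cell `w` of the `i`-th tree. -/
noncomputable def updatedCell (g : ℕ → ℕ → ℕ) (v i w : ℕ) : ℕ :=
  if w = 0 then g i 0 + 1 else g i w + if IsAncestor w v then g i v + 1 else 0

/-- The chain lies below all trees and is not disturbed by the updates. As it has no repetitions,
each tree is updated once and is still in its old state at that moment. -/
theorem runs_updateTrees {u v κ : ℕ} {l : List ℕ} {g : ℕ → ℕ → ℕ} (hκ : K = 2 ^ κ)
    (hl : IsChain σ.mem z h (σ.mem (h + u)) l) (hlz : ∀ i ∈ l, i < z) (hln : l.Nodup)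
    (hL : Layout z n K Q h σ) (hu : σ.reg .elt = u) (hv : σ.reg .node = v) (hun : u < n)
    (hv1 : K ≤ v) (hv2 : v < 2 * K) (hg : ∀ i w, g i w = σ.mem (h + n + 2 * K * i + w))
    (hs : h + n + 2 * K * z ≤ s) (hX : h + n + 2 * K * z < X)
    (hgX : ∀ i ∈ l, ∀ w < 2 * K, g i w + (g i v + 1) < X)
    (hσX : ∀ a, σ.mem a < X) :
    Runs X s updateTrees σ fun t σ' => t ≤ l.length * (30 * (κ + 1) + 35) + 10 ∧
      Layout z n K Q h σ' ∧ σ'.reg .elt = u ∧ σ'.reg .node = v ∧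
      (∀ a, a < h + n ∨ h + n + 2 * K * z ≤ a → σ'.mem a = σ.mem a) ∧
      ∀ i < z, ∀ w < 2 * K, σ'.mem (h + n + 2 * K * i + w) =
        if i ∈ l then updatedCell g v i w else g i w := by
  have hK0 : 0 < K := by rw [hκ]; positivity
  refine Runs.seq (Runs.straight ?_ ?_)
  · simp [Cmd.Straight, hL.heads, hu, hσX]
    omega
  refine (Runs.loop_const (fun j τ => Layout z n K Q h τ ∧ τ.reg .elt = u ∧ τ.reg .node = v ∧
    IsChain σ.mem z h (τ.reg .link) (l.drop j) ∧
    (∀ a, a < h + n ∨ h + n + 2 * K * z ≤ a → τ.mem a = σ.mem a) ∧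
    ∀ i < z, ∀ w < 2 * K, τ.mem (h + n + 2 * K * i + w) =
      if i ∈ l ∧ i ∉ l.drop j then updatedCell g v i w else g i w) l.length (30 * (κ + 1) + 32)
    ?_ ?_ ?_).mono ?_
  · refine ⟨hL.congr fun x hx => ?_, by simp [Cmd.after, hu], by simp [Cmd.after, hv],
      by simpa [Cmd.after, hL.heads, hu] using hl, fun _ _ => rfl, fun i hi w hw => ?_⟩
    · simp [scratch] at hx
      simp [Cmd.after, hx]
    · simp [Cmd.after, hg]
  · rintro j hj τ ⟨h1, h2, h3, h4, h5, h6⟩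
    have hdrop := List.drop_eq_getElem_cons hj
    have hmem : l[j] ∈ l := List.getElem_mem hj
    have hi := hlz _ hmem
    have hnd : l[j] ∉ l.drop (j + 1) := by
      have := hln.sublist (List.drop_sublist j l)
      rw [hdrop, List.nodup_cons] at this
      exact this.1
    rw [hdrop] at h4
    set i := l[j]
    clear_value i
    obtain ⟨c1, c2, c3, c4⟩ := h4
    have hold (w : ℕ) (hw : w < 2 * K) : τ.mem (h + n + 2 * K * i + w) = g i w := by
      rw [h6 i hi w hw, if_neg]
      rw [hdrop]
      simp
    have hold0 := hold 0 (by omega)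
    rw [add_zero] at hold0
    have hc := cell_lt (K := K) (w := v) hi hv2
    have hlink := h5 (τ.reg .link) (.inl (by omega))
    have hdiv := Nat.div_le_self (σ.mem (τ.reg .link)) z
    have hlt := hσX (τ.reg .link)
    have hgX0 := hgX i hmem 0 (by omega)
    have hgXv := hgX i hmem v hv2
    -- Increasing the counter in cell `0` leaves the nodes of the tree unchanged.
    have hoff (w : ℕ) (hw : 1 ≤ w) (f : ℕ) :
        Function.update τ.mem (h + n + 2 * K * i) f (h + n + 2 * K * i + w) =
          τ.mem (h + n + 2 * K * i + w) := Function.update_of_ne (by omega) _ _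
    refine ⟨by simp, by simpa using c1, Runs.seq (Runs.straight ?_ ?_)⟩
    · simp [Cmd.Straight, Cmd.after, hlink, h1.numSets, h1.trees, h1.leaves, h3, c3, hold0, hσX,
        hoff v (by omega), hold v hv2]
      omega
    refine (runs_climb (p := h + n + 2 * K * i) (o := g i v + 1) (v := v) hκ ?_ ?_ ?_ hv1 hv2
      (by omega) (by omega) ?_).mono ?_
    · simp [Cmd.after, hlink, h1.numSets, h1.trees, h1.leaves, c3]
    · simp [Cmd.after, hlink, h1.numSets, h1.trees, h1.leaves, c3, h3, hoff v (by omega),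
        hold v hv2]
    · simp [Cmd.after, h3]
    · intro w hw1 hw2
      simpa [Cmd.after, hlink, h1.numSets, h1.trees, h1.leaves, c3, hoff w hw1, hold w hw2]
        using hgX i hmem w hw2
    · rintro t τ' ⟨ht, g1, g2⟩
      simp only [Cmd.after, State.set_mem, State.put_mem, State.set_reg, Expr.eval_add,
        Expr.eval_mul, Expr.eval_mod, Expr.eval_var, Expr.eval_ofNat, Expr.eval_ld, if_true,
        reduceCtorEq, if_false, hlink, h1.numSets, h1.trees, h1.leaves, c3, hold0] at g2
      refine ⟨?_, h1.congr fun x hx => ?_, ?_, ?_, ?_, fun a ha => ?_, fun i' hi' w hw => ?_⟩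
      · have c1 : Cmd.size (.seq (.set .ptr (.ld (.var .link)))
          (.seq (.set .link (Expr.var .ptr / .var .numSets))
            (.seq (.set .ptr (Expr.var .trees + 2 * .var .leaves * (Expr.var .ptr % .var .numSets)))
              (.seq (.put (.var .ptr) (.ld (.var .ptr) + 1))
                (.set .inc (.ld (Expr.var .ptr + .var .node) + 1)))))) = 30 := rfl
        simp only [c1]
        omega
      · simp [scratch] at hx
        rw [g1 x (by simp [hx])]
        simp [Cmd.after, hx]
      · rw [g1 _ (by decide)]
        simp [Cmd.after, h2]
      · rw [g1 _ (by decide)]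
        simp [Cmd.after, h3]
      · rw [g1 _ (by decide)]
        simpa [Cmd.after, hlink, h1.numSets] using c4
      · rw [g2, if_neg, add_zero, Function.update_of_ne (by omega), h5 a ha]
        rintro ⟨w, hw, ⟨e, rfl⟩, rfl⟩
        have := Nat.div_le_self v (2 ^ e)
        omega
      · rw [g2]
        by_cases hii : i' = i
        · rw [hii, if_pos (⟨hmem, hnd⟩ : i ∈ l ∧ i ∉ l.drop (j + 1)), updatedCell]
          rcases Nat.eq_zero_or_pos w with rfl | hw0
          · have hno : ¬∃ w, 1 ≤ w ∧ IsAncestor w v ∧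
                h + n + 2 * K * i + 0 = h + n + 2 * K * i + w := by
              rintro ⟨w, hw, -, h⟩
              omega
            rw [if_neg hno, if_pos rfl, add_zero, add_zero, Function.update_self]
          · rw [hoff w hw0, hold w hw, if_neg (by omega : w ≠ 0)]
            congr 2
            refine propext ⟨?_, fun ha => ⟨w, hw0, ha, rfl⟩⟩
            rintro ⟨w', hw', ha, h⟩
            obtain rfl : w = w' := by omega
            exact ha
        · have hne (w' : ℕ) (hw' : w' < 2 * K) :
              h + n + 2 * K * i' + w ≠ h + n + 2 * K * i + w' := by
            intro h
            exact hii (cell_inj hw hw' (by omega : 2 * K * i' + w = 2 * K * i + w')).1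
          have hno : ¬∃ w', 1 ≤ w' ∧ IsAncestor w' v ∧
              h + n + 2 * K * i' + w = h + n + 2 * K * i + w' := by
            rintro ⟨w', hw', ⟨e, rfl⟩, h⟩
            have := Nat.div_le_self v (2 ^ e)
            exact hne _ (by omega) h
          rw [if_neg hno, add_zero, Function.update_of_ne (by have := hne 0 (by omega); omega),
            h6 i' hi' w hw]
          refine if_congr ?_ rfl rfl
          rw [hdrop, List.mem_cons]
          tauto
  · rintro τ ⟨h1, h2, h3, h4, -⟩
    rw [List.drop_length] at h4
    exact ⟨by simp, by simpa [IsChain] using h4⟩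
  · rintro t τ ⟨ht, h1, h2, h3, h4, h5, h6⟩
    refine ⟨?_, h1, h2, h3, h5, by simpa using h6⟩
    have c1 : (Expr.var .link : Expr).cost = 1 := rfl
    have c2 : Cmd.size (.set .link (.ld (Expr.var .heads + .var .elt))) = 5 := rfl
    simp only [c1, c2] at ht ⊢
    rw [show 30 * (κ + 1) + 35 = 30 * (κ + 1) + 32 + (1 + 2) by ring]
    omega

theorem runs_writeCodeword {u v b : ℕ} {f : ℕ → ℕ} (hQ : 1 < Q) (hL : Layout z n K Q h σ)
    (hb : b = h + n + 2 * K * z) (hu : σ.reg .elt = u) (hv : σ.reg .node = v) (hun : u < n)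
    (hv1 : K ≤ v) (hv2 : v < 2 * K) (hf : f u = v - K)
    (hprev : ∀ r < Q, (σ.mem (b + u / Q * Q + r) - 1) % Q = rsSymbol Q (u / Q) r)
    (hs : b + n * Q ≤ s) (hX : b + n * Q < X) (hKX : K * Q * Q < X) :
    Runs X s writeCodeword σ fun t σ' => t ≤ 50 * Q + 30 ∧
      Layout z n K Q h σ' ∧ σ'.reg .elt = u ∧
      (∀ a, a < b + u * Q ∨ b + (u + 1) * Q ≤ a → σ'.mem a = σ.mem a) ∧
      ∀ r < Q, σ'.mem (b + u * Q + r) = hashedSymbol Q f u r := by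
  have huQ : u * Q + Q ≤ n * Q := by
    rw [← Nat.succ_mul]
    exact Nat.mul_le_mul_right Q hun
  have hdivle : u / Q * Q ≤ u * Q := Nat.mul_le_mul_right Q (Nat.div_le_self u Q)
  refine Runs.seq (Runs.straight ?_ ?_)
  · simp [Cmd.Straight, Cmd.after, hL.base, hL.weight, hu, ← hb]
    omega
  refine (Runs.loop_const (fun r τ => Layout z n K Q h τ ∧ τ.reg .elt = u ∧ τ.reg .node = v ∧
    τ.reg .row = r ∧ τ.reg .ptr = b + u * Q ∧ τ.reg .right = b + u / Q * Q ∧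
    (∀ a, a < b + u * Q ∨ b + u * Q + r ≤ a → τ.mem a = σ.mem a) ∧
      ∀ i < r, τ.mem (b + u * Q + i) = hashedSymbol Q f u i) Q 40 ?_ ?_ ?_).mono ?_
  · refine ⟨hL.congr fun x hx => ?_, ?_⟩
    · simp [scratch] at hx
      simp [Cmd.after, hx]
    · simp [Cmd.after, hL.base, hL.weight, hu, hv, ← hb]
  · rintro r hr τ ⟨h1, h2, h3, h4, h5, h6, h7, h8⟩
    -- For `u > 0` the block of `u / Q` ends before that of `u`. For `u = 0` the two blocks
    -- coincide, but row `r` is read before it is overwritten.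
    have hread : τ.mem (b + u / Q * Q + r) = σ.mem (b + u / Q * Q + r) := by
      apply h7
      rcases Nat.eq_zero_or_pos u with rfl | hu0
      · simp
      · have : u / Q < u := Nat.div_lt_self hu0 hQ
        have : (u / Q + 1) * Q ≤ u * Q := Nat.mul_le_mul_right Q this
        rw [Nat.succ_mul] at this
        omega
    have hval : 1 + ((v - K) * Q + r) * Q + (rsSymbol Q (u / Q) r * r + u % Q) % Q =
        hashedSymbol Q f u r := by
      rw [← rsSymbol_eq hQ, hashedSymbol, hf]
    have hvalX : hashedSymbol Q f u r < X := by
      have h9 := rsSymbol_lt (by omega : 0 < Q) u r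
      have h10 : (v - K) * Q + r + 1 ≤ K * Q := by
        calc (v - K) * Q + r + 1 ≤ (v - K) * Q + Q := by omega
          _ = (v - K + 1) * Q := by ring
          _ ≤ K * Q := Nat.mul_le_mul_right Q (by omega)
      have h11 := Nat.mul_le_mul_right Q h10
      rw [Nat.succ_mul] at h11
      rw [hashedSymbol, hf]
      omega
    refine ⟨by simp, by simp [h1.weight, h4]; omega, Runs.straight ?_ ⟨by decide, ?_⟩⟩
    · simp [Cmd.Straight, Cmd.after, h1.weight, h1.leaves, h2, h3, h4, h5, h6, hread, hprev r hr,
        hval, hvalX, -Nat.add_mod_mod]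
      omega
    · refine ⟨h1.congr fun x hx => ?_, by simp [Cmd.after, h2], by simp [Cmd.after, h3],
        by simp [Cmd.after, h4], by simp [Cmd.after, h5], by simp [Cmd.after, h6],
        fun a ha => ?_, fun i hi => ?_⟩
      · simp [scratch] at hx
        simp [Cmd.after, hx]
      · simp only [Cmd.after, State.set_mem, State.put_mem, Expr.eval_add, Expr.eval_var, h4, h5]
        rw [Function.update_of_ne (by omega)]
        exact h7 a (by omega)
      · simp [Cmd.after, h1.weight, h1.leaves, h2, h3, h4, h5, h6, hread, hprev r hr, hval,
          -Nat.add_mod_mod]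
        rcases eq_or_ne i r with rfl | hir
        · rw [Function.update_self]
        · rw [Function.update_of_ne (by omega)]
          exact h8 i (by omega)
  · rintro τ ⟨h1, h2, h3, h4, -⟩
    simp [h1.weight, h4]
  · rintro t τ ⟨ht, h1, h2, h3, h4, h5, h6, h7, h8⟩
    refine ⟨?_, h1, h2, fun a ha => h7 a ?_, h8⟩
    · have c1 : (Expr.var .weight - Expr.var .row : Expr).cost = 3 := rfl
      have c2 : Cmd.size (.seq (.set .row 0)
        (.seq (.set .ptr (Expr.var .base + Expr.var .elt * Expr.var .weight))
          (.set .right (Expr.var .base + Expr.var .elt / Expr.var .weight * Expr.var .weight))))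
        = 16 := rfl
      simp only [c1, c2] at ht ⊢
      omega
    · rw [Nat.succ_mul] at ha
      omega

end

end WordRAM

/-! ### The main loop over the universe. -/

namespace WordRAM

theorem Exec.state_below {X s t : ℕ} {c : Cmd} {σ σ' : State} (h : Exec X s c σ t σ')
    (hσ : σ.Below X) : σ'.Below X := by
  induction h with
  | set _ hX => exact hσ.set hX
  | put _ _ _ hX => exact hσ.put hX
  | seq _ _ ih₁ ih₂ => exact ih₂ (ih₁ hσ)
  | iteTrue _ _ _ ih => exact ih hσ
  | iteFalse _ _ _ ih => exact ih hσ
  | loopTrue _ _ _ _ ih₁ ih₂ => exact ih₂ (ih₁ hσ)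
  | loopFalse _ _ => exact hσ

theorem Runs.below {X s : ℕ} {c : Cmd} {σ : State} {Q : ℕ → State → Prop} (h : Runs X s c σ Q)
    (hσ : σ.Below X) : Runs X s c σ fun t σ' => Q t σ' ∧ σ'.Below X := by
  obtain ⟨t, σ', h, hq⟩ := h
  exact ⟨t, σ', h, hq, h.state_below hσ⟩

theorem Runs.and_below {X s : ℕ} {c : Cmd} {σ : State} {P : ℕ → Prop} {I : State → Prop}
    (h : Runs X s c σ fun t σ' => P t ∧ I σ') (hσ : σ.Below X) :
    Runs X s c σ fun t σ' => P t ∧ I σ' ∧ σ'.Below X :=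
  (h.below hσ).mono fun _ _ h => ⟨h.1.1, h.1.2, h.2⟩

section

variable {X s : ℕ} {σ : State} {z n K Q h : ℕ}

/-- The loop invariant joins the balancing invariant, read off the tree cells, to the correctness of
the codewords written so far. The hash function exists only in the proof; the program stores no more
than its trace in the codewords. -/
theorem runs_writeCode {k κ b : ℕ} {A : ℕ → List ℕ} (hAk : ∀ i < z, (A i).length ≤ k)
    (hk : 2 * k ≤ K) (hκ : K = 2 ^ κ) (hQ : 1 < Q) (hL : Layout z n K Q h σ)
    (hb : b = h + n + 2 * K * z)
    (hlink : Linked σ.mem z h h n fun i u => i < z ∧ u ∈ A i)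
    (hzero : ∀ a, h + n ≤ a → σ.mem a = 0) (hσ : σ.Below X) (hs : b + n * Q ≤ s)
    (hX : b + n * Q < X) (hX1 : K * Q * Q < X) (hX2 : z * (K * K) < X) (hX3 : 4 * z * K < X)
    (hX4 : 2 * K < X) :
    Runs X s writeCode σ fun t σ' =>
      t ≤ ∑ u ∈ Finset.range n, (125 * ((κ + 1) *
        (((Finset.range z).filter fun i => u ∈ A i).card + 1)) + 50 * Q + 5) + 10 ∧
      Layout z n K Q h σ' ∧ ∃ f : ℕ → ℕ, (∀ u < n, K ≤ f u ∧ f u < 2 * K) ∧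
        (∀ i < z, ∀ v, K ≤ v → v < 2 * K →
          2 ^ ((A i).toFinset.filter fun x => x < n ∧ f x = v).card ≤ 2 * z * K) ∧
        ∀ u < n, ∀ r < Q, σ'.mem (b + u * Q + r) = hashedSymbol Q (fun x => f x - K) u r := by
  have hK0 : 0 < K := by rw [hκ]; positivity
  have hcard (i : ℕ) (hi : i < z) : (A i).toFinset.card ≤ k :=
    (List.toFinset_card_le _).trans (hAk i hi)
  have hnQ : n ≤ n * Q := Nat.le_mul_of_pos_right n (by omega)
  refine Runs.seq (Runs.straight ?_ ?_)
  · simp [Cmd.Straight]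
    omega
  refine (Runs.loop (fun u τ => (Layout z n K Q h τ ∧ τ.reg .elt = u ∧
    (∀ a < h + n, τ.mem a = σ.mem a) ∧ (∀ a, b + u * Q ≤ a → τ.mem a = 0) ∧
    ∃ f : ℕ → ℕ, (∀ u' < u, K ≤ f u' ∧ f u' < 2 * K) ∧
      BalancedTrees (fun i => (A i).toFinset) z K u f
        (fun i w => τ.mem (h + n + 2 * K * i + w)) ∧
      ∀ u' < u, ∀ r < Q,
        τ.mem (b + u' * Q + r) = hashedSymbol Q (fun x => f x - K) u' r) ∧ τ.Below X) n
    (fun u => 125 * ((κ + 1) *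
        (((Finset.range z).filter fun i => u ∈ A i).card + 1)) + 50 * Q) ?_ ?_ ?_).mono ?_
  · refine ⟨⟨hL.congr fun x hx => ?_, by simp [Cmd.after], fun _ _ => rfl,
      -- The initial hash function is arbitrary, as no element has been placed.
      fun a ha => hzero a (by omega), fun _ => K, by simp, ?_, by simp⟩,
      hσ.set (by simp only [Expr.eval_ofNat]; omega)⟩
    · simp [scratch] at hx
      simp [Cmd.after, hx]
    · refine (BalancedTrees.init _ z K _).congr hK0 fun i _ w _ => hzero _ (by omega)
  · rintro u hu τ ⟨⟨h1, h2, h3, h4, f, h5, h6, h7⟩, hτ⟩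
    obtain ⟨l, hl, hln, hlm⟩ := hlink u hu
    have hlz : ∀ i ∈ l, i < z := fun i hi => ((hlm i).mp hi).1
    have hlmem (i : ℕ) (hi : i < z) : i ∈ l ↔ u ∈ (A i).toFinset := by
      rw [hlm, List.mem_toFinset]
      tauto
    have hlfin : l.toFinset = (Finset.range z).filter fun i => u ∈ (A i).toFinset := by
      ext i
      simp [hlm]
    have hlen : l.length = ((Finset.range z).filter fun i => u ∈ A i).card := by
      rw [← List.toFinset_card_of_nodup hln, hlfin]
      simp only [List.mem_toFinset]
    have hlsum (G : ℕ → ℕ) : (l.map G).sum =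
        ∑ i ∈ (Finset.range z).filter (fun i => u ∈ (A i).toFinset), G i := by
      rw [← List.sum_toFinset _ hln, hlfin]
    set g : ℕ → ℕ → ℕ := fun i w => τ.mem (h + n + 2 * K * i + w) with hg
    set F : ℕ → ℕ → ℕ := fun i w => (K - 1 - τ.mem (h + n + 2 * K * i)) *
      τ.mem (h + n + 2 * K * i + w) with hF
    -- The sums compared during the descent are bounded by the potential, hence fit into a word.
    have hFX : (l.map fun i => F i 1).sum < X := by
      refine lt_of_le_of_lt ?_ hX2
      rw [hlsum]
      refine le_trans (le_trans (Finset.sum_le_sum fun i _ => ?_) (Finset.sum_le_sum_of_subset (Finset.filter_subset _ _)))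
        h6.potential
      exact Nat.mul_le_mul (by simp only [hg, add_zero]; omega) (Nat.le_add_right _ _)
    have hchain : ∀ μ : ℕ → ℕ, (∀ a < h + n, μ a = σ.mem a) → IsChain μ z h (μ (h + u)) l := by
      intro μ hμ
      rw [hμ _ (by omega)]
      exact hl.congr le_rfl fun x hx => hμ x (by omega)
    refine ⟨by simp, by simp [h1.univ, h2]; omega, Runs.and_below (Runs.seq ?_) hτ⟩
    refine ((runs_descend (F := F) (u := u) hκ (hchain _ h3) hlz h1 h2 hu (fun _ _ => rfl)
      ?_ (by omega) (by omega) hFX hX4 hτ.2).below hτ).mono ?_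
    · intro i hi v hv1 hv2
      exact h6.node i hi v hv1 hv2
    rintro t₁ τ₁ ⟨⟨ht₁, g1, g2, g3, g4, g5, g6⟩, hτ₁⟩
    obtain ⟨v, hv⟩ : ∃ v, v = τ₁.reg .node := ⟨_, rfl⟩
    rw [← hv] at g4 g5 g6
    refine Runs.seq ?_
    refine ((runs_updateTrees (g := g) (u := u) hκ (hchain _ (by rw [g1]; exact h3)) hlz hln g2 g3
      hv.symm hu g4 g5 (by rw [g1]; exact fun _ _ => rfl) (by omega) (by omega)
      ?_ hτ₁.2).below hτ₁).mono ?_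
    · intro i hi w hw
      have hi' := hlz i hi
      have e1 := h6.root_le hi' (hcard i hi') hk hK0
      have e2 := h6.le_root hi' (by omega : 1 ≤ v) g5
      -- Cell `0` holds a counter, at most `k ≤ K`; every other cell is bounded by the root.
      have e3 : g i w ≤ g i 1 + K := by
        rcases Nat.eq_zero_or_pos w with rfl | hw0
        · have := h6.count i hi'
          have := Finset.card_filter_le (A i).toFinset (· < u)
          have := hcard i hi'
          omega
        · exact (h6.le_root hi' hw0 hw).trans (Nat.le_add_right _ _)
      have e4 : 4 * z * K = 2 * z * K + 2 * z * K := by ring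
      omega
    rintro t₂ τ₂ ⟨⟨ht₂, k1, k2, k3, k4, k5⟩, hτ₂⟩
    rw [g1] at k4
    have hlow : ∀ a < h + n, τ₂.mem a = σ.mem a := fun a ha => by rw [k4 a (.inl ha), h3 a ha]
    have hhigh : ∀ a, b ≤ a → τ₂.mem a = τ.mem a := fun a ha => k4 a (.inr (by omega))
    -- Earlier codewords do not see the new hash value.
    have hupd (u' : ℕ) (hu' : u' < u) (r : ℕ) :
        hashedSymbol Q (fun x => Function.update f u v x - K) u' r =
          hashedSymbol Q (fun x => f x - K) u' r := by
      simp [hashedSymbol, hu'.ne]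
    refine Runs.seq ?_
    refine (runs_writeCodeword (f := fun x => Function.update f u v x - K) (v := v) hQ k1 hb k2 k3
      hu g4 g5 (by simp) ?_ hs hX hX1).mono ?_
    · intro r hr
      rw [hhigh _ (by omega)]
      rcases Nat.eq_zero_or_pos u with rfl | hu0
      -- For `u = 0` the block is still zero, and truncated subtraction makes `0 - 1` the correct
      -- symbol `0`.
      · rw [h4 _ (by simp), Nat.zero_div, rsSymbol_zero]
        simp
      · have e1 : u / Q < u := Nat.div_lt_self hu0 hQ
        rw [h7 _ e1 r hr, hashedSymbol, add_assoc, Nat.add_sub_cancel_left, Nat.mul_add_mod',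
          Nat.mod_eq_of_lt (rsSymbol_lt (by omega) _ _)]
    rintro t₃ τ₃ ⟨ht₃, m1, m2, m3, m4⟩
    have hsmall (a : ℕ) (ha : a < b) : τ₃.mem a = τ₂.mem a := m3 a (.inl (by omega))
    refine Runs.straight ?_ ⟨?_, m1.congr fun x hx => ?_, by simp [Cmd.after, m2], ?_, ?_,
      Function.update f u v, ?_, ?_, ?_⟩
    · simp [Cmd.Straight, m2]
      omega
    · have c1 : Cmd.size (.set .elt (Expr.var .elt + 1)) = 4 := rfl
      simp only [c1]
      rw [← hlen]
      have e1 : 125 * ((κ + 1) * (l.length + 1)) = (κ * (60 * l.length + 40) + 10) +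
          (l.length * (30 * (κ + 1) + 35) + 10) + (35 * (κ * l.length) + 85 * κ + 60 * l.length +
          105) := by ring
      omega
    · simp [scratch] at hx
      simp [Cmd.after, hx]
    · intro a ha
      exact (hsmall a (by omega)).trans (hlow a ha)
    · intro a ha
      have e1 : b + u * Q ≤ a := le_trans (by rw [Nat.succ_mul]; omega) ha
      exact (m3 a (.inr ha)).trans ((hhigh a (by omega)).trans (h4 a e1))
    · intro u' hu'
      rcases eq_or_ne u' u with rfl | hne
      · simpa using ⟨g4, g5⟩
      · simpa [hne] using h5 u' (by omega)
    · have hcell (i : ℕ) (hi : i < z) (w : ℕ) (hw : w < 2 * K) :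
          τ₃.mem (h + n + 2 * K * i + w) =
            if u ∈ (A i).toFinset then updatedCell g v i w else g i w := by
        rw [hsmall _ (by have := cell_lt hi hw; omega), k5 i hi w hw]
        exact if_congr (hlmem i hi) rfl rfl
      refine h6.step (fun i hi => (hcard i hi).trans (by omega)) hκ g4 g5 ?_ ?_ ?_ ?_ ?_
      · rw [hlsum, hlsum] at g6
        exact g6
      · intro i hi hui
        refine (hcell i hi 0 (by omega)).trans ?_
        rw [if_pos hui, updatedCell, if_pos rfl]
      · intro i hi hui w hw1 hw2 ha
        refine (hcell i hi w hw2).trans ?_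
        rw [if_pos hui, updatedCell, if_neg (by omega), if_pos ha]
      · intro i hi hui w hw1 hw2 ha
        refine (hcell i hi w hw2).trans ?_
        rw [if_pos hui, updatedCell, if_neg (by omega), if_neg ha, add_zero]
      · intro i hi hui w hw
        refine (hcell i hi w hw).trans ?_
        rw [if_neg hui]
    · intro u' hu' r hr
      rcases eq_or_ne u' u with rfl | hne
      · exact m4 r hr
      · have e1 : u' < u := by omega
        have e2 : (u' + 1) * Q ≤ u * Q := Nat.mul_le_mul_right Q e1
        rw [Nat.succ_mul] at e2
        rw [hupd u' e1]
        exact (m3 _ (.inl (by omega))).trans ((hhigh _ (by omega)).trans (h7 u' e1 r hr))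
  · rintro τ ⟨⟨h1, h2, -⟩, -⟩
    simp [h1.univ, h2]
  · rintro t τ ⟨ht, ⟨h1, h2, h3, h4, f, h5, h6, h7⟩, -⟩
    refine ⟨?_, h1, f, h5, fun i hi v hv1 hv2 => ?_, h7⟩
    · have c1 : (Expr.var .univ - Expr.var .elt : Expr).cost = 3 := rfl
      have c2 : Cmd.size (.set .elt 0) = 2 := rfl
      simp only [c1, c2, Nat.reduceAdd] at ht ⊢
      omega
    · exact h6.two_pow_load_le hi (hcard i hi) hk hK0 hv1 hv2

end

end WordRAM

/-! ### Parameters and total running time. -/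

namespace WordRAM

theorem length_inputFrom_le {z k : ℕ} {A : ℕ → List ℕ} (hA : ∀ i < z, (A i).length ≤ k) :
    (inputFrom z A 0).length ≤ z + z * k := by
  rw [inputFrom, List.length_flatMap]
  refine (List.sum_le_card_nsmul _ (k + 1) fun x hx => ?_).trans ?_
  · obtain ⟨i, hi, rfl⟩ := List.mem_map.mp hx
    rw [List.mem_range'_1] at hi
    have := hA i (by omega)
    simp only [List.length_cons]
    omega
  · simp only [List.length_map, List.length_range', smul_eq_mul]
    rw [mul_add]
    simp [add_comm]

section

variable {X s : ℕ} {σ : State}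

/-- The parameters of the hashed code: the number of leaves `K` of the balancing trees, the
logarithm `m` of the size of the universe, and the lower bound `M` for the weight. -/
structure CodeParams (z k p q K κ m M : ℕ) : Prop where
  two_le : 2 ≤ z * k
  num_pos : 0 < p
  num_lt : p < q
  leaves_eq : K = 2 ^ κ
  le_leaves : 2 * k ≤ K
  leaves_lt : K < 4 * k
  depth_le : κ ≤ m + 1
  univ_le : z * k ≤ 2 ^ m
  lt_univ : 2 ^ m < 2 * (z * k)
  bound_eq : (m + 2) * (m + 2) * q / p = M

namespace CodeParams

variable {z k p q K κ m M : ℕ}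

theorem exists_of (h : 2 ≤ z * k) (hp : 0 < p) (hpq : p < q) :
    CodeParams z k p q (2 ^ Nat.clog 2 (2 * k)) (Nat.clog 2 (2 * k)) (Nat.clog 2 (z * k))
      ((Nat.clog 2 (z * k) + 2) * (Nat.clog 2 (z * k) + 2) * q / p) := by
  have hz : 0 < z := Nat.pos_of_mul_pos_right (by omega : 0 < z * k)
  have hk : 0 < k := Nat.pos_of_mul_pos_left (by omega : 0 < z * k)
  have hpow {x : ℕ} (hx : 1 < x) : 2 ^ Nat.clog 2 x < 2 * x := by
    have h1 := Nat.pow_pred_clog_lt_self (b := 2) (by omega) hx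
    have h2 := Nat.clog_pos (b := 2) (by omega) hx
    rw [← Nat.succ_pred_eq_of_pos h2, pow_succ]
    omega
  have h1 := Nat.le_pow_clog (b := 2) (by omega) (z * k)
  refine ⟨h, hp, hpq, rfl, Nat.le_pow_clog (by omega) _, ?_, ?_, h1, hpow (by omega), rfl⟩
  · have := hpow (x := 2 * k) (by omega)
    omega
  · refine Nat.clog_le_of_le_pow ?_
    rw [pow_succ]
    have := Nat.le_mul_of_pos_left k hz
    omega

theorem pos (h : CodeParams z k p q K κ m M) : 0 < z ∧ 0 < k :=
  ⟨Nat.pos_of_mul_pos_right (by have := h.two_le; omega : 0 < z * k),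
    Nat.pos_of_mul_pos_left (by have := h.two_le; omega : 0 < z * k)⟩

theorem sq_le (h : CodeParams z k p q K κ m M) : (m + 2) * (m + 2) ≤ M := by
  rw [← h.bound_eq, Nat.le_div_iff_mul_le h.num_pos]
  exact Nat.mul_le_mul_left _ h.num_lt.le

/-- Since the depth of the trees is at most `m + 1`, this makes balancing no more expensive than
writing the codewords. -/
theorem add_two_le (h : CodeParams z k p q K κ m M) : m + 2 ≤ M :=
  (Nat.le_mul_of_pos_left _ (by omega)).trans h.sq_le

end CodeParams

/-- All numbers that occur in the construction are below `X`. -/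
structure WordBound (X z k p q K m M : ℕ) : Prop where
  input : p + q + z + k + z * k + 4 < X
  log : 2 ^ m + m + 2 < X
  weight : 2 * M + 1 < X
  length : K * (2 * M) * (2 * M) < X
  lists : (4 + z + z * k) * z + z < X
  space : 4 + z + z * k + z * k + 2 * K * z + z * k * (2 * M) < X
  trees : z * (K * K) < X
  cells : 4 * z * K < X

/-- The dominant costs are the search for the prime, `O(Q²)`, and the main loop, `O(zkQ)`. -/
theorem runs_hashedCode {z k p q K κ m M : ℕ} {A : ℕ → List ℕ}
    (hP : CodeParams z k p q K κ m M) (hW : WordBound X z k p q K m M)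
    (hκ : κ = Nat.clog 2 (2 * k)) (hm : m = Nat.clog 2 (z * k))
    (hA : ∀ i < z, (A i).Nodup) (hAk : ∀ i < z, (A i).length ≤ k)
    (hAn : ∀ i < z, ∀ u ∈ A i, u < z * k) (hz : σ.reg .numSets = z) (hk : σ.reg .maxSize = k)
    (hp : σ.reg .num = p) (hq : σ.reg .den = q) (hn : σ.reg .univ = z * k)
    (hmem : σ.mem = fun a => (z :: k :: p :: q :: inputFrom z A 0).getD a 0) (hσ : σ.Below X)
    (hs : s = 4 + z + z * k + z * k + 2 * K * z + z * k * (2 * M)) :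
    Runs X s hashedCode σ fun t σ' => ∃ (Q b : ℕ) (f : ℕ → ℕ), Q.Prime ∧ M < Q ∧ Q ≤ 2 * M ∧
      t ≤ 400 * (z * k * Q) + 40 * (Q * Q) ∧
      σ'.reg .weight = Q ∧ σ'.reg .length = K * Q * Q ∧ σ'.reg .base = b ∧
      (∀ u < z * k, K ≤ f u ∧ f u < 2 * K) ∧
      (∀ i < z, ∀ v, K ≤ v → v < 2 * K →
        2 ^ ((A i).toFinset.filter fun x => x < z * k ∧ f x = v).card ≤ 2 * z * K) ∧
      ∀ u < z * k, ∀ r < Q, σ'.mem (b + u * Q + r) = hashedSymbol Q (fun x => f x - K) u r := by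
  obtain ⟨hz0, hk0⟩ := hP.pos
  have hn2 := hP.two_le
  have hKz : K ≤ 4 * z * K := Nat.le_mul_of_pos_left K (by omega)
  have hKz2 : 4 * z * K = 2 * (2 * K * z) := by ring
  have hKK : 2 * K ≤ 2 * K * z := Nat.le_mul_of_pos_right _ hz0
  have hW1 := hW.input
  have hW2 := hW.log
  have hW3 := hW.weight
  have hW4 := hW.length
  have hW5 := hW.lists
  have hW6 := hW.space
  have hW8 := hW.cells
  have hM := hP.add_two_le
  refine Runs.seq (((runs_computeLeaves hk (by rw [← hκ, ← hP.leaves_eq]; omega)).below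
    hσ).mono ?_)
  rintro t₁ σ₁ ⟨⟨ht₁, a1, a2, a3⟩, hσ₁⟩
  rw [← hκ] at ht₁
  rw [← hκ, ← hP.leaves_eq] at a3
  refine Runs.seq (((runs_computeLog (n := z * k) (by rw [a2 _ (by decide), hn])
    (by rw [← hm]; omega) (by rw [← hm]; omega)).below hσ₁).mono ?_)
  rintro t₂ σ₂ ⟨⟨ht₂, b1, b2, b3⟩, hσ₂⟩
  rw [← hm] at ht₂ b3
  refine Runs.seq (((runs_computeWeight b3 (p := p) (q := q)
    (by rw [b2 _ (by decide), a2 _ (by decide), hp])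
    (by rw [b2 _ (by decide), a2 _ (by decide), hq]) hP.bound_eq (by omega)
    (by omega)).below hσ₂).mono ?_)
  rintro t₃ σ₃ ⟨⟨c1, c2, c3, c4, c5, ht₃⟩, hσ₃⟩
  obtain ⟨Q, hQ⟩ : ∃ Q, σ₃.reg .weight = Q := ⟨_, rfl⟩
  rw [hQ] at c3 c4 c5 ht₃
  have hKQ : K * Q * Q ≤ K * (2 * M) * (2 * M) :=
    Nat.mul_le_mul (Nat.mul_le_mul_left _ c5) c5
  have hnQ : z * k * Q ≤ z * k * (2 * M) := Nat.mul_le_mul_left _ c5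
  refine Runs.seq (((runs_computeLayout (z := z) (n := z * k) (K := K) (Q := Q)
    (by rw [c2 _ (by decide), b2 _ (by decide), a2 _ (by decide), hz])
    (by rw [c2 _ (by decide), b2 _ (by decide), a2 _ (by decide), hn])
    (by rw [c2 _ (by decide), b2 _ (by decide), a3]) hQ (by omega) (by omega)).below hσ₃).mono ?_)
  rintro t₄ σ₄ ⟨⟨ht₄, d1, d2, d3, d4, d5, d6⟩, hσ₄⟩
  have hmem₄ : σ₄.mem = σ.mem := by rw [d1, c1, b1, a1]
  have hlen := length_inputFrom_le hAk
  have hL₄ : Layout z (z * k) K Q (4 + z + z * k) σ₄ :=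
    ⟨by rw [d2 _ (by decide), c2 _ (by decide), b2 _ (by decide), a2 _ (by decide), hz],
      by rw [d2 _ (by decide), c2 _ (by decide), b2 _ (by decide), a2 _ (by decide), hn],
      by rw [d2 _ (by decide), c2 _ (by decide), b2 _ (by decide), a3],
      by rw [d2 _ (by decide), hQ], d4, d5, d6, d3⟩
  refine Runs.seq (((runs_buildLists (h := 4 + z + z * k) (n := z * k) hA hAn hL₄.numSets
    hL₄.heads ⟨by omega, fun j _ => ?_⟩ (fun x hx => ?_) (by omega) (by omega) hW5).below
    hσ₄).mono ?_)
  · rw [hmem₄, hmem, add_comm 4 j]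
    rfl
  · rw [hmem₄, hmem]
    refine List.getD_eq_default _ _ ?_
    simp only [List.length_cons]
    omega
  rintro t₅ σ₅ ⟨⟨ht₅, e1, e2, e3⟩, hσ₅⟩
  have hL₅ : Layout z (z * k) K Q (4 + z + z * k) σ₅ :=
    ⟨by rw [e1 _ (by decide), hL₄.numSets], by rw [e1 _ (by decide), hL₄.univ],
      by rw [e1 _ (by decide), hL₄.leaves], by rw [e1 _ (by decide), hL₄.weight],
      by rw [e1 _ (by decide), hL₄.heads], by rw [e1 _ (by decide), hL₄.trees],
      by rw [e1 _ (by decide), hL₄.base], by rw [e1 _ (by decide), hL₄.length]⟩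
  refine (runs_writeCode hAk hP.le_leaves hP.leaves_eq c3.one_lt hL₅ rfl e3 e2 hσ₅ (by omega)
    (by omega) (by omega) hW.trees hW8 (by omega)).mono ?_
  rintro t₆ σ₆ ⟨ht₆, hL₆, f, f1, f2, f3⟩
  refine ⟨Q, _, f, c3, c4, c5, ?_, hL₆.weight, hL₆.length, hL₆.base, f1, f2, f3⟩
  have hsum1 : ∑ i ∈ Finset.range z, (A i).length ≤ z * k := by
    refine (Finset.sum_le_card_nsmul _ _ k fun i hi => hAk i (Finset.mem_range.mp hi)).trans ?_
    simp
  -- Double counting of the pairs of a set and one of its elements.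
  have hsum2 : ∑ u ∈ Finset.range (z * k), ((Finset.range z).filter fun i => u ∈ A i).card ≤
      z * k := by
    simp only [Finset.card_filter]
    rw [Finset.sum_comm]
    refine le_trans (Finset.sum_le_sum fun i _ => ?_) hsum1
    rw [← Finset.card_filter]
    refine le_trans (Finset.card_le_card fun u hu => ?_) (List.toFinset_card_le (A i))
    simpa using (Finset.mem_filter.mp hu).2
  have hz1 : z ≤ z * k := Nat.le_mul_of_pos_right z hk0
  have hκQ : κ + 1 ≤ Q := by have := hP.depth_le; omega
  have hT5 : t₅ ≤ 40 * (z * k) + 30 * z + 10 := by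
    refine ht₅.trans ?_
    rw [Finset.sum_add_distrib, ← Finset.mul_sum, Finset.sum_const, Finset.card_range, smul_eq_mul]
    omega
  have hT6 : t₆ ≤ 125 * ((κ + 1) * (z * k + z * k)) + 50 * (z * k * Q) + 5 * (z * k) + 10 := by
    refine ht₆.trans ?_
    rw [Finset.sum_add_distrib, Finset.sum_add_distrib, ← Finset.mul_sum, ← Finset.mul_sum,
      Finset.sum_add_distrib]
    simp only [Finset.sum_const, Finset.card_range, smul_eq_mul, mul_one]
    have h1 : (κ + 1) * (∑ u ∈ Finset.range (z * k),
        ((Finset.range z).filter fun i => u ∈ A i).card + z * k) ≤ (κ + 1) * (z * k + z * k) :=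
      Nat.mul_le_mul_left _ (by omega)
    have h2 : z * k * (50 * Q) = 50 * (z * k * Q) := by ring
    omega
  have hT6' : (κ + 1) * (z * k + z * k) ≤ 2 * (z * k * Q) := by
    calc (κ + 1) * (z * k + z * k) ≤ Q * (z * k + z * k) := Nat.mul_le_mul_right _ hκQ
      _ = 2 * (z * k * Q) := by ring
  have hQ2 := c3.two_le
  have h1 : 2 * Q ≤ z * k * Q := Nat.mul_le_mul_right Q hn2
  have h2 : z * k * 2 ≤ z * k * Q := Nat.mul_le_mul_left _ hQ2
  omega

/-- The test compares `q²` with `p²zk`, that is `ε⁻²` with the size of the universe; truncated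
subtraction makes it nonzero exactly in the second case. -/
theorem runs_construction {z k p q K κ m M : ℕ} {A : ℕ → List ℕ}
    (hP : CodeParams z k p q K κ m M) (hW : WordBound X z k p q K m M)
    (hκ : κ = Nat.clog 2 (2 * k)) (hm : m = Nat.clog 2 (z * k))
    (hA : ∀ i < z, (A i).Nodup) (hAk : ∀ i < z, (A i).length ≤ k)
    (hAn : ∀ i < z, ∀ u ∈ A i, u < z * k)
    (hσ : (State.initial (z :: k :: p :: q :: inputFrom z A 0)).Below X)
    (hs : s = 4 + z + z * k + z * k + 2 * K * z + z * k * (2 * M)) :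
    Runs X s construction (State.initial (z :: k :: p :: q :: inputFrom z A 0)) fun t σ' =>
      p * p * (z * k) ≤ q * q ∧ t ≤ 50 * (z * k) ∧ σ'.reg .weight = 1 ∧
        σ'.reg .length = z * k ∧ σ'.reg .base = 0 ∧ (∀ u < z * k, σ'.mem u = u + 1) ∨
      q * q < p * p * (z * k) ∧ ∃ (Q b : ℕ) (f : ℕ → ℕ), Q.Prime ∧ M < Q ∧ Q ≤ 2 * M ∧
      t ≤ 430 * (z * k * Q) + 40 * (Q * Q) ∧
      σ'.reg .weight = Q ∧ σ'.reg .length = K * Q * Q ∧ σ'.reg .base = b ∧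
      (∀ u < z * k, K ≤ f u ∧ f u < 2 * K) ∧
      (∀ i < z, ∀ v, K ≤ v → v < 2 * K →
        2 ^ ((A i).toFinset.filter fun x => x < z * k ∧ f x = v).card ≤ 2 * z * K) ∧
      ∀ u < z * k, ∀ r < Q, σ'.mem (b + u * Q + r) = hashedSymbol Q (fun x => f x - K) u r := by
  have hn2 := hP.two_le
  have hW1 := hW.input
  have hsize : readParameters.size = 16 := rfl
  have hcost : (Expr.var .num * Expr.var .num * Expr.var .univ -
    Expr.var .den * Expr.var .den : Expr).cost = 9 := rfl
  have hread : Runs X s readParameters (State.initial (z :: k :: p :: q :: inputFrom z A 0))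
      fun t τ => t = 16 ∧ τ.mem = (fun a => (z :: k :: p :: q :: inputFrom z A 0).getD a 0) ∧
        τ.reg .numSets = z ∧ τ.reg .maxSize = k ∧ τ.reg .num = p ∧ τ.reg .den = q ∧
        τ.reg .univ = z * k := by
    refine Runs.straight ?_ ⟨hsize, rfl, ?_⟩
    · simp [readParameters, Cmd.Straight, Cmd.after, State.initial]
      omega
    · simp [readParameters, Cmd.after, State.initial]
  refine Runs.seq ((hread.below hσ).mono ?_)
  rintro t₁ τ ⟨⟨ht₁, h1, h2, h3, h4, h5, h6⟩, hτ⟩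
  rcases le_or_gt (p * p * (z * k)) (q * q) with hc | hc
  · refine Runs.iteFalse (by simp) ?_ ?_
    · simp [h4, h5, h6]
      omega
    refine (runs_disjointCode h6 (by omega) (by omega)).mono ?_
    rintro t₂ σ' ⟨ht₂, h⟩
    refine .inl ⟨hc, ?_, h⟩
    rw [hcost]
    omega
  · refine Runs.iteTrue (by simp) ?_ ?_
    · simp only [Expr.eval_sub, Expr.eval_mul, Expr.eval_var, h4, h5, h6]
      omega
    refine (runs_hashedCode hP hW hκ hm hA hAk hAn h2 h3 h4 h5 h6 h1 hτ hs).mono ?_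
    rintro t₂ σ' ⟨Q, b, f, g1, g2, g3, g4, g5⟩
    refine .inr ⟨hc, Q, b, f, g1, g2, g3, ?_, g5⟩
    rw [hcost]
    have h7 : 2 * 2 ≤ z * k * Q := Nat.mul_le_mul hn2 g1.two_le
    omega

end

end WordRAM

/-! ### The theorem -/

/-- The lists of the elements of the sets, as lists of natural numbers. -/
def setList {z n : ℕ} (L : Fin z → List (Fin n)) (i : ℕ) : List ℕ :=
  if h : i < z then (L ⟨i, h⟩).map Fin.val else []

theorem setList_of_lt {z n : ℕ} (L : Fin z → List (Fin n)) {i : ℕ} (h : i < z) :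
    setList L i = (L ⟨i, h⟩).map Fin.val := dif_pos h

theorem encodeInput_eq (z k p q : ℕ) (L : Fin z → List (Fin (z * k))) :
    encodeInput z k p q L = z :: k :: p :: q :: WordRAM.inputFrom z (setList L) 0 := by
  simp only [encodeInput, WordRAM.inputFrom, List.cons.injEq, true_and, Nat.sub_zero]
  rw [List.ofFn_eq_map, ← List.range_eq_range', ← List.map_coe_finRange_eq_range, List.flatMap_map,
    List.flatMap_map]
  simp [setList]

/-- Hashed Reed-Solomon codes with a balanced hash function are superimposed codes. -/
theorem isSuperimposedCode_of_hashedSymbol {z n K Q m : ℕ} {ε : ℝ} {S : Fin z → Finset (Fin n)}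
    {f : ℕ → ℕ} {C : Fin n → Finset ℕ} (hQ : Q.Prime)
    (hC : ∀ u, C u = (Finset.range Q).image (hashedSymbol Q (fun x => f x - K) u))
    (hf : ∀ u < n, K ≤ f u ∧ f u < 2 * K) (hm : n ≤ 2 ^ m)
    (hload : ∀ i v, K ≤ v → v < 2 * K → ((S i).filter fun x : Fin n => f x = v).card ≤ m + 2)
    (hε : ((m + 2) * (m + 2) : ℕ) ≤ ε * Q) :
    IsSuperimposedCode S ((1 - ε) * Q) (K * Q * Q) Q C := by
  have hpow : ∀ u : Fin n, (u : ℕ) < Q ^ m := fun u =>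
    (u.2.trans_le hm).trans_le (Nat.pow_le_pow_left hQ.two_le m)
  refine ⟨fun u x hx => ?_, fun u => ?_, fun i u hu => ?_⟩
  · rw [hC, Finset.mem_image] at hx
    obtain ⟨r, hr, rfl⟩ := hx
    rw [Finset.mem_range] at hr
    have h1 := rsSymbol_lt hQ.pos u r
    have h2 := hf u u.2
    have h3 : (f u - K) * Q + r + 1 ≤ K * Q :=
      calc (f u - K) * Q + r + 1 ≤ (f u - K) * Q + Q := by omega
        _ = (f u - K + 1) * Q := by ring
        _ ≤ K * Q := Nat.mul_le_mul_right Q (by omega)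
    have h4 := Nat.mul_le_mul_right Q h3
    rw [Nat.succ_mul] at h4
    rw [Finset.mem_Icc, hashedSymbol]
    omega
  · rw [hC, Finset.card_image_of_injOn, Finset.card_range]
    intro r hr t ht h
    rw [Finset.mem_coe, Finset.mem_range] at hr ht
    exact (hashedSymbol_inj hQ.pos hr ht h).2.1
  · have hbi : (S i).biUnion C = ((S i).map Fin.valEmbedding).biUnion fun v =>
        (Finset.range Q).image (hashedSymbol Q (fun x => f x - K) v) := by
      ext x
      simp [hC]
    -- All hash values are at least `K`, so shifting them down by `K` keeps the fibres.
    have hB : (((S i).map Fin.valEmbedding).filter fun v => f v - K = f u - K).card ≤ m + 2 := by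
      refine le_trans (le_of_eq ?_) (hload i (f u) (hf u u.2).1 (hf u u.2).2)
      rw [Finset.filter_map, Finset.card_map]
      congr 1
      refine Finset.filter_congr fun v _ => ?_
      have h1 := hf v v.2
      have h2 := hf u u.2
      simp only [Function.comp_apply, Fin.valEmbedding_apply]
      omega
    have h := card_hashedSymbol_sdiff (T := (S i).map Fin.valEmbedding) (u := u) hQ
      (fun v hv => by
        obtain ⟨v, -, rfl⟩ := Finset.mem_map.mp hv
        exact hpow v) (hpow u)
      (fun h => by
        obtain ⟨v, hv, h⟩ := Finset.mem_map.mp h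
        obtain rfl : v = u := Fin.ext h
        exact hu hv) hB
    rw [← hbi, ← hC] at h
    -- There are at most `(m + 2) * m` collisions, rounded up to `(m + 2)²`.
    have h1 : (Q : ℝ) ≤ ((C u \ (S i).biUnion C).card : ℝ) + ((m + 2) * (m + 2) : ℕ) := by
      exact_mod_cast h.trans (Nat.add_le_add_left (Nat.mul_le_mul_left _ (by omega)) _)
    linarith

/-- The trivial superimposed code with disjoint codewords. -/
theorem isSuperimposedCode_singleton {z n : ℕ} {ε : ℝ} {S : Fin z → Finset (Fin n)}
    {C : Fin n → Finset ℕ} (hC : ∀ u, C u = {(u : ℕ) + 1}) (hε : 0 ≤ ε) :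
    IsSuperimposedCode S ((1 - ε) * (1 : ℕ)) n 1 C := by
  refine ⟨fun u => ?_, fun u => by simp [hC], fun i u hu => ?_⟩
  · rw [hC, Finset.singleton_subset_iff, Finset.mem_Icc]
    have := u.2
    omega
  · have h : C u \ (S i).biUnion C = {(u : ℕ) + 1} := by
      rw [hC, Finset.sdiff_eq_self_iff_disjoint, Finset.disjoint_singleton_left]
      simp only [hC, Finset.mem_biUnion, Finset.mem_singleton, not_exists, not_and]
      intro v hv h
      obtain rfl : u = v := Fin.ext (by omega)
      exact hu hv
    rw [h]
    simp
    exact hε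

/-! ### Word length and asymptotic estimates. -/

namespace WordRAM

/-- Every quantity is polynomial in `N = zkq`, and `N ≥ 4` absorbs constants into powers of `N`. The
largest exponent, `14`, comes from the code length; the rest of `20` leaves room for sums of several
terms. -/
theorem wordBound {z k p q K κ m M : ℕ} (hP : CodeParams z k p q K κ m M) :
    WordBound ((z * k * q) ^ 20) z k p q K m M := by
  obtain ⟨hz, hk⟩ := hP.pos
  have hn := hP.two_le
  have hp := hP.num_pos
  have hpq := hP.num_lt
  obtain ⟨N, hN⟩ : ∃ N, N = z * k * q := ⟨_, rfl⟩
  have hN4 : 4 ≤ N := by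
    rw [hN]
    exact Nat.mul_le_mul hn (by omega : 2 ≤ q)
  have hnN : z * k ≤ N := hN ▸ Nat.le_mul_of_pos_right _ (by omega)
  have hqN : q ≤ N := hN ▸ Nat.le_mul_of_pos_left _ (by omega)
  have hzN : z ≤ N := (Nat.le_mul_of_pos_right z hk).trans hnN
  have hkN : k ≤ N := (Nat.le_mul_of_pos_left k hz).trans hnN
  have hK : K ≤ N ^ 2 := by
    have := hP.leaves_lt
    rw [sq]
    exact (by omega : K ≤ 4 * k).trans (Nat.mul_le_mul hN4 hkN)
  have h2m : 2 ^ m ≤ N ^ 2 := by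
    have := hP.lt_univ
    rw [sq]
    exact (by omega : 2 ^ m ≤ 4 * (z * k)).trans (Nat.mul_le_mul hN4 hnN)
  have hm : m + 2 ≤ N ^ 2 := by
    have h1 : m < 2 ^ m := Nat.lt_two_pow_self
    have := hP.lt_univ
    rw [sq]
    exact (by omega : m + 2 ≤ 4 * (z * k)).trans (Nat.mul_le_mul hN4 hnN)
  have hMN : 2 * M ≤ N ^ 6 := by
    have h1 : M ≤ (m + 2) * (m + 2) * q := hP.bound_eq ▸ Nat.div_le_self _ _
    have h2 : (m + 2) * (m + 2) * q ≤ N ^ 2 * N ^ 2 * N :=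
      Nat.mul_le_mul (Nat.mul_le_mul hm hm) hqN
    calc 2 * M ≤ N * (N ^ 2 * N ^ 2 * N) := Nat.mul_le_mul (by omega) (h1.trans h2)
      _ = N ^ 6 := by ring
  have hP14 {e x : ℕ} (he : e ≤ 14) (hx : x ≤ N ^ e) : x ≤ N ^ 14 :=
    hx.trans (Nat.pow_le_pow_right (by omega) he)
  have h16 : 16 * N ^ 14 ≤ N ^ 20 := by
    calc 16 * N ^ 14 ≤ N ^ 2 * N ^ 14 := Nat.mul_le_mul_right _ (Nat.pow_le_pow_left hN4 2)
      _ = N ^ 16 := by rw [← pow_add]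
      _ ≤ N ^ 20 := Nat.pow_le_pow_right (by omega) (by omega)
  have hN1 : N ≤ N ^ 14 := hP14 (e := 1) (by omega) (pow_one N).ge
  have hzK : 4 * z * K ≤ N ^ 4 := by
    calc 4 * z * K ≤ N * N * N ^ 2 := Nat.mul_le_mul (Nat.mul_le_mul hN4 hzN) hK
      _ = N ^ 4 := by ring
  have e1 := hP14 (by omega) h2m
  have e2 := hP14 (by omega) hm
  have e3 := hP14 (by omega) hMN
  have e4 := hP14 (by omega) hzK
  have e5 : K * (2 * M) * (2 * M) ≤ N ^ 14 := by
    calc K * (2 * M) * (2 * M) ≤ N ^ 2 * N ^ 6 * N ^ 6 :=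
          Nat.mul_le_mul (Nat.mul_le_mul hK hMN) hMN
      _ = N ^ 14 := by ring
  have e6 : (4 + z + z * k) * z ≤ N ^ 14 := by
    refine hP14 (e := 3) (by omega) ?_
    calc (4 + z + z * k) * z ≤ (4 * N) * N := Nat.mul_le_mul (by omega) hzN
      _ ≤ (N * N) * N := Nat.mul_le_mul_right _ (Nat.mul_le_mul_right _ hN4)
      _ = N ^ 3 := by ring
  have e7 : 2 * K * z ≤ 4 * z * K := by nlinarith
  have e8 : z * k * (2 * M) ≤ N ^ 14 := by
    refine hP14 (e := 7) (by omega) ?_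
    calc z * k * (2 * M) ≤ N * N ^ 6 := Nat.mul_le_mul hnN hMN
      _ = N ^ 7 := by ring
  have e9 : z * (K * K) ≤ N ^ 14 := by
    refine hP14 (e := 5) (by omega) ?_
    calc z * (K * K) ≤ N * (N ^ 2 * N ^ 2) := Nat.mul_le_mul hzN (Nat.mul_le_mul hK hK)
      _ = N ^ 5 := by ring
  rw [← hN]
  constructor <;> omega

/-- The initial state of the construction is within the word bound. -/
theorem initial_lt {z k X : ℕ} {p q : ℕ} {A : ℕ → List ℕ} (hAk : ∀ i < z, (A i).length ≤ k)
    (hAn : ∀ i < z, ∀ u ∈ A i, u < z * k) (hX : p + q + z + k + z * k + 4 < X) :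
    ∀ x ∈ z :: k :: p :: q :: inputFrom z A 0, x < X := by
  intro x hx
  simp only [List.mem_cons, inputFrom, List.mem_flatMap, List.mem_range'_1] at hx
  rcases hx with rfl | rfl | rfl | rfl | ⟨i, hi, rfl | hx⟩
  · omega
  · omega
  · omega
  · omega
  · have := hAk i (by omega)
    omega
  · have := hAn i (by omega) x hx
    omega

theorem State.initial_below {input : List ℕ} {X : ℕ} (hX : 0 < X) (h : ∀ x ∈ input, x < X) :
    (State.initial input).Below X := by
  refine ⟨fun _ => hX, fun a => ?_⟩
  simp only [State.initial, List.getD_eq_getElem?_getD]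
  rcases lt_or_ge a input.length with ha | ha
  · simpa [ha] using h _ (List.getElem_mem ha)
  · simpa [List.getElem?_eq_none ha] using hX

/-! ### Asymptotic bounds -/

theorem CodeParams.log_bounds {z k p q K κ m M : ℕ} (hP : CodeParams z k p q K κ m M) {ε : ℝ}
    (hε : ε = (p : ℝ) / (q : ℝ)) :
    0.69 ≤ Real.log (z * k : ℕ) ∧ 1 < ε⁻¹ ∧
      (M : ℝ) ≤ 36 * (ε⁻¹ * Real.log (z * k : ℕ) ^ 2) := by
  have hn : (2 : ℝ) ≤ (z * k : ℕ) := by exact_mod_cast hP.two_le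
  have hp : (0 : ℝ) < p := by exact_mod_cast hP.num_pos
  have hpq : (p : ℝ) < q := by exact_mod_cast hP.num_lt
  have h2 := Real.log_two_gt_d9
  have hlog : Real.log 2 ≤ Real.log (z * k : ℕ) := Real.log_le_log (by norm_num) hn
  have hm : (m : ℝ) * Real.log 2 ≤ Real.log 2 + Real.log (z * k : ℕ) := by
    rw [← Real.log_pow, ← Real.log_mul (by norm_num) (by linarith)]
    refine Real.log_le_log (by positivity) ?_
    exact_mod_cast hP.lt_univ.le
  -- From `m log 2 ≤ log 2 + log n` and `log n ≥ log 2` one gets `m + 2 ≤ 4 log n / log 2`, and `4 /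
  -- log 2 < 6`.
  have hm2 : (m : ℝ) + 2 ≤ 6 * Real.log (z * k : ℕ) := by nlinarith
  have hinv : ε⁻¹ = (q : ℝ) / p := by rw [hε, inv_div]
  refine ⟨by linarith, by rw [hinv, one_lt_div hp]; exact hpq, ?_⟩
  have hM : (M : ℝ) ≤ ((m : ℝ) + 2) * (m + 2) * q / p := by
    rw [← hP.bound_eq]
    refine Nat.cast_div_le.trans (le_of_eq ?_)
    push_cast
    ring
  calc (M : ℝ) ≤ ((m : ℝ) + 2) * (m + 2) * (q / p) := by rw [← mul_div_assoc]; exact hM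
    _ ≤ (6 * Real.log (z * k : ℕ)) * (6 * Real.log (z * k : ℕ)) * (q / p) := by gcongr
    _ = 36 * (ε⁻¹ * Real.log (z * k : ℕ) ^ 2) := by rw [hinv]; ring

/-- The inequality `log y ≤ y`, applied to the fourth root of `x`. -/
theorem log_sq_le_sqrt {x : ℝ} (hx : 1 ≤ x) : Real.log x ^ 2 ≤ 16 * √x := by
  have h1 : Real.log x = 4 * Real.log √√x := by
    rw [Real.log_sqrt (Real.sqrt_nonneg _), Real.log_sqrt (by linarith)]
    ring
  have h2 : Real.log √√x ≤ √√x := Real.log_le_self (Real.sqrt_nonneg _)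
  have h3 : 0 ≤ Real.log √√x := by have := Real.log_nonneg hx; linarith
  calc Real.log x ^ 2 = 16 * Real.log √√x ^ 2 := by rw [h1]; ring
    _ ≤ 16 * √√x ^ 2 := by gcongr
    _ = 16 * √x := by rw [Real.sq_sqrt (Real.sqrt_nonneg _)]

end WordRAM

set_option maxHeartbeats 1000000 in
open WordRAM in
theorem mainTheorem1 :
    ∃ (P : WordRAM.Program) (c : ℕ),
      ∀ (z k p q : ℕ) (ε : ℝ) (S : Fin z → Finset (Fin (z * k)))
        (L : Fin z → List (Fin (z * k))),
        2 ≤ z * k → 0 < p → p < q → ε = (p : ℝ) / (q : ℝ) →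
        (∀ i, (S i).card ≤ k) →
        (∀ i, (L i).Nodup ∧ (L i).toFinset = S i) →
        ∃ (T s w ℓ : ℕ) (final : WordRAM.Config),
          WordRAM.RunsWithin P (encodeInput z k p q L) T s ((z * k * q) ^ c) ∧
          (T : ℝ) ≤ c * (ε⁻¹ * (z * k : ℕ) * Real.log (z * k : ℕ) ^ 2) ∧
          (s : ℝ) ≤ c * (ε⁻¹ * (z * k : ℕ) * Real.log (z * k : ℕ) ^ 2) ∧
          final = WordRAM.configAt P (WordRAM.initial (encodeInput z k p q L)) T ∧
          w = outputWeight final ∧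
          ℓ = outputLength final ∧
          IsSuperimposedCode S ((1 - ε) * w) ℓ w (outputCode final) ∧
          0 < w ∧
          (w : ℝ) ≤ c * (ε⁻¹ * Real.log (z * k : ℕ) ^ 2) ∧
          (ℓ : ℝ) ≤ c * (ε⁻¹ ^ 2 * k * Real.log (z * k : ℕ) ^ 5) := by
  -- The structured program needs words below `(zkq) ^ 20`, and compilation raises this to the power
  -- `construction.deg`. The other summand absorbs the constants in time, space, weight and length.
  refine ⟨construction.compile 0, 20 * construction.deg + 10000000, ?_⟩
  intro z k p q ε S L hn hp hpq hε hS hL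
  have hP := CodeParams.exists_of hn hp hpq
  obtain ⟨κ, hκ⟩ : ∃ κ, κ = Nat.clog 2 (2 * k) := ⟨_, rfl⟩
  obtain ⟨m, hm⟩ : ∃ m, m = Nat.clog 2 (z * k) := ⟨_, rfl⟩
  rw [← hκ, ← hm] at hP
  obtain ⟨K, hK⟩ : ∃ K, K = 2 ^ κ := ⟨_, rfl⟩
  obtain ⟨M, hM⟩ : ∃ M, M = (m + 2) * (m + 2) * q / p := ⟨_, rfl⟩
  rw [← hK, ← hM] at hP
  have hW := wordBound hP
  obtain ⟨hz, hk⟩ := hP.pos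
  have hA (i : ℕ) (hi : i < z) : (setList L i).Nodup := by
    rw [setList_of_lt L hi]
    exact (hL ⟨i, hi⟩).1.map Fin.val_injective
  have hAS (i : Fin z) : (setList L i).toFinset = (S i).map Fin.valEmbedding := by
    rw [setList_of_lt L i.2, ← (hL i).2]
    ext x
    simp
  have hAk (i : ℕ) (hi : i < z) : (setList L i).length ≤ k := by
    rw [← List.toFinset_card_of_nodup (hA i hi), hAS ⟨i, hi⟩, Finset.card_map]
    exact hS _
  have hAn (i : ℕ) (hi : i < z) (u : ℕ) (hu : u ∈ setList L i) : u < z * k := by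
    rw [setList_of_lt L hi, List.mem_map] at hu
    obtain ⟨x, -, rfl⟩ := hu
    exact x.2
  have hin := initial_lt hAk hAn hW.input
  obtain ⟨t, σ, hE, hpost⟩ := runs_construction hP hW hκ hm hA hAk hAn
    (State.initial_below (by have := hW.input; omega) hin) rfl
  have hNpos : 0 < z * k * q := Nat.mul_pos (Nat.mul_pos hz hk) (by omega)
  have hlen : (z :: k :: p :: q :: inputFrom z (setList L) 0).length ≤
      4 + z + z * k + z * k + 2 * K * z + z * k * (2 * M) := by
    have := length_inputFrom_le hAk
    simp only [List.length_cons]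
    omega
  obtain ⟨hrun, hmatch⟩ := hE.runsWithin (W := (z * k * q) ^ (20 * construction.deg + 10000000))
    (by have := hW.input; omega) hin hlen
    (by rw [← pow_mul]; exact Nat.pow_le_pow_right hNpos (by omega))
    (Nat.pow_le_pow_right hNpos (by omega))
  rw [← encodeInput_eq] at hrun hmatch
  generalize hc : configAt (construction.compile 0) (initial (encodeInput z k p q L)) t = final
    at hmatch
  obtain ⟨hlog, hinv, hMr⟩ := hP.log_bounds hε
  have hdeg : (10000000 : ℝ) ≤ ((20 * construction.deg + 10000000 : ℕ) : ℝ) := by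
    exact_mod_cast Nat.le_add_left _ _
  generalize ((20 * construction.deg + 10000000 : ℕ) : ℝ) = c at hdeg
  have hw : outputWeight final = σ.reg .weight := hmatch.reg .weight
  have hl : outputLength final = σ.reg .length := hmatch.reg .length
  have hb : final.reg 2 = σ.reg .base := hmatch.reg .base
  have hcode (u : Fin (z * k)) : outputCode final u =
      (Finset.range (σ.reg .weight)).image fun j => σ.mem (σ.reg .base + u * σ.reg .weight + j) := by
    rw [outputCode, hw, hb, hmatch.mem]
  have hn1 : (2 : ℝ) ≤ (z * k : ℕ) := by exact_mod_cast hn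
  have hk1 : (1 : ℝ) ≤ k := by exact_mod_cast hk
  have hε0 : 0 ≤ ε := by rw [hε]; positivity
  obtain ⟨n, hnn⟩ : ∃ n : ℝ, n = (z * k : ℕ) := ⟨_, rfl⟩
  obtain ⟨l, hll⟩ : ∃ l, l = Real.log (z * k : ℕ) := ⟨_, rfl⟩
  obtain ⟨E, hEE⟩ : ∃ E, E = ε⁻¹ := ⟨_, rfl⟩
  obtain ⟨B, hB⟩ : ∃ B, B = E * l ^ 2 := ⟨_, rfl⟩
  have hEq : E = (q : ℝ) / p := by rw [hEE, hε, inv_div]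
  have hp0 : (0 : ℝ) < p := by exact_mod_cast hp
  rw [← hll] at hlog
  rw [← hEE] at hinv
  rw [← hll, ← hEE, ← hB] at hMr
  rw [← hnn] at hn1
  -- Lower-order terms can be absorbed into `B = ε⁻¹ log² n`, since `ε⁻¹ > 1` and `3 * 0.69² > 1`.
  have hB1 : 1 ≤ 3 * B := by rw [hB]; nlinarith
  have hnB : n ≤ 3 * (n * B) := by nlinarith
  have hnB' : E * n * l ^ 2 = n * B := by rw [hB]; ring
  rw [← hll, ← hEE, ← hnn, hnB', ← hB]
  have hs : ((4 + z + z * k + z * k + 2 * K * z + z * k * (2 * M) : ℕ) : ℝ) ≤ c * (n * B) := by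
    have h1 : 4 + z + z * k + z * k + 2 * K * z + z * k * (2 * M) ≤
        13 * (z * k) + 2 * (z * k) * M := by
      have h2 : z ≤ z * k := Nat.le_mul_of_pos_right z hk
      have h3 : 2 * K * z ≤ 8 * (z * k) := by
        have := hP.leaves_lt
        calc 2 * K * z ≤ 2 * (4 * k) * z := by gcongr
          _ = 8 * (z * k) := by ring
      have h4 : z * k * (2 * M) = 2 * (z * k) * M := by ring
      omega
    have h2 : ((4 + z + z * k + z * k + 2 * K * z + z * k * (2 * M) : ℕ) : ℝ) ≤
        13 * n + 2 * n * M := by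
      rw [hnn]
      exact_mod_cast h1
    nlinarith [mul_le_mul_of_nonneg_left hMr (by linarith : 0 ≤ 2 * n)]
  have hnB0 : 0 ≤ n * B := by nlinarith
  have hE2 : E ^ 2 = (q * q : ℕ) / (p * p : ℕ) := by
    rw [hEq]
    push_cast
    ring
  have hpp : (0 : ℝ) < (p * p : ℕ) := by exact_mod_cast Nat.mul_pos hp hp
  rcases hpost with ⟨hlarge, ht, g1, g2, g3, g4⟩ |
    ⟨hsmall, Q, b, f, hQ, hMQ, hQM, ht, g1, g2, g3, g4, g5, g6⟩
  · have hEn : n ≤ E ^ 2 := by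
      rw [hE2, le_div_iff₀ hpp, hnn]
      exact_mod_cast (mul_comm _ _).trans_le hlarge
    refine ⟨t, _, 1, z * k, final, hrun, ?_, hs, hc.symm, by rw [hw, g1], by rw [hl, g2],
      isSuperimposedCode_singleton (fun u => ?_) hε0, one_pos, ?_, ?_⟩
    · have h1 : (t : ℝ) ≤ 50 * n := by rw [hnn]; exact_mod_cast ht
      nlinarith
    · rw [hcode, g1, g3]
      simp [g4 u u.2]
    · push_cast
      nlinarith
    · rw [← hnn]
      have h1 : (0.69 : ℝ) ^ 5 ≤ l ^ 5 := pow_le_pow_left₀ (by norm_num) hlog 5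
      have h2 : (0.1 : ℝ) ≤ k * l ^ 5 := by nlinarith
      calc n ≤ E ^ 2 := hEn
        _ ≤ c * (E ^ 2 * 0.1) := by nlinarith
        _ ≤ c * (E ^ 2 * (k * l ^ 5)) := by gcongr
        _ = c * (E ^ 2 * k * l ^ 5) := by ring
  · have hEn : E ≤ √n := by
      refine Real.le_sqrt_of_sq_le ?_
      rw [hE2, div_le_iff₀ hpp, hnn]
      exact_mod_cast hsmall.le.trans_eq (mul_comm _ _)
    -- This makes `Q = O(n)`, so that the prime search in `O(Q²)` steps is within `O(nQ)`.
    have hBn : B ≤ 16 * n := by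
      have h1 : l ^ 2 ≤ 16 * √n := by
        rw [hll, ← hnn]
        exact log_sq_le_sqrt (by linarith)
      calc B = E * l ^ 2 := hB
        _ ≤ √n * (16 * √n) := by gcongr
        _ = 16 * (√n * √n) := by ring
        _ = 16 * n := by rw [Real.mul_self_sqrt (by linarith)]
    have hQB : (Q : ℝ) ≤ 72 * B := by
      have h1 : (Q : ℝ) ≤ 2 * M := by exact_mod_cast hQM
      linarith
    have hQ0 : (0 : ℝ) ≤ Q := by positivity
    refine ⟨t, _, Q, K * Q * Q, final, hrun, ?_, hs, hc.symm, by rw [hw, g1], by rw [hl, g2],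
      isSuperimposedCode_of_hashedSymbol hQ (fun u => ?_) g4 hP.univ_le (fun i v hv1 hv2 => ?_) ?_,
      hQ.pos, ?_, ?_⟩
    · have h1 : (t : ℝ) ≤ 430 * (n * Q) + 40 * (Q * Q) := by rw [hnn]; exact_mod_cast ht
      have h2 : n * Q ≤ n * (72 * B) := by gcongr
      have h3 : (Q : ℝ) * Q ≤ 72 * B * (72 * (16 * n)) :=
        mul_le_mul hQB (hQB.trans (by linarith)) hQ0 (by linarith)
      have h4 : 10000000 * (n * B) ≤ c * (n * B) := mul_le_mul_of_nonneg_right hdeg hnB0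
      linarith
    · rw [hcode, g1, g3]
      refine Finset.image_congr fun r hr => ?_
      exact g6 u u.2 r (by simpa using hr)
    · have h1 := g5 i i.2 v hv1 hv2
      rw [hAS, Finset.filter_map, Finset.card_map] at h1
      have h2 : ((S i).filter fun x : Fin (z * k) => f x = v) =
          (S i).filter ((fun x => x < z * k ∧ f x = v) ∘ Fin.valEmbedding) := by
        refine Finset.filter_congr fun x _ => ?_
        simp
      rw [h2]
      -- A load `b` satisfies `2 ^ b ≤ 2zK < 8zk ≤ 2 ^ (m + 3)`, hence `b ≤ m + 2`.
      refine Nat.le_of_lt_succ ((Nat.pow_lt_pow_iff_right (by omega : 1 < 2)).mp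
        (h1.trans_lt ?_))
      have h3 := hP.leaves_lt
      have h4 : 2 * z * K ≤ 8 * (z * k) := by
        calc 2 * z * K ≤ 2 * z * (4 * k) := by gcongr
          _ = 8 * (z * k) := by ring
      have h5 := hP.univ_le
      have h6 : 2 * z * K < 2 * z * (4 * k) := Nat.mul_lt_mul_of_pos_left h3 (by omega)
      have h7 : 2 * z * (4 * k) = 8 * (z * k) := by ring
      have h8 : 2 ^ (m + 2).succ = 8 * 2 ^ m := by rw [Nat.succ_eq_add_one]; ring
      omega
    -- As `M` is a floor, `M < Q` gives `(m + 2)² q < Q p`, which is the required `(m + 2)² ≤ εQ`.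
    · rw [← hP.bound_eq, Nat.div_lt_iff_lt_mul hp] at hMQ
      have h1 : (((m + 2) * (m + 2) : ℕ) : ℝ) * q ≤ Q * p := by exact_mod_cast hMQ.le
      rw [hε, div_mul_eq_mul_div, le_div_iff₀ (by exact_mod_cast hp.trans hpq)]
      linarith
    · have h1 : 10000000 * B ≤ c * B := mul_le_mul_of_nonneg_right hdeg (by linarith)
      linarith
    · have hK4 : (K : ℝ) ≤ 4 * k := by exact_mod_cast hP.leaves_lt.le
      have hB0 : 0 ≤ B := by linarith
      have h1 : (K : ℝ) * Q * Q ≤ 4 * k * (72 * B) * (72 * B) := by gcongr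
      have h2 : 4 * k * (72 * B) * (72 * B) = 20736 * (E ^ 2 * k * l ^ 4) := by rw [hB]; ring
      -- The construction needs only four logarithmic factors; the fifth is introduced through `1 ≤
      -- 2 log n`.
      have h3 : E ^ 2 * k * l ^ 4 ≤ 2 * (E ^ 2 * k * l ^ 5) := by
        calc E ^ 2 * k * l ^ 4 = E ^ 2 * k * l ^ 4 * 1 := by ring
          _ ≤ E ^ 2 * k * l ^ 4 * (2 * l) := by gcongr; linarith
          _ = 2 * (E ^ 2 * k * l ^ 5) := by ring
      have h4 : 10000000 * (E ^ 2 * k * l ^ 5) ≤ c * (E ^ 2 * k * l ^ 5) := by gcongr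
      have h5 : 0 ≤ E ^ 2 * k * l ^ 5 := by positivity
      push_cast
      linarith
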